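/- Let $M$ be a smooth manifold (Hausdorff, second countable, without boundary) and let $\mathcal F$ be a smooth foliation of codimension $2$ on $M$. Say that $\mathcal F$ is transversely Minkowski (resp. transversely de Sitter) if it has a transverse $(\mathrm{Isom}(X),X)$-structure, where $X$ is the Minkowski plane $(\mathbb R^2,-dx_0^2+dx_1^2)$ (resp. the de Sitter surface $\{-x_0^2+x_1^2+x_2^2=1\}\subset\mathbb R^3$ with the metric induced by $-dx_0^2+dx_1^2+dx_2^2$): $M$ is covered by open sets $U_i$ with submersions $f_i:U_i\to X$ such that $T\mathcal F=\ker df_i$ on $U_i$ and, near every point of $U_i\cap U_j$, $f_j=g\circ f_i$ for some isometry $g$ of $X$. Consider the following condition on $\mathcal F$: there are three smooth $1$-forms $\omega_0,\omega_1,\omega_2$ on $M$ such that $$T\mathcal F=\ker\omega_1\cap\ker\omega_2,\qquad d\omega_1=\omega_1\wedge\omega_0,\qquad d\omega_2=-\omega_2\wedge\omega_0,\qquad d\omega_0=0\ \ (\text{resp. } d\omega_0=\omega_1\wedge\omega_2).\tag{$*$}$$ (1) If $\mathcal F$ satisfies $(*)$, then $\mathcal F$ is transversely Minkowski (resp. de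 Sitter). (2) If $\mathcal F$ is transversely Minkowski (resp. de Sitter), then there is a smooth covering $p:N\to M$ all of whose fibres have $1$, $2$ or $4$ elements, with $N$ connected if $M$ is, such that the pulled-back foliation $p^*\mathcal F$ satisfies $(*)$ on $N$. -/

import Mathlib

open Set Filter Topology
open scoped Manifold ContDiff

noncomputable section

universe u

namespace TransverseGeometry

section Forms

variable {E : Type*} [NormedAddCommGroup E] [NormedSpace ℝ E]

/-- Smooth differential `1`-forms on a manifold `M` without boundary modelled on `E`:
smooth sections of the cotangent bundle. -/
abbrev OneForm (E : Type*) [NormedAddCommGroup E] [NormedSpace ℝ E]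
    (M : Type*) [TopologicalSpace M] [ChartedSpace E M] [IsManifold 𝓘(ℝ, E) ∞ M] : Type _ :=
  ContMDiffSection 𝓘(ℝ, E) (E →L[ℝ] ℝ) ∞
    (fun x : M => TangentSpace 𝓘(ℝ, E) x →L[ℝ] Bundle.Trivial M ℝ x)

variable {M : Type*} [TopologicalSpace M] [ChartedSpace E M] [IsManifold 𝓘(ℝ, E) ∞ M]

/-- The value of a `1`-form at a point, as a linear form on the tangent space. -/
def OneForm.at (α : OneForm E M) (x : M) : TangentSpace 𝓘(ℝ, E) x →L[ℝ] ℝ := α x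

/-- The wedge product of two `1`-forms, `(α ∧ β)(v, w) = α v * β w - α w * β v`. -/
def OneForm.wedge (α β : OneForm E M) (x : M) (v w : TangentSpace 𝓘(ℝ, E) x) : ℝ :=
  α.at x v * β.at x w - α.at x w * β.at x v

/-- The expression of a `1`-form in the chart around `x₀`: its pull-back by the inverse chart,
a `1`-form on (an open subset of) the vector space `E`. -/
def OneForm.inChart (α : OneForm E M) (x₀ : M) (y : E) (w : TangentSpace 𝓘(ℝ, E) y) : ℝ :=
  α.at ((extChartAt 𝓘(ℝ, E) x₀).symm y)
    (mfderiv 𝓘(ℝ, E) 𝓘(ℝ, E) (extChartAt 𝓘(ℝ, E) x₀).symm y w)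

/-- The exterior derivative of a `1`-form at `x`, computed in the chart around `x`, where
`dα (v, w) = ∂_v (α w) - ∂_w (α v)` for constant vector fields `v`, `w`. -/
def OneForm.d (α : OneForm E M) (x : M) (v w : TangentSpace 𝓘(ℝ, E) x) : ℝ :=
  let v' : E := mfderiv 𝓘(ℝ, E) 𝓘(ℝ, E) (extChartAt 𝓘(ℝ, E) x) x v
  let w' : E := mfderiv 𝓘(ℝ, E) 𝓘(ℝ, E) (extChartAt 𝓘(ℝ, E) x) x w
  fderiv ℝ (fun y : E => α.inChart x y w') (extChartAt 𝓘(ℝ, E) x x) v' -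
    fderiv ℝ (fun y : E => α.inChart x y v') (extChartAt 𝓘(ℝ, E) x x) w'

end Forms

section Foliations

/-- A smooth foliation of codimension `q` of the manifold `M`, given by its tangent distribution
`TF`, which has to be integrable: around every point there is a submersion to `ℝ^q` whose level
sets are tangent to `TF`, i.e. are the local leaves. -/
structure Foliation (E : Type*) [NormedAddCommGroup E] [NormedSpace ℝ E]
    (M : Type*) [TopologicalSpace M] [ChartedSpace E M] (q : ℕ) where
  /-- The tangent space of the leaf through a point. -/
  tangent : ∀ x : M, Submodule ℝ (TangentSpace 𝓘(ℝ, E) x)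
  exists_submersion : ∀ x : M, ∃ (U : Set M) (f : M → (Fin q → ℝ)), IsOpen U ∧ x ∈ U ∧
    ContMDiffOn 𝓘(ℝ, E) 𝓘(ℝ, Fin q → ℝ) ∞ f U ∧
    ∀ y ∈ U, Function.Surjective (mfderiv 𝓘(ℝ, E) 𝓘(ℝ, Fin q → ℝ) f y) ∧
      ∀ v : TangentSpace 𝓘(ℝ, E) y,
        v ∈ tangent y ↔ mfderiv 𝓘(ℝ, E) 𝓘(ℝ, Fin q → ℝ) f y v = 0

variable {E : Type*} [NormedAddCommGroup E] [NormedSpace ℝ E]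
  {M : Type*} [TopologicalSpace M] [ChartedSpace E M]
  {N : Type*} [TopologicalSpace N] [ChartedSpace E N]

/-- The pull-back of a foliation by a local diffeomorphism `p`, whose tangent distribution is the
preimage of `TF` by the differential of `p`. -/
def Foliation.pullback {q : ℕ} (F : Foliation E M q) (p : N → M)
    (hp : IsLocalDiffeomorph 𝓘(ℝ, E) 𝓘(ℝ, E) ∞ p) : Foliation E N q where
  tangent x := (F.tangent (p x)).comap
    ((mfderiv 𝓘(ℝ, E) 𝓘(ℝ, E) p x : TangentSpace 𝓘(ℝ, E) x →L[ℝ] TangentSpace 𝓘(ℝ, E) (p x)) :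
      TangentSpace 𝓘(ℝ, E) x →ₗ[ℝ] TangentSpace 𝓘(ℝ, E) (p x))
  exists_submersion x := by
    obtain ⟨U, f, hU, hxU, hf, h⟩ := F.exists_submersion (p x)
    have hne : (∞ : WithTop ℕ∞) ≠ 0 := by simp
    refine ⟨p ⁻¹' U, f ∘ p, hU.preimage hp.contMDiff.continuous, hxU,
      hf.comp hp.contMDiff.contMDiffOn subset_rfl, fun y hy => ?_⟩
    obtain ⟨hs, hk⟩ := h (p y) hy
    have hfd : MDifferentiableAt 𝓘(ℝ, E) 𝓘(ℝ, Fin q → ℝ) f (p y) :=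
      (hf.contMDiffAt (hU.mem_nhds hy)).mdifferentiableAt hne
    have hc := mfderiv_comp y hfd (hp.mdifferentiable hne y)
    rw [hc]
    refine ⟨hs.comp ?_, fun v => hk _⟩
    have hb := (hp.mfderivToContinuousLinearEquiv hne y).surjective
    intro w
    obtain ⟨v, hv⟩ := hb w
    refine ⟨v, ?_⟩
    rw [← hv, ← hp.mfderivToContinuousLinearEquiv_coe hne y]
    rfl

/-- A transverse `(G, X)`-structure on a foliation of codimension `q`, where `X` is a
`q`-dimensional submanifold of the vector space `V` and the elements of the group `G` of
diffeomorphisms of `X` are given as maps of `V`: an atlas of pairs `(U, f)`, with `f` a smooth map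
from the open set `U` to `X` whose level sets are the local leaves (so that `f` is a submersion
to `X`, the codimension being the dimension of `X`), any two of which differ, locally on the
intersection of their domains, by an element of `G`. -/
def Foliation.HasTransverseStructure {q : ℕ} (F : Foliation E M q)
    {V : Type*} [NormedAddCommGroup V] [NormedSpace ℝ V] (X : Set V) (G : Set (V → V)) : Prop :=
  ∃ A : Set (Set M × (M → V)),
    (∀ x : M, ∃ c ∈ A, x ∈ c.1) ∧
    (∀ c ∈ A, IsOpen c.1 ∧ ContMDiffOn 𝓘(ℝ, E) 𝓘(ℝ, V) ∞ c.2 c.1 ∧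
      ∀ x ∈ c.1, c.2 x ∈ X ∧
        ∀ v : TangentSpace 𝓘(ℝ, E) x, v ∈ F.tangent x ↔ mfderiv 𝓘(ℝ, E) 𝓘(ℝ, V) c.2 x v = 0) ∧
    (∀ c ∈ A, ∀ c' ∈ A, ∀ x ∈ c.1 ∩ c'.1, ∃ g ∈ G, ∀ᶠ y in 𝓝 x, c'.2 y = g (c.2 y))

end Foliations

section Models

/-- The Lorentzian quadratic form `-x₀² + x₁² + ⋯ + x_m²` on `ℝ^(m+1)`. -/
def lorentzForm (m : ℕ) : QuadraticForm ℝ (Fin (m + 1) → ℝ) :=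
  QuadraticMap.weightedSumSquares ℝ (Fin.cons (-1) (fun _ => 1) : Fin (m + 1) → ℝ)

/-- The isometries of the Minkowski plane `(ℝ², -dx₀² + dx₁²)`: the affine maps of `ℝ²` with
linear part in `O(1,1)`. -/
def minkowskiIsometries : Set ((Fin 2 → ℝ) → (Fin 2 → ℝ)) :=
  {g | ∃ (A : (lorentzForm 1).IsometryEquiv (lorentzForm 1)) (b : Fin 2 → ℝ),
    ∀ x, g x = A x + b}

/-- The de Sitter surface: the hyperboloid `-x₀² + x₁² + x₂² = 1` of `ℝ³`, with the Lorentzian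
metric induced by `-dx₀² + dx₁² + dx₂²`. -/
def deSitterSurface : Set (Fin 3 → ℝ) := {x | lorentzForm 2 x = 1}

/-- The isometries of the de Sitter surface: the restrictions of the linear maps in `O(1,2)`. -/
def deSitterIsometries : Set ((Fin 3 → ℝ) → (Fin 3 → ℝ)) :=
  {g | ∃ A : (lorentzForm 2).IsometryEquiv (lorentzForm 2), ∀ x, g x = A x}

end Models

section Definitions

variable {E : Type*} [NormedAddCommGroup E] [NormedSpace ℝ E]
  {M : Type*} [TopologicalSpace M] [ChartedSpace E M]

/-- A codimension `2` foliation is transversely Minkowski if it has a transverse structure modelled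
on the Minkowski plane and its isometry group. -/
def Foliation.IsTransverselyMinkowski (F : Foliation E M 2) : Prop :=
  F.HasTransverseStructure univ minkowskiIsometries

/-- A codimension `2` foliation is transversely de Sitter if it has a transverse structure modelled
on the de Sitter surface and its isometry group. -/
def Foliation.IsTransverselyDeSitter (F : Foliation E M 2) : Prop :=
  F.HasTransverseStructure deSitterSurface deSitterIsometries

/-- `ω₁` and `ω₂` define the foliation, `TF = ker ω₁ ∩ ker ω₂`, and satisfy, together with `ω₀`,
the equations `dω₁ = ω₁ ∧ ω₀` and `dω₂ = -ω₂ ∧ ω₀`. -/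
def Foliation.IsDefinedByForms [IsManifold 𝓘(ℝ, E) ∞ M] (F : Foliation E M 2)
    (ω₀ ω₁ ω₂ : OneForm E M) : Prop :=
  (∀ (x : M) (v : TangentSpace 𝓘(ℝ, E) x),
    v ∈ F.tangent x ↔ ω₁.at x v = 0 ∧ ω₂.at x v = 0) ∧
  (∀ (x : M) (v w : TangentSpace 𝓘(ℝ, E) x), ω₁.d x v w = ω₁.wedge ω₀ x v w) ∧
  (∀ (x : M) (v w : TangentSpace 𝓘(ℝ, E) x), ω₂.d x v w = -ω₂.wedge ω₀ x v w)

/-- The existence of the `1`-forms of the Minkowski case, where `dω₀ = 0`. -/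
def Foliation.HasMinkowskiForms [IsManifold 𝓘(ℝ, E) ∞ M] (F : Foliation E M 2) : Prop :=
  ∃ ω₀ ω₁ ω₂ : OneForm E M, F.IsDefinedByForms ω₀ ω₁ ω₂ ∧
    ∀ (x : M) (v w : TangentSpace 𝓘(ℝ, E) x), ω₀.d x v w = 0

/-- The existence of the `1`-forms of the de Sitter case, where `dω₀ = ω₁ ∧ ω₂`. -/
def Foliation.HasDeSitterForms [IsManifold 𝓘(ℝ, E) ∞ M] (F : Foliation E M 2) : Prop :=
  ∃ ω₀ ω₁ ω₂ : OneForm E M, F.IsDefinedByForms ω₀ ω₁ ω₂ ∧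
    ∀ (x : M) (v w : TangentSpace 𝓘(ℝ, E) x), ω₀.d x v w = ω₁.wedge ω₂ x v w

/-- The property `P` holds for the pull-back of the foliation `F` to some covering of `M` with one,
two or four sheets: there are a (Hausdorff, second countable) manifold `N`, connected if `M` is, and
a smooth covering map `p : N → M`, the number of sheets of which is `1`, `2` or `4`, such that
the pull-back of `F` by `p` satisfies `P`. -/
def Foliation.HoldsUpToFourCover {E : Type*} [NormedAddCommGroup E] [NormedSpace ℝ E]
    {M : Type u} [TopologicalSpace M] [ChartedSpace E M] (F : Foliation E M 2)
    (P : ∀ (N : Type u) [TopologicalSpace N] [ChartedSpace E N] [IsManifold 𝓘(ℝ, E) ∞ N],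
      Foliation E N 2 → Prop) : Prop :=
  ∃ (N : Type u) (_ : TopologicalSpace N) (_ : ChartedSpace E N) (_ : IsManifold 𝓘(ℝ, E) ∞ N)
    (p : N → M) (hp : IsLocalDiffeomorph 𝓘(ℝ, E) 𝓘(ℝ, E) ∞ p),
    T2Space N ∧ SecondCountableTopology N ∧ (ConnectedSpace M → ConnectedSpace N) ∧
    IsCoveringMap p ∧ (∀ x : M, Nat.card (p ⁻¹' {x}) ∣ 4) ∧ P N (F.pullback p hp)

end Definitions

end TransverseGeometry

end

noncomputable section

universe u

namespace TransverseGeometry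

/-! ### Exterior derivatives of pulled-back forms -/

section ExteriorDerivative

variable {E : Type*} [NormedAddCommGroup E] [NormedSpace ℝ E]
variable {M : Type*} [TopologicalSpace M] [ChartedSpace E M] [IsManifold 𝓘(ℝ, E) ∞ M]

/-! Both geometries are treated at once, with `κ = 0` for the Minkowski plane and `κ = 1` for the
unit quadric. Let `f` be a map to the model and `n₁, n₂` null vectors tangent to the model at `f`
with `⟨n₁, n₂⟩ = 1`. With ω₁ = ⟨df, n₂⟩, ω₂ = ⟨df, n₁⟩, ω₀ = ⟨dn₁, n₂⟩ the moving frame satisfies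
the linear system df = ω₁n₁ + ω₂n₂, dn₁ = ω₀n₁ - κω₂f, dn₂ = -ω₀n₂ - κω₁f, and the equations (*) are
the flatness equations of this system.

For (1), the flat system is solved locally (`exists_hasFDerivAt_of_flat`) by Picard iteration along
rays. The linear map carrying one solution to another is constant (`IsAdaptedOn.frameMap_eq`):
comparing a solution with itself shows that it remains a null frame, comparing two solutions shows
that their maps `f` differ by an isometry. These maps form the transverse atlas.

For (2), each model has a global smooth field of null frames, which every map of the atlas pulls
back. Up to an isometry, two such pulled-back frames differ at a point by a sign common to both
vectors, an exchange of them, and a positive scaling (t⁻¹, t), as in `exists_twist_sameDirections`.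
Sign and exchange form a group of order four and are locally constant, hence give a cocycle, which
becomes trivial on the associated principal covering; over a connected base one passes to a
component, whose fibres are as large as a subgroup. On the covering the local forms ω₁ agree up to
positive factors, a convex condition, so a partition of unity gives a global ω₁. It determines the
frame up to isometry (`right_eq_of_form₁_eq`), so ω₂ and ω₀ are global too, and (*) follows by
differentiation. -/

theorem OneForm.d_apply_of_eventually {V : Type*} [NormedAddCommGroup V] [NormedSpace ℝ V]
    (α : OneForm E M) {x : M} {φ : M → V} {a : V → V →L[ℝ] ℝ}
    (hφ : ContMDiffAt 𝓘(ℝ, E) 𝓘(ℝ, V) ∞ φ x) (ha : DifferentiableAt ℝ a (φ x))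
    (h : ∀ᶠ y in 𝓝 x, ∀ v : TangentSpace 𝓘(ℝ, E) y,
      α.at y v = a (φ y) (mfderiv 𝓘(ℝ, E) 𝓘(ℝ, V) φ y v))
    (v w : TangentSpace 𝓘(ℝ, E) x) :
    α.d x v w =
      fderiv ℝ a (φ x) (mfderiv 𝓘(ℝ, E) 𝓘(ℝ, V) φ x v) (mfderiv 𝓘(ℝ, E) 𝓘(ℝ, V) φ x w) -
      fderiv ℝ a (φ x) (mfderiv 𝓘(ℝ, E) 𝓘(ℝ, V) φ x w) (mfderiv 𝓘(ℝ, E) 𝓘(ℝ, V) φ x v) := by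
  set χ := extChartAt 𝓘(ℝ, E) x with hχ
  set Φ : E → V := φ ∘ χ.symm with hΦ
  have hne : (∞ : WithTop ℕ∞) ≠ 0 := by simp
  have hsymm : ∀ᶠ y in 𝓝 (χ x), ContMDiffAt 𝓘(ℝ, E) 𝓘(ℝ, E) ∞ χ.symm y := by
    filter_upwards [extChartAt_target_mem_nhds (I := 𝓘(ℝ, E)) x] with y hy
    exact (contMDiffOn_extChartAt_symm x).contMDiffAt
      ((isOpen_extChartAt_target x).mem_nhds hy)
  have htend : Tendsto χ.symm (𝓝 (χ x)) (𝓝 x) := by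
    have := (continuousAt_extChartAt_symm (I := 𝓘(ℝ, E)) x)
    rwa [ContinuousAt, extChartAt_to_inv] at this
  have hφ' : ∀ᶠ y in 𝓝 x, ContMDiffAt 𝓘(ℝ, E) 𝓘(ℝ, V) 1 φ y := by
    exact contMDiffAt_iff_contMDiffAt_nhds (by simp) |>.1 (hφ.of_le (by exact_mod_cast le_top))
  have hΦs : ContDiffAt ℝ ∞ Φ (χ x) := by
    rw [← contMDiffAt_iff_contDiffAt]
    refine ContMDiffAt.comp _ ?_ hsymm.self_of_nhds
    rwa [hχ, extChartAt_to_inv]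
  have hin : ∀ᶠ y in 𝓝 (χ x), ∀ w : E, α.inChart x y w = a (Φ y) (fderiv ℝ Φ y w) := by
    filter_upwards [htend.eventually h, htend.eventually hφ', hsymm] with y h1 h2 h3 w
    have := mfderiv_comp y (h2.mdifferentiableAt one_ne_zero) (h3.mdifferentiableAt hne)
    rw [← mfderiv_eq_fderiv, hΦ, this]
    exact h1 _
  have hdΦ : DifferentiableAt ℝ (fderiv ℝ Φ) (χ x) :=
    (hΦs.fderiv_right (m := 1) (WithTop.coe_le_coe.2 le_top)).differentiableAt (by simp)
  have hΦx : Φ (χ x) = φ x := by simp [hΦ, hχ]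
  have hd : ∀ u : E, HasFDerivAt (fun y => α.inChart x y u)
      ((a (φ x)).comp ((fderiv ℝ (fderiv ℝ Φ) (χ x)).flip u) +
        ((fderiv ℝ a (φ x)).comp (fderiv ℝ Φ (χ x))).flip (fderiv ℝ Φ (χ x) u)) (χ x) := by
    intro u
    have h1 : HasFDerivAt (fun y => a (Φ y)) ((fderiv ℝ a (φ x)).comp (fderiv ℝ Φ (χ x))) (χ x) := by
      rw [← hΦx] at ha ⊢
      exact ha.hasFDerivAt.comp _ (hΦs.differentiableAt hne).hasFDerivAt
    have h2 : HasFDerivAt (fun y => fderiv ℝ Φ y u) ((fderiv ℝ (fderiv ℝ Φ) (χ x)).flip u) (χ x) := by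
      simpa using hdΦ.hasFDerivAt.clm_apply (hasFDerivAt_const u (χ x))
    have h3 := h1.clm_apply h2
    rw [hΦx] at h3
    refine h3.congr_of_eventuallyEq ?_
    filter_upwards [hin] with y hy using hy u
  have hcomp : ∀ u : TangentSpace 𝓘(ℝ, E) x, fderiv ℝ Φ (χ x) (mfderiv 𝓘(ℝ, E) 𝓘(ℝ, E) χ x u)
      = mfderiv 𝓘(ℝ, E) 𝓘(ℝ, V) φ x u := by
    intro u
    have hm : MDifferentiableAt 𝓘(ℝ, E) 𝓘(ℝ, V) Φ (χ x) :=
      (hΦs.differentiableAt hne).mdifferentiableAt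
    have := mfderiv_comp x hm (mdifferentiableAt_extChartAt (mem_chart_source _ x))
    have e : Φ ∘ χ =ᶠ[𝓝 x] φ := by
      filter_upwards [extChartAt_source_mem_nhds (I := 𝓘(ℝ, E)) x] with y hy
      simp only [hΦ, Function.comp_apply]
      rw [χ.left_inv hy]
    rw [e.mfderiv_eq, mfderiv_eq_fderiv] at this
    rw [this]; rfl
  have key : ∀ v' w' : E, fderiv ℝ (fun y => α.inChart x y w') (χ x) v' -
      fderiv ℝ (fun y => α.inChart x y v') (χ x) w' =
      fderiv ℝ a (φ x) (fderiv ℝ Φ (χ x) v') (fderiv ℝ Φ (χ x) w') -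
      fderiv ℝ a (φ x) (fderiv ℝ Φ (χ x) w') (fderiv ℝ Φ (χ x) v') := by
    intro v' w'
    -- The second derivative of `Φ` is symmetric, so its contributions to the two terms cancel and
    -- only the derivative of `a` survives.
    have hsym := (hΦs.isSymmSndFDerivAt (by simp; exact WithTop.coe_le_coe.2 le_top)).eq v' w'
    rw [(hd _).fderiv, (hd _).fderiv]
    simp only [add_apply, ContinuousLinearMap.comp_apply,
      ContinuousLinearMap.flip_apply]
    rw [hsym]
    ring
  rw [← hcomp, ← hcomp]
  exact key _ _

end ExteriorDerivative

/-! ### Smoothness of forms and their expressions in charts -/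

section SmoothForms

variable {E : Type*} [NormedAddCommGroup E] [NormedSpace ℝ E]
variable {M : Type*} [TopologicalSpace M] [ChartedSpace E M] [IsManifold 𝓘(ℝ, E) ∞ M]
variable {V : Type*} [NormedAddCommGroup V] [NormedSpace ℝ V]

/-- The form is the pull-back by `(f, n)` of a form on `V × V` whose coefficients are linear in the
point, so the latter is its own derivative. All of ω₀, ω₁, ω₂ have this shape when they come from a
moving frame. -/
theorem OneForm.d_apply_of_pairing (α : OneForm E M) (B : V →L[ℝ] V →L[ℝ] ℝ) {x : M} {f n : M → V}
    (hf : ContMDiffAt 𝓘(ℝ, E) 𝓘(ℝ, V) ∞ f x) (hn : ContMDiffAt 𝓘(ℝ, E) 𝓘(ℝ, V) ∞ n x)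
    (h : ∀ᶠ y in 𝓝 x, ∀ v : TangentSpace 𝓘(ℝ, E) y,
      α.at y v = B (mfderiv 𝓘(ℝ, E) 𝓘(ℝ, V) f y v) (n y))
    (v w : TangentSpace 𝓘(ℝ, E) x) :
    α.d x v w =
      B (mfderiv 𝓘(ℝ, E) 𝓘(ℝ, V) f x w) (mfderiv 𝓘(ℝ, E) 𝓘(ℝ, V) n x v) -
      B (mfderiv 𝓘(ℝ, E) 𝓘(ℝ, V) f x v) (mfderiv 𝓘(ℝ, E) 𝓘(ℝ, V) n x w) := by
  let a : (V × V) →L[ℝ] (V × V) →L[ℝ] ℝ :=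
    ((ContinuousLinearMap.compL ℝ (V × V) V ℝ).flip (ContinuousLinearMap.fst ℝ V V)).comp
      (B.flip.comp (ContinuousLinearMap.snd ℝ V V))
  have ha : ∀ p q, a p q = B q.1 p.2 := fun p q => rfl
  have hφ : ContMDiffAt 𝓘(ℝ, E) 𝓘(ℝ, V × V) ∞ (fun y => (f y, n y)) x := hf.prodMk_space hn
  have hd : ∀ᶠ y in 𝓝 x, ∀ v : TangentSpace 𝓘(ℝ, E) y,
      mfderiv 𝓘(ℝ, E) 𝓘(ℝ, V × V) (fun y => (f y, n y)) y v =
      ((mfderiv 𝓘(ℝ, E) 𝓘(ℝ, V) f y v, mfderiv 𝓘(ℝ, E) 𝓘(ℝ, V) n y v) : V × V) := by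
    have h1 := contMDiffAt_iff_contMDiffAt_nhds (by simp) |>.1
      (hf.of_le (n := ∞) (m := 1) (by exact_mod_cast le_top))
    have h2 := contMDiffAt_iff_contMDiffAt_nhds (by simp) |>.1
      (hn.of_le (n := ∞) (m := 1) (by exact_mod_cast le_top))
    filter_upwards [h1, h2] with y h1 h2 v
    have h1 := (h1.mdifferentiableAt one_ne_zero).hasMFDerivAt
    have h2 := (h2.mdifferentiableAt one_ne_zero).hasMFDerivAt
    have e : HasMFDerivAt 𝓘(ℝ, E) 𝓘(ℝ, V × V) (fun y => (f y, n y)) y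
        ((mfderiv 𝓘(ℝ, E) 𝓘(ℝ, V) f y : E →L[ℝ] V).prod
          (mfderiv 𝓘(ℝ, E) 𝓘(ℝ, V) n y : E →L[ℝ] V)) := ⟨h1.1.prodMk h2.1, h1.2.prodMk h2.2⟩
    rw [e.mfderiv]; rfl
  have := α.d_apply_of_eventually (φ := fun y => (f y, n y)) (a := a) hφ a.differentiableAt
    (by filter_upwards [h, hd] with y h1 h2 v
        rw [h1, h2, ha]) v w
  rw [this, a.fderiv]
  exact congrArg₂ (· - ·)
    (congrArg₂ (fun p q : V × V => a p q) (hd.self_of_nhds v) (hd.self_of_nhds w))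
    (congrArg₂ (fun p q : V × V => a p q) (hd.self_of_nhds w) (hd.self_of_nhds v))

/-- The coefficients of a linear form on a tangent space in the trivialization around `x₀`. -/
def coeff (x₀ x : M) (β : TangentSpace 𝓘(ℝ, E) x →L[ℝ] ℝ) : E →L[ℝ] ℝ :=
  β.comp ((trivializationAt E (TangentSpace 𝓘(ℝ, E)) x₀).symmL ℝ x)

/-- Smoothness at a point of a field of linear forms, as a section of the cotangent bundle. -/
def SmoothFormAt (α : ∀ x : M, TangentSpace 𝓘(ℝ, E) x →L[ℝ] Bundle.Trivial M ℝ x) (x₀ : M) : Prop :=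
  ContMDiffAt 𝓘(ℝ, E) (𝓘(ℝ, E).prod 𝓘(ℝ, E →L[ℝ] ℝ)) ∞
    (fun x => Bundle.TotalSpace.mk' (E →L[ℝ] ℝ) x (α x)) x₀

theorem smoothFormAt_iff (α : ∀ x : M, TangentSpace 𝓘(ℝ, E) x →L[ℝ] Bundle.Trivial M ℝ x)
    {x₀ z : M} (hz : z ∈ (chartAt E x₀).source) : SmoothFormAt α z ↔
      ContMDiffAt 𝓘(ℝ, E) 𝓘(ℝ, E →L[ℝ] ℝ) ∞ (fun x => coeff x₀ x (α x)) z := by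
  have h := Bundle.Trivialization.contMDiffAt_section_iff (IB := 𝓘(ℝ, E)) (n := ∞)
    (F := E →L[ℝ] ℝ) (s := α) (x₀ := z)
    (e := trivializationAt (E →L[ℝ] ℝ)
      (fun x : M => TangentSpace 𝓘(ℝ, E) x →L[ℝ] Bundle.Trivial M ℝ x) x₀) (by simpa using hz)
  rw [SmoothFormAt, h]
  have : (fun x => coeff x₀ x (α x)) = fun x => (trivializationAt (E →L[ℝ] ℝ)
      (fun x : M => TangentSpace 𝓘(ℝ, E) x →L[ℝ] Bundle.Trivial M ℝ x) x₀ ⟨x, α x⟩).2 := by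
    funext x
    rw [hom_trivializationAt_apply]
    ext u
    simp [ContinuousLinearMap.inCoordinates, coeff]
  rw [this]

theorem smoothFormAt_pairing (B : V →L[ℝ] V →L[ℝ] ℝ) {x : M} {f n : M → V}
    (α : ∀ x : M, TangentSpace 𝓘(ℝ, E) x →L[ℝ] Bundle.Trivial M ℝ x)
    (hf : ContMDiffAt 𝓘(ℝ, E) 𝓘(ℝ, V) ∞ f x) (hn : ContMDiffAt 𝓘(ℝ, E) 𝓘(ℝ, V) ∞ n x)
    (h : ∀ᶠ y in 𝓝 x, ∀ v : TangentSpace 𝓘(ℝ, E) y,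
      α y v = B (mfderiv 𝓘(ℝ, E) 𝓘(ℝ, V) f y v) (n y)) : SmoothFormAt α x := by
  rw [smoothFormAt_iff α (mem_chart_source E x)]
  have h1 := hf.mfderiv_const (m := ∞) (by simp)
  have h2 : ContMDiffAt 𝓘(ℝ, E) 𝓘(ℝ, E →L[ℝ] ℝ) ∞ (fun y => (B.flip (n y)).comp
    (inTangentCoordinates 𝓘(ℝ, E) 𝓘(ℝ, V) id f (mfderiv 𝓘(ℝ, E) 𝓘(ℝ, V) f) x y)) x :=
    ContMDiffAt.clm_comp (B.flip.contMDiff.contMDiffAt.comp x hn) h1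
  refine h2.congr_of_eventuallyEq ?_
  filter_upwards [h] with y hy
  ext u
  simp only [coeff, inTangentCoordinates, ContinuousLinearMap.inCoordinates,
    ContinuousLinearMap.comp_apply, TangentBundle.continuousLinearMapAt_model_space]
  exact hy _

/-- Moves the structure equations to an open subset of `E`, where they can be integrated. -/
theorem OneForm.exists_chart_repr (α : OneForm E M) (x₀ : M) : ∃ a : E → E →L[ℝ] ℝ,
    ContDiffOn ℝ ∞ a (extChartAt 𝓘(ℝ, E) x₀).target ∧
    ∀ y ∈ (chartAt E x₀).source, ∀ v : TangentSpace 𝓘(ℝ, E) y,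
      α.at y v = a (extChartAt 𝓘(ℝ, E) x₀ y)
        (mfderiv 𝓘(ℝ, E) 𝓘(ℝ, E) (extChartAt 𝓘(ℝ, E) x₀) y v) := by
  set χ := extChartAt 𝓘(ℝ, E) x₀ with hχ
  refine ⟨fun y => coeff x₀ (χ.symm y) (α (χ.symm y)), ?_, fun y hy v => ?_⟩
  · rw [← contMDiffOn_iff_contDiffOn]
    intro y hy
    have h1 : ContMDiffAt 𝓘(ℝ, E) 𝓘(ℝ, E) ∞ χ.symm y :=
      (contMDiffOn_extChartAt_symm x₀).contMDiffAt ((isOpen_extChartAt_target x₀).mem_nhds hy)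
    have h2 := (smoothFormAt_iff (E := E) (fun x => α x) (x₀ := x₀) (z := χ.symm y)
      (by have := χ.map_target hy; rwa [hχ, extChartAt_source] at this)).1 (α.contMDiff _)
    exact (h2.comp y h1).contMDiffWithinAt
  · have hy' : y ∈ χ.source := by simpa [hχ] using hy
    dsimp only
    rw [χ.left_inv hy']
    simp only [coeff]
    rw [TangentBundle.symmL_trivializationAt hy]
    have := ContinuousLinearMap.ext_iff.1 (mfderivWithin_extChartAt_symm_comp_mfderiv_extChartAt' (I := 𝓘(ℝ, E)) hy') v
    exact congrArg (α.at y) this.symm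

/-- Evaluated on a vector `w` of the trivialization which `β x₀` does not kill, the relation
exhibits `c` as a quotient of smooth functions. It makes pointwise chosen scaling factors smooth. -/
theorem contMDiffAt_of_eventually_smul {x₀ : M} {c : M → ℝ}
    {α β : ∀ x : M, TangentSpace 𝓘(ℝ, E) x →L[ℝ] Bundle.Trivial M ℝ x}
    (hα : SmoothFormAt α x₀) (hβ : SmoothFormAt β x₀) (h0 : β x₀ ≠ 0)
    (h : ∀ᶠ x in 𝓝 x₀, ∀ v, α x v = c x * β x v) :
    ContMDiffAt 𝓘(ℝ, E) 𝓘(ℝ) ∞ c x₀ := by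
  rw [smoothFormAt_iff _ (mem_chart_source E x₀)] at hα hβ
  obtain ⟨w, hw⟩ : ∃ w, coeff x₀ x₀ (β x₀) w ≠ 0 := by
    by_contra! hc
    apply h0
    ext v
    have := hc ((trivializationAt E (TangentSpace 𝓘(ℝ, E)) x₀).continuousLinearMapAt ℝ x₀ v)
    simp only [coeff, ContinuousLinearMap.comp_apply] at this
    rw [Bundle.Trivialization.symmL_continuousLinearMapAt _ (by simp)] at this
    exact this
  have ha := hα.clm_apply (contMDiffAt_const (c := w))
  have hb := hβ.clm_apply (contMDiffAt_const (c := w))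
  refine (ha.div₀ hb hw).congr_of_eventuallyEq ?_
  filter_upwards [h, hb.continuousAt.eventually_ne hw] with x hx hx0
  rw [Pi.div_apply, eq_div_iff hx0]
  exact (hx _).symm

end SmoothForms

/-! ### Flat linear systems of partial differential equations -/

section FlatSystems

section FlatConnection

variable {E : Type*} [NormedAddCommGroup E] [NormedSpace ℝ E] [FiniteDimensional ℝ E]
  {W : Type*} [NormedAddCommGroup W] [NormedSpace ℝ W] [CompleteSpace W]

/-- The homotopy formula for the radial primitive of a `1`-form. -/
theorem hasFDerivAt_radialPrimitive {β : E → E →L[ℝ] W} (hβ : ContDiff ℝ 1 β) (y : E) :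
    HasFDerivAt (fun y : E => ∫ s in (0 : ℝ)..1, β (s • y) y)
      (β y + ∫ s in (0 : ℝ)..1,
        s • ((fderiv ℝ β (s • y)).flip y - fderiv ℝ β (s • y) y)) y := by
  have hβc := hβ.continuous
  have hβ' : Continuous (fderiv ℝ β) := hβ.continuous_fderiv one_ne_zero
  have hβd : Differentiable ℝ β := hβ.differentiable one_ne_zero
  let G : E → ℝ → E →L[ℝ] W := fun y s => β (s • y) + s • (fderiv ℝ β (s • y)).flip y
  have hflip : Continuous fun p : E × ℝ => (fderiv ℝ β (p.2 • p.1)).flip p.1 := by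
    have : Continuous fun p : E × ℝ => ContinuousLinearMap.flipₗᵢ ℝ E E W
        (fderiv ℝ β (p.2 • p.1)) :=
      (ContinuousLinearMap.flipₗᵢ ℝ E E W).continuous.comp
        (hβ'.comp (continuous_snd.smul continuous_fst))
    exact this.clm_apply continuous_fst
  have hG : Continuous fun p : E × ℝ => G p.1 p.2 :=
    (hβc.comp (continuous_snd.smul continuous_fst)).add (continuous_snd.smul hflip)
  have hd : ∀ s y, HasFDerivAt (fun y : E => β (s • y) y) (G y s) y := by
    intro s y
    have h1 : HasFDerivAt (fun y : E => β (s • y))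
        ((fderiv ℝ β (s • y)).comp (s • ContinuousLinearMap.id ℝ E)) y :=
      (hβd (s • y)).hasFDerivAt.comp y ((hasFDerivAt_id y).const_smul s)
    have h2 := h1.clm_apply (hasFDerivAt_id y)
    refine h2.congr_fderiv ?_
    ext v
    simp [G]
  -- A compactness bound on the derivative of the integrand, to differentiate under the integral
  -- sign.
  obtain ⟨C, hC⟩ := ((isCompact_closedBall y 1).prod (isCompact_Icc (a := (0 : ℝ)) (b := 1))
    ).exists_bound_of_continuousOn hG.continuousOn
  have key := intervalIntegral.hasFDerivAt_integral_of_dominated_of_fderiv_le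
    (μ := MeasureTheory.volume) (a := 0) (b := 1) (F := fun (y : E) (s : ℝ) => β (s • y) y)
    (F' := G) (x₀ := y) (bound := fun _ => C) (Metric.closedBall_mem_nhds y one_pos)
    (Eventually.of_forall fun z => by
      have : Continuous fun s : ℝ => β (s • z) z := by fun_prop
      exact this.aestronglyMeasurable)
    (by
      have : Continuous fun s : ℝ => β (s • y) y := by fun_prop
      exact this.intervalIntegrable _ _)
    (hG.comp (continuous_const.prodMk continuous_id)).aestronglyMeasurable
    (Eventually.of_forall fun s hs z hz => by
      rw [uIoc_of_le zero_le_one] at hs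
      exact hC (z, s) ⟨hz, hs.1.le, hs.2⟩)
    intervalIntegrable_const
    (Eventually.of_forall fun s _ z _ => hd s z)
  convert key using 1
  have hflip' : Continuous fun s : ℝ => (fderiv ℝ β (s • y)).flip y :=
    hflip.comp (continuous_const.prodMk continuous_id)
  have hfd' : Continuous fun s : ℝ => fderiv ℝ β (s • y) y :=
    (hβ'.comp (continuous_id.smul continuous_const)).clm_apply continuous_const
  -- Integrating this derivative over the unit interval produces the term `β y`; what is left is the
  -- antisymmetric part of the derivative of `β`.
  have hder : ∀ s : ℝ, HasDerivAt (fun s : ℝ => s • β (s • y))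
      (β (s • y) + s • fderiv ℝ β (s • y) y) s := by
    intro s
    have h1 : HasDerivAt (fun s : ℝ => β (s • y)) (fderiv ℝ β (s • y) y) s := by
      have := (hβd (s • y)).hasFDerivAt.comp_hasDerivAt s
        (f := fun s : ℝ => s • y) ((hasDerivAt_id s).smul_const y)
      rw [one_smul] at this
      exact this
    exact ((hasDerivAt_id s).smul h1).congr_deriv (by simp [add_comm])
  have hβs : Continuous fun s : ℝ => β (s • y) := by fun_prop
  have hint : IntervalIntegrable (fun s : ℝ => β (s • y) + s • fderiv ℝ β (s • y) y)
      MeasureTheory.volume 0 1 :=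
    (hβs.add (continuous_id.smul hfd')).intervalIntegrable _ _
  have h1 := intervalIntegral.integral_eq_sub_of_hasDerivAt (fun s _ => hder s) hint
  simp only [one_smul, zero_smul, sub_zero] at h1
  have hint' : IntervalIntegrable
      (fun s : ℝ => s • ((fderiv ℝ β (s • y)).flip y - fderiv ℝ β (s • y) y))
      MeasureTheory.volume 0 1 :=
    (continuous_id.smul (hflip'.sub hfd')).intervalIntegrable _ _
  rw [← h1, ← intervalIntegral.integral_add hint hint']
  refine intervalIntegral.integral_congr fun s _ => ?_
  simp only [G, smul_sub]
  abel

/-- The homotopy formula contains only first derivatives of `β`, so no regularity is lost and the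
Picard iteration stays within `C¹`. -/
theorem contDiff_radialPrimitive {β : E → E →L[ℝ] W} (hβ : ContDiff ℝ 1 β) :
    ContDiff ℝ 1 (fun y : E => ∫ s in (0 : ℝ)..1, β (s • y) y) := by
  rw [contDiff_one_iff_hasFDerivAt]
  refine ⟨_, ?_, hasFDerivAt_radialPrimitive hβ⟩
  have hβ' : Continuous (fderiv ℝ β) := hβ.continuous_fderiv one_ne_zero
  have hc : Continuous fun p : E × ℝ => fderiv ℝ β (p.2 • p.1) :=
    hβ'.comp (continuous_snd.smul continuous_fst)
  have hflip : Continuous fun p : E × ℝ => (fderiv ℝ β (p.2 • p.1)).flip p.1 := by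
    have : Continuous fun p : E × ℝ => ContinuousLinearMap.flipₗᵢ ℝ E E W
        (fderiv ℝ β (p.2 • p.1)) :=
      (ContinuousLinearMap.flipₗᵢ ℝ E E W).continuous.comp hc
    exact this.clm_apply continuous_fst
  refine hβ.continuous.add ?_
  apply intervalIntegral.continuous_parametric_intervalIntegral_of_continuous'
  exact continuous_snd.smul (hflip.sub (hc.clm_apply continuous_fst))

/-- One step of the Picard iteration for the system `dA = Ω A`. -/
def picardStep (Ω : E → W →L[ℝ] E →L[ℝ] W) (z₀ : W) (A : E → W) (y : E) : W :=
  z₀ + ∫ s in (0 : ℝ)..1, Ω (s • y) (A (s • y)) y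

theorem contDiff_picardStep {Ω : E → W →L[ℝ] E →L[ℝ] W} (hΩ : ContDiff ℝ 1 Ω) (z₀ : W) {A : E → W}
    (hA : ContDiff ℝ 1 A) : ContDiff ℝ 1 (picardStep Ω z₀ A) :=
  contDiff_const.add (contDiff_radialPrimitive (hΩ.clm_apply hA))

theorem smul_mem_ball_of_mem_Icc {E : Type*} [NormedAddCommGroup E] [NormedSpace ℝ E] {r s : ℝ} (hs : s ∈ Icc (0 : ℝ) 1) {y : E}
    (hy : y ∈ Metric.ball (0 : E) r) : s • y ∈ Metric.ball (0 : E) r := by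
  rw [mem_ball_zero_iff] at hy ⊢
  rw [norm_smul, Real.norm_of_nonneg hs.1]
  exact lt_of_le_of_lt (mul_le_of_le_one_left (norm_nonneg y) hs.2) hy

/-- The failure of `A` to solve the system `dA = Ω A`. -/
def systemDefect (Ω : E → W →L[ℝ] E →L[ℝ] W) (A : E → W) (y : E) : E →L[ℝ] W :=
  fderiv ℝ A y - Ω y (A y)

/-- In the homotopy formula for `y ↦ Ω y (A y)`, replace dA by ΩA plus the defect. Flatness cancels
the terms free of the defect, so the error in the derivative is linear in the defect of `A`. -/
theorem fderiv_picardStep {Ω : E → W →L[ℝ] E →L[ℝ] W} (hΩ : ContDiff ℝ 1 Ω) (z₀ : W) {A : E → W}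
    (hA : ContDiff ℝ 1 A) {r : ℝ}
    (hflat : ∀ y ∈ Metric.ball (0 : E) r, ∀ v w z, fderiv ℝ Ω y v z w - fderiv ℝ Ω y w z v =
      Ω y (Ω y z w) v - Ω y (Ω y z v) w) {y : E} (hy : y ∈ Metric.ball (0 : E) r) :
    fderiv ℝ (picardStep Ω z₀ A) y = Ω y (A y) + ∫ s in (0 : ℝ)..1,
      s • (((Ω (s • y)).flip y).comp (systemDefect Ω A (s • y)) -
        Ω (s • y) (systemDefect Ω A (s • y) y)) := by
  have h := (hasFDerivAt_radialPrimitive (hΩ.clm_apply hA) y).const_add z₀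
  have e : picardStep Ω z₀ A = fun y => z₀ + ∫ s in (0 : ℝ)..1, Ω (s • y) (A (s • y)) y := rfl
  rw [e, h.fderiv]
  congr 1
  refine intervalIntegral.integral_congr fun s hs => ?_
  rw [uIcc_of_le zero_le_one] at hs
  have hsy := smul_mem_ball_of_mem_Icc hs hy
  have hd := ((hΩ.differentiable one_ne_zero (s • y)).hasFDerivAt.clm_apply
    (hA.differentiable one_ne_zero (s • y)).hasFDerivAt).fderiv
  congr 1
  ext v
  rw [hd]
  have := hflat _ hsy v y (A (s • y))
  simp only [systemDefect, sub_apply, add_apply, ContinuousLinearMap.flip_apply,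
    ContinuousLinearMap.comp_apply, map_sub] at this ⊢
  rw [sub_eq_iff_eq_add] at this
  rw [this]
  abel

/-- The summand `C * D` is the cost of replacing `A` by its Picard step inside `Ω`; the other one
bounds the two terms under the integral, each at most `C * r * e`. On a small ball the defects
therefore decay along with the increments. -/
theorem norm_systemDefect_picardStep_le {Ω : E → W →L[ℝ] E →L[ℝ] W} (hΩ : ContDiff ℝ 1 Ω) (z₀ : W)
    {A : E → W} (hA : ContDiff ℝ 1 A) {r C D e : ℝ} (hr : 0 ≤ r) (hC : 0 ≤ C)
    (hflat : ∀ y ∈ Metric.ball (0 : E) r, ∀ v w z, fderiv ℝ Ω y v z w - fderiv ℝ Ω y w z v =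
      Ω y (Ω y z w) v - Ω y (Ω y z v) w)
    (hΩC : ∀ y ∈ Metric.ball (0 : E) r, ‖Ω y‖ ≤ C)
    (hAD : ∀ y ∈ Metric.ball (0 : E) r, ‖picardStep Ω z₀ A y - A y‖ ≤ D)
    (hAe : ∀ y ∈ Metric.ball (0 : E) r, ‖systemDefect Ω A y‖ ≤ e)
    {y : E} (hy : y ∈ Metric.ball (0 : E) r) :
    ‖systemDefect Ω (picardStep Ω z₀ A) y‖ ≤ C * D + 2 * C * r * e := by
  have hyr : ‖y‖ ≤ r := (mem_ball_zero_iff.1 hy).le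
  rw [systemDefect, fderiv_picardStep hΩ z₀ hA hflat hy]
  have h1 : ‖Ω y (A y) - Ω y (picardStep Ω z₀ A y)‖ ≤ C * D := by
    rw [← map_sub, ← norm_neg, ← map_neg, neg_sub]
    exact (Ω y).le_of_opNorm_le_of_le (hΩC y hy) (hAD y hy)
  have h2 : ‖∫ s in (0 : ℝ)..1, s • (((Ω (s • y)).flip y).comp (systemDefect Ω A (s • y)) -
        Ω (s • y) (systemDefect Ω A (s • y) y))‖ ≤ (2 * C * r * e) * |1 - 0| := by
    refine intervalIntegral.norm_integral_le_of_norm_le_const fun s hs => ?_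
    rw [uIoc_of_le zero_le_one] at hs
    have hsy := smul_mem_ball_of_mem_Icc ⟨hs.1.le, hs.2⟩ hy
    have b1 : ‖((Ω (s • y)).flip y).comp (systemDefect Ω A (s • y))‖ ≤ C * r * e := by
      refine (ContinuousLinearMap.opNorm_comp_le _ _).trans ?_
      refine mul_le_mul ?_ (hAe _ hsy) (norm_nonneg _) (by positivity)
      refine (ContinuousLinearMap.le_opNorm _ _).trans ?_
      rw [ContinuousLinearMap.opNorm_flip]
      exact mul_le_mul (hΩC _ hsy) hyr (norm_nonneg _) hC
    have b2 : ‖Ω (s • y) (systemDefect Ω A (s • y) y)‖ ≤ C * (e * r) :=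
      (Ω (s • y)).le_of_opNorm_le_of_le (hΩC _ hsy)
        ((systemDefect Ω A (s • y)).le_of_opNorm_le_of_le (hAe _ hsy) hyr)
    rw [norm_smul, Real.norm_of_nonneg hs.1.le]
    refine (mul_le_of_le_one_left (norm_nonneg _) hs.2).trans ?_
    refine (norm_sub_le _ _).trans ?_
    linarith
  rw [add_sub_right_comm]
  refine (norm_add_le _ _).trans ?_
  simp only [sub_zero, abs_one, mul_one] at h2
  linarith

theorem eventually_norm_le_add_one {X F : Type*} [TopologicalSpace X] [NormedAddCommGroup F]
    {f : X → F} (hf : Continuous f) (x : X) : ∀ᶠ y in 𝓝 x, ‖f y‖ ≤ ‖f x‖ + 1 := by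
  filter_upwards [hf.norm.continuousAt.eventually (gt_mem_nhds (lt_add_one ‖f x‖))] with y hy
  exact hy.le

theorem norm_picardStep_sub_le {E W : Type*} [NormedAddCommGroup E] [NormedSpace ℝ E]
    [NormedAddCommGroup W] [NormedSpace ℝ W] {Ω : E → W →L[ℝ] E →L[ℝ] W} (hΩ : Continuous Ω) (z₀ : W)
    {A A' : E → W} (hA : Continuous A) (hA' : Continuous A') {r C D : ℝ}
    (hΩC : ∀ y ∈ Metric.ball (0 : E) r, ‖Ω y‖ ≤ C)
    (hAD : ∀ y ∈ Metric.ball (0 : E) r, ‖A y - A' y‖ ≤ D)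
    {y : E} (hy : y ∈ Metric.ball (0 : E) r) :
    ‖picardStep Ω z₀ A y - picardStep Ω z₀ A' y‖ ≤ C * D * r := by
  have hyr : ‖y‖ ≤ r := (mem_ball_zero_iff.1 hy).le
  have hi : ∀ A : E → W, Continuous A → IntervalIntegrable (fun s : ℝ => Ω (s • y) (A (s • y)) y)
      MeasureTheory.volume 0 1 := fun A hA => by
    have : Continuous fun s : ℝ => Ω (s • y) (A (s • y)) y := by fun_prop
    exact this.intervalIntegrable _ _
  rw [picardStep, picardStep, add_sub_add_left_eq_sub,
    ← intervalIntegral.integral_sub (hi A hA) (hi A' hA')]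
  have : ‖∫ s in (0 : ℝ)..1, (Ω (s • y) (A (s • y)) y - Ω (s • y) (A' (s • y)) y)‖ ≤
      C * D * r * |1 - 0| := by
    refine intervalIntegral.norm_integral_le_of_norm_le_const fun s hs => ?_
    rw [uIoc_of_le zero_le_one] at hs
    have hsy := smul_mem_ball_of_mem_Icc ⟨hs.1.le, hs.2⟩ hy
    rw [← sub_apply, ← map_sub]
    exact ContinuousLinearMap.le_of_opNorm_le_of_le _
      ((Ω (s • y)).le_of_opNorm_le_of_le (hΩC _ hsy) (hAD _ hsy)) hyr
  simpa using this

/-- The Picard iterates converge uniformly to some `Z` on a small ball, and since their defects tend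
to zero, their derivatives converge uniformly to ΩZ. Flatness is local, but `Ω` is `C¹` everywhere,
so that every iterate is defined and `C¹` on all of `E`. -/
theorem exists_hasFDerivAt_of_flat_zero {Ω : E → W →L[ℝ] E →L[ℝ] W} (hΩ : ContDiff ℝ 1 Ω)
    (hflat : ∀ᶠ y in 𝓝 (0 : E), ∀ v w z, fderiv ℝ Ω y v z w - fderiv ℝ Ω y w z v =
      Ω y (Ω y z w) v - Ω y (Ω y z v) w) (z₀ : W) :
    ∃ Z : E → W, Z 0 = z₀ ∧ ∀ᶠ y in 𝓝 (0 : E), HasFDerivAt Z (Ω y (Z y)) y := by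
  set C : ℝ := ‖Ω 0‖ + 1 with hC
  have hC0 : 0 < C := by positivity
  have hbd : ∀ᶠ y in 𝓝 (0 : E), ‖Ω y‖ ≤ C := eventually_norm_le_add_one hΩ.continuous 0
  obtain ⟨r₀, hr₀, hball⟩ := Metric.eventually_nhds_iff_ball.1 (hflat.and hbd)
  -- With `C * r ≤ 1 / 8` the increments shrink by `1 / 8` at each step, and the two parts of the
  -- defect estimate add up to `1 / 8 + 2 / 8` times the previous bound; both are below the ratio `1
  -- / 2` of the inductions.
  set r : ℝ := min r₀ (1 / (8 * C)) with hr
  have hrpos : 0 < r := lt_min hr₀ (by positivity)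
  have hCr : C * r ≤ 1 / 8 := by
    have : r ≤ 1 / (8 * C) := min_le_right _ _
    calc C * r ≤ C * (1 / (8 * C)) := by gcongr
      _ = 1 / 8 := by field_simp
  have hsub : Metric.ball (0 : E) r ⊆ Metric.ball 0 r₀ := Metric.ball_subset_ball (min_le_left _ _)
  have hflat' := fun y hy => (hball y (hsub hy)).1
  have hΩC := fun y hy => (hball y (hsub hy)).2
  let A : ℕ → E → W := fun n => (picardStep Ω z₀)^[n] fun _ => z₀
  have hAs : ∀ n, A (n + 1) = picardStep Ω z₀ (A n) := fun n =>
    Function.iterate_succ_apply' _ _ _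
  have hAc : ∀ n, ContDiff ℝ 1 (A n) := by
    intro n
    induction n with
    | zero => exact contDiff_const
    | succ n ih => rw [hAs]; exact contDiff_picardStep hΩ z₀ ih
  set K : ℝ := ‖z₀‖ with hK
  have hK0 : 0 ≤ K := norm_nonneg _
  have hD : ∀ n, ∀ y ∈ Metric.ball (0 : E) r, ‖A (n + 1) y - A n y‖ ≤ K / 8 * (1 / 2) ^ n := by
    intro n
    induction n with
    | zero =>
      intro y hy
      have hyr : ‖y‖ ≤ r := (mem_ball_zero_iff.1 hy).le
      rw [hAs]
      have e : picardStep Ω z₀ (A 0) y - A 0 y = ∫ s in (0 : ℝ)..1, Ω (s • y) z₀ y := by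
        simp [A, picardStep]
      have : ‖∫ s in (0 : ℝ)..1, Ω (s • y) z₀ y‖ ≤ C * K * r * |1 - 0| := by
        refine intervalIntegral.norm_integral_le_of_norm_le_const fun s hs => ?_
        rw [uIoc_of_le zero_le_one] at hs
        have hsy := smul_mem_ball_of_mem_Icc ⟨hs.1.le, hs.2⟩ hy
        exact ContinuousLinearMap.le_of_opNorm_le_of_le _
          ((Ω (s • y)).le_of_opNorm_le_of_le (hΩC _ hsy) le_rfl) hyr
      rw [e]
      simp only [sub_zero, abs_one, mul_one, pow_zero] at this ⊢
      nlinarith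
    | succ n ih =>
      intro y hy
      have := norm_picardStep_sub_le hΩ.continuous z₀ (hAc (n + 1)).continuous (hAc n).continuous
        hΩC ih hy
      rw [← hAs, ← hAs] at this
      refine this.trans ?_
      rw [pow_succ]
      have h0 : 0 ≤ K / 8 * (1 / 2) ^ n := by positivity
      nlinarith
  have hE : ∀ n, ∀ y ∈ Metric.ball (0 : E) r, ‖systemDefect Ω (A n) y‖ ≤ C * K * (1 / 2) ^ n := by
    intro n
    induction n with
    | zero =>
      intro y hy
      have e : systemDefect Ω (A 0) y = -(Ω y z₀) := by
        simp [A, systemDefect]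
      rw [e, norm_neg, pow_zero, mul_one]
      exact (Ω y).le_of_opNorm_le_of_le (hΩC y hy) le_rfl
    | succ n ih =>
      intro y hy
      have := norm_systemDefect_picardStep_le hΩ z₀ (hAc n) hrpos.le hC0.le hflat'
        hΩC (fun y hy => by rw [← hAs]; exact hD n y hy) ih hy
      rw [hAs]
      refine this.trans ?_
      rw [pow_succ]
      have h0 : 0 ≤ C * K * (1 / 2) ^ n := by positivity
      nlinarith
  have hdist : ∀ y ∈ Metric.ball (0 : E) r, ∀ n, dist (A n y) (A (n + 1) y) ≤ K / 4 / 2 / 2 ^ n := by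
    intro y hy n
    rw [dist_comm, dist_eq_norm]
    refine (hD n y hy).trans (le_of_eq ?_)
    rw [div_pow, one_pow]
    ring
  have hlim : ∀ y, ∃ z, y ∈ Metric.ball (0 : E) r → Tendsto (fun n => A n y) atTop (𝓝 z) := by
    intro y
    by_cases hy : y ∈ Metric.ball (0 : E) r
    · obtain ⟨z, hz⟩ := cauchySeq_tendsto_of_complete (cauchySeq_of_le_geometric_two (hdist y hy))
      exact ⟨z, fun _ => hz⟩
    · exact ⟨0, fun h => absurd h hy⟩
  choose Z hZ using hlim
  have hclose : ∀ n, ∀ y ∈ Metric.ball (0 : E) r, ‖A n y - Z y‖ ≤ K * (1 / 2) ^ n := by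
    intro n y hy
    have := dist_le_of_le_geometric_two_of_tendsto (hdist y hy) (hZ y hy) n
    rw [dist_eq_norm] at this
    refine this.trans ?_
    rw [div_pow, one_pow, mul_one_div]
    gcongr
    linarith
  refine ⟨Z, ?_, ?_⟩
  · refine tendsto_nhds_unique (hZ 0 (Metric.mem_ball_self hrpos)) ?_
    have : ∀ n, A n 0 = z₀ := by
      intro n
      cases n with
      | zero => rfl
      | succ n => rw [hAs]; simp [picardStep]
    simp only [this, tendsto_const_nhds]
  · filter_upwards [Metric.ball_mem_nhds (0 : E) hrpos] with y hy
    refine hasFDerivAt_of_tendstoUniformlyOn (l := atTop) (f := A) (f' := fun n => fderiv ℝ (A n))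
      (g' := fun y => Ω y (Z y)) Metric.isOpen_ball ?_
      (fun n x _ => ((hAc n).differentiable one_ne_zero x).hasFDerivAt) hZ hy
    rw [Metric.tendstoUniformlyOn_iff]
    intro ε hε
    have ht : Tendsto (fun n : ℕ => 2 * C * K * (1 / 2 : ℝ) ^ n) atTop (𝓝 (2 * C * K * 0)) :=
      (tendsto_pow_atTop_nhds_zero_of_lt_one (by norm_num) (by norm_num)).const_mul _
    rw [mul_zero] at ht
    filter_upwards [ht.eventually (gt_mem_nhds hε)] with n hn x hx
    rw [dist_comm, dist_eq_norm]
    refine lt_of_le_of_lt ?_ hn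
    have e : fderiv ℝ (A n) x - Ω x (Z x) = systemDefect Ω (A n) x + Ω x (A n x - Z x) := by
      rw [systemDefect, map_sub]; abel
    rw [e]
    refine (norm_add_le _ _).trans ?_
    have h1 := hE n x hx
    have h2 := (Ω x).le_of_opNorm_le_of_le (hΩC x hx) (hclose n x hx)
    linarith

/-- Multiplication by a bump function. It supplies the globally defined coefficients that the
iteration wants, without changing the germ. -/
theorem exists_contDiff_eventuallyEq {F : Type*} [NormedAddCommGroup F] [NormedSpace ℝ F]
    {f : E → F} {y₀ : E} (hf : ContDiffAt ℝ 1 f y₀) : ∃ g : E → F, ContDiff ℝ 1 g ∧ g =ᶠ[𝓝 y₀] f := by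
  obtain ⟨R, hR, hball⟩ := Metric.eventually_nhds_iff_ball.1 (hf.eventually (by simp))
  let χ : ContDiffBump y₀ := ⟨R / 4, R / 2, by linarith, by linarith⟩
  refine ⟨fun y => χ y • f y, ?_, ?_⟩
  · rw [contDiff_iff_contDiffAt]
    intro y
    by_cases hy : y ∈ Metric.ball y₀ R
    · exact χ.contDiffAt.smul (hball y hy)
    · have hy' : R / 2 < dist y y₀ := by
        rw [Metric.mem_ball, not_lt] at hy; linarith
      have hev : ∀ᶠ z in 𝓝 y, R / 2 < dist z y₀ :=
        (continuous_id.dist continuous_const).continuousAt.eventually (lt_mem_nhds hy')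
      refine (contDiffAt_const (c := (0 : F))).congr_of_eventuallyEq ?_
      filter_upwards [hev] with z hz
      rw [χ.zero_of_le_dist hz.le, zero_smul]
  · filter_upwards [χ.eventuallyEq_one] with y hy
    simp [hy]

theorem fderiv_translate {E F : Type*} [NormedAddCommGroup E] [NormedSpace ℝ E]
    [NormedAddCommGroup F] [NormedSpace ℝ F]
    (f : E → F) (a y : E) : fderiv ℝ (fun y => f (a + y)) y = fderiv ℝ f (a + y) :=
  fderiv_comp_add_left a

/-- Local solutions of a flat linear system `dZ = Ω Z`. -/
theorem exists_hasFDerivAt_of_flat {Ω : E → W →L[ℝ] E →L[ℝ] W} {y₀ : E} (hΩ : ContDiffAt ℝ 1 Ω y₀)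
    (hflat : ∀ᶠ y in 𝓝 y₀, ∀ v w z, fderiv ℝ Ω y v z w - fderiv ℝ Ω y w z v =
      Ω y (Ω y z w) v - Ω y (Ω y z v) w) (z₀ : W) :
    ∃ Z : E → W, Z y₀ = z₀ ∧ ∀ᶠ y in 𝓝 y₀, HasFDerivAt Z (Ω y (Z y)) y := by
  obtain ⟨Θ, hΘ, heq⟩ := exists_contDiff_eventuallyEq hΩ
  have htr : Tendsto (fun y : E => y₀ + y) (𝓝 0) (𝓝 y₀) := by
    have : Continuous fun y : E => y₀ + y := by fun_prop
    simpa using this.tendsto 0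
  obtain ⟨Z, hZ0, hZ⟩ := exists_hasFDerivAt_of_flat_zero (Ω := fun y => Θ (y₀ + y))
    (hΘ.comp (contDiff_const.add contDiff_id)) (by
      filter_upwards [htr.eventually hflat, htr.eventually heq.eventuallyEq_nhds] with y h1 h2 v w z
      rw [fderiv_translate Θ, h2.fderiv_eq, h2.self_of_nhds]
      exact h1 v w z) z₀
  refine ⟨fun y => Z (y - y₀), by simpa using hZ0, ?_⟩
  have htr' : Tendsto (fun y : E => y - y₀) (𝓝 y₀) (𝓝 0) := by
    have : Continuous fun y : E => y - y₀ := by fun_prop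
    simpa using this.tendsto y₀
  filter_upwards [htr'.eventually hZ, heq] with y h1 h2
  have h3 := h1.comp y ((hasFDerivAt_id y).sub_const y₀)
  rw [add_sub_cancel, h2] at h3
  exact h3
end FlatConnection

end FlatSystems

/-! ### Lorentzian models and null frames -/

section LorentzModels

/-- A vector space with a nondegenerate symmetric bilinear form, seen as a model space: for `κ = 0`
the geometry of the whole vector space, for `κ = 1` that of the unit quadric. -/
structure LorentzModel (V : Type*) [NormedAddCommGroup V] [NormedSpace ℝ V] where
  /-- The bilinear form. -/
  form : V →L[ℝ] V →L[ℝ] ℝ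
  /-- The curvature. -/
  κ : ℝ
  symm : ∀ u v, form u v = form v u
  nondeg : ∀ u, (∀ v, form u v = 0) → u = 0
  -- This forces `κ` to be `0` or `1`; a relation multiplied by `κ` is void in the flat case.
  κ_mul_self : κ * κ = κ

namespace LorentzModel

variable {V : Type*} [NormedAddCommGroup V] [NormedSpace ℝ V] (L : LorentzModel V)

/-- The underlying space of a model. -/
def space : Set V := {x | L.κ * L.form x x = L.κ}

/-- The isometries of a model. -/
def isometries : Set (V → V) :=
  -- The equation for `b` allows translations precisely when `κ = 0`.
  {g | ∃ (A : V →L[ℝ] V) (b : V), (∀ u v, L.form (A u) (A v) = L.form u v) ∧ L.κ • b = 0 ∧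
    ∀ x, g x = A x + b}

theorem ext_form {u v : V} (h : ∀ w, L.form u w = L.form v w) : u = v := by
  rw [← sub_eq_zero]
  exact L.nondeg _ fun w => by rw [map_sub, sub_apply, h, sub_self]

/-- `n₁, n₂` is a basis of null vectors of the tangent plane of the model at `f`. -/
structure IsNullFrame (f n₁ n₂ : V) : Prop where
  null₁ : L.form n₁ n₁ = 0
  null₂ : L.form n₂ n₂ = 0
  pair : L.form n₁ n₂ = 1
  orth₁ : L.κ * L.form f n₁ = 0
  orth₂ : L.κ * L.form f n₂ = 0
  norm : L.κ * L.form f f = L.κ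
  -- Completeness of the frame: by nondegeneracy it amounts to the expansion `eq_sum` of every
  -- vector.
  expand : ∀ u v, L.form u v =
    L.κ * (L.form u f * L.form v f) + L.form u n₂ * L.form v n₁ + L.form u n₁ * L.form v n₂

/-- The linear map sending the frame `f, n₁, n₂` to the frame `f', n₁', n₂'`. -/
def frameMap (f n₁ n₂ f' n₁' n₂' : V) : V →L[ℝ] V :=
  L.κ • (L.form f).smulRight f' + (L.form n₂).smulRight n₁' + (L.form n₁).smulRight n₂'

theorem frameMap_apply (f n₁ n₂ f' n₁' n₂' u : V) : L.frameMap f n₁ n₂ f' n₁' n₂' u =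
    L.κ • L.form u f • f' + L.form u n₂ • n₁' + L.form u n₁ • n₂' := by
  simp [frameMap, L.symm u]

variable {L} {f n₁ n₂ f' n₁' n₂' : V}

namespace IsNullFrame

theorem pair' (h : L.IsNullFrame f n₁ n₂) : L.form n₂ n₁ = 1 := by rw [L.symm, h.pair]

theorem orth₁' (h : L.IsNullFrame f n₁ n₂) : L.κ * L.form n₁ f = 0 := by rw [L.symm, h.orth₁]

theorem orth₂' (h : L.IsNullFrame f n₁ n₂) : L.κ * L.form n₂ f = 0 := by rw [L.symm, h.orth₂]

theorem swap (h : L.IsNullFrame f n₁ n₂) : L.IsNullFrame f n₂ n₁ where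
  null₁ := h.null₂
  null₂ := h.null₁
  pair := h.pair'
  orth₁ := h.orth₂
  orth₂ := h.orth₁
  norm := h.norm
  expand u v := by rw [h.expand u v]; ring

theorem scale (h : L.IsNullFrame f n₁ n₂) {c : ℝ} (hc : c ≠ 0) :
    L.IsNullFrame f (c⁻¹ • n₁) (c • n₂) where
  null₁ := by simp [h.null₁]
  null₂ := by simp [h.null₂]
  pair := by simp [h.pair, hc]
  orth₁ := by have := h.orth₁; simp only [map_smul, smul_eq_mul]; linear_combination c⁻¹ * this
  orth₂ := by have := h.orth₂; simp only [map_smul, smul_eq_mul]; linear_combination c * this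
  norm := h.norm
  expand u v := by
    rw [h.expand u v]
    simp only [map_smul, smul_eq_mul]
    field_simp

theorem eq_sum (h : L.IsNullFrame f n₁ n₂) (u : V) :
    u = L.κ • L.form u f • f + L.form u n₂ • n₁ + L.form u n₁ • n₂ := by
  refine L.ext_form fun w => ?_
  rw [h.expand]
  simp only [map_add, map_smul, add_apply, smul_apply, smul_eq_mul, L.symm w]

theorem frameMap_self (h : L.IsNullFrame f n₁ n₂) (u : V) :
    L.frameMap f n₁ n₂ f n₁ n₂ u = u := by
  rw [frameMap_apply, ← h.eq_sum]

theorem frameMap_null₁ (h : L.IsNullFrame f n₁ n₂) (f' n₁' n₂' : V) :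
    L.frameMap f n₁ n₂ f' n₁' n₂' n₁ = n₁' := by
  rw [frameMap_apply, smul_smul, h.orth₁', h.pair, h.null₁]; simp

theorem frameMap_null₂ (h : L.IsNullFrame f n₁ n₂) (f' n₁' n₂' : V) :
    L.frameMap f n₁ n₂ f' n₁' n₂' n₂ = n₂' := by
  rw [frameMap_apply, smul_smul, h.orth₂', h.pair', h.null₂]; simp

theorem frameMap_base (h : L.IsNullFrame f n₁ n₂) (f' n₁' n₂' : V) :
    L.κ • L.frameMap f n₁ n₂ f' n₁' n₂' f = L.κ • f' := by
  rw [frameMap_apply]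
  simp only [smul_add, smul_smul]
  rw [h.orth₁, h.orth₂, h.norm, L.κ_mul_self]; simp

theorem form_frameMap (h : L.IsNullFrame f n₁ n₂) (h' : L.IsNullFrame f' n₁' n₂') (u v : V) :
    L.form (L.frameMap f n₁ n₂ f' n₁' n₂' u) (L.frameMap f n₁ n₂ f' n₁' n₂' v) = L.form u v := by
  rw [frameMap_apply, frameMap_apply, h.expand u v]
  simp only [map_add, map_smul, add_apply, smul_apply, smul_eq_mul,
    h'.null₁, h'.null₂, h'.pair, h'.pair']
  have a1 := h'.orth₁
  have a2 := h'.orth₂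
  have a3 := h'.orth₁'
  have a4 := h'.orth₂'
  have a5 := h'.norm
  have a6 := L.κ_mul_self
  linear_combination L.form u f * L.form v n₂ * a1 + L.form u f * L.form v n₁ * a2 +
    L.form u n₂ * L.form v f * a3 + L.form u n₁ * L.form v f * a4 +
    L.κ * L.form u f * L.form v f * a5 + L.form u f * L.form v f * a6

/-- A vector orthogonal to the tangent plane of the model at `f` which is moreover
tangent vanishes. -/
theorem eq_zero (h : L.IsNullFrame f n₁ n₂) {u : V} (h0 : L.κ * L.form u f = 0)
    (h1 : L.form u n₁ = 0) (h2 : L.form u n₂ = 0) : u = 0 := by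
  rw [h.eq_sum u, smul_smul, h0, h1, h2]; simp

/-- Let `T` carry the null frame to the primed one and `S` be the map in the other direction. The
hypothesis gives `T * S = 1`, hence `S * T = 1` in finite dimension. Applying this to n₁, n₂ and κf
and pairing with the null frame reads off the products of the primed vectors. -/
theorem of_frameMap_self [FiniteDimensional ℝ V] (h : L.IsNullFrame f n₁ n₂)
    (h' : ∀ u, L.frameMap f' n₁' n₂' f' n₁' n₂' u = u) : L.IsNullFrame f' n₁' n₂' := by
  set T : V →ₗ[ℝ] V := (L.frameMap f n₁ n₂ f' n₁' n₂').toLinearMap with hT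
  set S : V →ₗ[ℝ] V := (L.frameMap f' n₁' n₂' f n₁ n₂).toLinearMap with hS
  have hTS : T * S = 1 := by
    refine LinearMap.ext fun u => ?_
    change L.frameMap f n₁ n₂ f' n₁' n₂' (L.frameMap f' n₁' n₂' f n₁ n₂ u) = u
    rw [L.frameMap_apply f' n₁' n₂' f n₁ n₂, map_add, map_add, map_smul, map_smul, map_smul,
      map_smul, h.frameMap_null₁, h.frameMap_null₂, smul_comm, h.frameMap_base, smul_comm]
    rw [← L.frameMap_apply, h']
  have hST : ∀ u, L.frameMap f' n₁' n₂' f n₁ n₂ (L.frameMap f n₁ n₂ f' n₁' n₂' u) = u :=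
    fun u => congrArg (fun A : V →ₗ[ℝ] V => A u) (mul_eq_one_comm.1 hTS)
  have e1 := hST n₁
  have e2 := hST n₂
  have e3 : L.κ • L.frameMap f' n₁' n₂' f n₁ n₂ f' = L.κ • f := by
    rw [← map_smul, ← h.frameMap_base f' n₁' n₂', map_smul, hST]
  rw [h.frameMap_null₁, frameMap_apply] at e1
  rw [h.frameMap_null₂, frameMap_apply] at e2
  rw [frameMap_apply] at e3
  have p : ∀ {u v : V}, u = v → ∀ w, L.form u w = L.form v w := fun h w => by rw [h]
  have a1 := h.orth₁
  have a2 := h.orth₂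
  have a3 := h.orth₁'
  have a4 := h.orth₂'
  have a5 := h.norm
  have a6 := L.κ_mul_self
  have q1 := p e1 n₁
  have q2 := p e1 n₂
  have q3 := p e1 f
  have q4 := p e2 n₁
  have q5 := p e2 n₂
  have q6 := p e2 f
  have q7 := p e3 f
  simp only [map_add, map_smul, add_apply, smul_apply, smul_eq_mul, h.null₁,
    h.null₂, h.pair, h.pair'] at q1 q2 q3 q4 q5 q6 q7
  have o1 : L.κ * L.form n₁' f' = 0 := by
    linear_combination L.κ * q3 - L.κ * L.form n₁' f' * a5 - L.form n₁' f' * a6 -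
      (L.form n₁' n₂' - 1) * a3 - L.form n₁' n₁' * a4
  have o2 : L.κ * L.form n₂' f' = 0 := by
    linear_combination L.κ * q6 - L.κ * L.form n₂' f' * a5 - L.form n₂' f' * a6 -
      (L.form n₂' n₂') * a3 - (L.form n₂' n₁' - 1) * a4
  refine ⟨?_, ?_, ?_, ?_, ?_, ?_, ?_⟩
  · linear_combination q1 - L.form n₁' f' * a1
  · linear_combination q5 - L.form n₂' f' * a2
  · linear_combination q2 - L.form n₁' f' * a2
  · rw [L.symm]; exact o1
  · rw [L.symm]; exact o2
  · linear_combination q7 - L.κ * L.form f' f' * a5 - L.form f' f' * a6 -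
      (L.form f' n₂') * a3 - (L.form f' n₁') * a4 + a5
  · intro u v
    conv_lhs => rw [← h' u, frameMap_apply]
    simp only [map_add, map_smul, add_apply, smul_apply, smul_eq_mul, L.symm v]

end IsNullFrame
end LorentzModel

end LorentzModels

/-! ### The structure equations in a vector space -/

section AdaptedFrames

variable {E : Type*} [NormedAddCommGroup E] [NormedSpace ℝ E]
variable {V : Type*} [NormedAddCommGroup V] [NormedSpace ℝ V] (L : LorentzModel V)

/-- Frames `f, n₁, n₂` on a subset of a vector space solving the structure equations with
coefficients `a₀, a₁, a₂`. -/
structure IsAdaptedOn (a₀ a₁ a₂ : E → E →L[ℝ] ℝ) (s : Set E) (f n₁ n₂ : E → V) : Prop where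
  base : ∀ y ∈ s, HasFDerivAt f ((a₁ y).smulRight (n₁ y) + (a₂ y).smulRight (n₂ y)) y
  left : ∀ y ∈ s, HasFDerivAt n₁ ((a₀ y).smulRight (n₁ y) - L.κ • (a₂ y).smulRight (f y)) y
  right : ∀ y ∈ s, HasFDerivAt n₂ (-(a₀ y).smulRight (n₂ y) - L.κ • (a₁ y).smulRight (f y)) y

variable {L} {a₀ a₁ a₂ : E → E →L[ℝ] ℝ} {s : Set E} {f n₁ n₂ f' n₁' n₂' : E → V}

/-- Both frames solve the same equations, and the derivatives of the three summands of the frame map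
cancel each other. The null relations play no role, which allows the next lemma to deduce them. -/
theorem IsAdaptedOn.frameMap_eq (h : IsAdaptedOn L a₀ a₁ a₂ s f n₁ n₂)
    (h' : IsAdaptedOn L a₀ a₁ a₂ s f' n₁' n₂') (hs : IsOpen s) (hs' : IsPreconnected s)
    {x y : E} (hx : x ∈ s) (hy : y ∈ s) :
    L.frameMap (f x) (n₁ x) (n₂ x) (f' x) (n₁' x) (n₂' x) =
      L.frameMap (f y) (n₁ y) (n₂ y) (f' y) (n₁' y) (n₂' y) := by
  ext u
  have key : ∀ z ∈ s, HasFDerivAt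
      (fun z => L.frameMap (f z) (n₁ z) (n₂ z) (f' z) (n₁' z) (n₂' z) u) (0 : E →L[ℝ] V) z := by
    intro z hz
    have e0 := (L.form u).hasFDerivAt.comp z (h.base z hz)
    have e1 := (L.form u).hasFDerivAt.comp z (h.left z hz)
    have e2 := (L.form u).hasFDerivAt.comp z (h.right z hz)
    have e := (((e0.smul (h'.base z hz)).const_smul L.κ).add (e2.smul (h'.left z hz))).add
      (e1.smul (h'.right z hz))
    simp only [LorentzModel.frameMap_apply]
    refine e.congr_fderiv ?_
    ext v
    simp only [Function.comp_apply, add_apply, smul_apply, sub_apply, neg_apply,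
      ContinuousLinearMap.comp_apply, ContinuousLinearMap.smulRight_apply, map_add, map_sub,
      map_smul, map_neg, smul_eq_mul, zero_apply]
    module
  exact hs.is_const_of_fderiv_eq_zero hs'
    (fun z hz => (key z hz).differentiableAt.differentiableWithinAt)
    (fun z hz => (key z hz).fderiv) hx hy

/-- The frame map from the frame to itself is constant and is the identity at `x`; hence it is the
identity at `y`. -/
theorem IsAdaptedOn.isNullFrame [FiniteDimensional ℝ V] (h : IsAdaptedOn L a₀ a₁ a₂ s f n₁ n₂)
    (hs : IsOpen s) (hs' : IsPreconnected s) {x y : E} (hx : x ∈ s) (hy : y ∈ s)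
    (hn : L.IsNullFrame (f x) (n₁ x) (n₂ x)) : L.IsNullFrame (f y) (n₁ y) (n₂ y) :=
  hn.of_frameMap_self fun u => by rw [← h.frameMap_eq h hs hs' hx hy, hn.frameMap_self]

/-- The constant frame map `A` carries n₁, n₂ to n₁', n₂', so f' and A ∘ f have the same
differential and differ by a constant. It is annihilated by `κ` because `A` sends κf to κf'. -/
theorem IsAdaptedOn.exists_isometry (h : IsAdaptedOn L a₀ a₁ a₂ s f n₁ n₂)
    (h' : IsAdaptedOn L a₀ a₁ a₂ s f' n₁' n₂') (hs : IsOpen s) (hs' : IsPreconnected s)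
    (hn : ∀ y ∈ s, L.IsNullFrame (f y) (n₁ y) (n₂ y))
    (hn' : ∀ y ∈ s, L.IsNullFrame (f' y) (n₁' y) (n₂' y)) {x : E} (hx : x ∈ s) :
    ∃ g ∈ L.isometries, ∀ y ∈ s, f' y = g (f y) := by
  set A := L.frameMap (f x) (n₁ x) (n₂ x) (f' x) (n₁' x) (n₂' x) with hA
  have hAy : ∀ y ∈ s, A = L.frameMap (f y) (n₁ y) (n₂ y) (f' y) (n₁' y) (n₂' y) :=
    fun y hy => h.frameMap_eq h' hs hs' hx hy
  refine ⟨fun u => A u + (f' x - A (f x)), ⟨A, f' x - A (f x),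
    (hn x hx).form_frameMap (hn' x hx), ?_, fun _ => rfl⟩, fun y hy => ?_⟩
  · rw [smul_sub, hA, (hn x hx).frameMap_base, sub_self]
  · have key : ∀ z ∈ s, HasFDerivAt (fun z => f' z - A (f z)) (0 : E →L[ℝ] V) z := by
      intro z hz
      refine ((h'.base z hz).sub (A.hasFDerivAt.comp z (h.base z hz))).congr_fderiv ?_
      ext v
      simp only [add_apply, sub_apply, ContinuousLinearMap.comp_apply,
        ContinuousLinearMap.smulRight_apply, map_add, map_smul, zero_apply]
      rw [hAy z hz, (hn z hz).frameMap_null₁, (hn z hz).frameMap_null₂, sub_self]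
    have := hs.is_const_of_fderiv_eq_zero hs'
      (fun z hz => (key z hz).differentiableAt.differentiableWithinAt)
      (fun z hz => (key z hz).fderiv) hx hy
    dsimp only at this ⊢
    rw [this]; abel

/-- Bootstrapping: if `Z` has `n` continuous derivatives, so has its differential ΩZ. -/
theorem contDiffOn_of_hasFDerivAt_apply {W : Type*} [NormedAddCommGroup W] [NormedSpace ℝ W]
    {Ω : E → W →L[ℝ] E →L[ℝ] W} {Z : E → W} (hs : IsOpen s) (hΩ : ContDiffOn ℝ ∞ Ω s)
    (hZ : ∀ y ∈ s, HasFDerivAt Z (Ω y (Z y)) y) : ContDiffOn ℝ ∞ Z s := by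
  rw [contDiffOn_infty]
  intro n
  induction n with
  | zero =>
    rw [Nat.cast_zero, contDiffOn_zero]
    exact fun y hy => (hZ y hy).continuousAt.continuousWithinAt
  | succ n ih =>
    rw [Nat.cast_succ, contDiffOn_succ_iff_fderiv_of_isOpen hs]
    refine ⟨fun y hy => (hZ y hy).differentiableAt.differentiableWithinAt, by simp, ?_⟩
    refine ((hΩ.of_le (by exact_mod_cast le_top)).clm_apply ih).congr fun y hy => (hZ y hy).fderiv

/-- The operator `(a, z) ↦ a ⊗ D z`. -/
def tensorApply {W : Type*} [NormedAddCommGroup W] [NormedSpace ℝ W] (D : W →L[ℝ] W) :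
    (E →L[ℝ] ℝ) →L[ℝ] W →L[ℝ] E →L[ℝ] W :=
  ((ContinuousLinearMap.compL ℝ W W (E →L[ℝ] W)).flip D).comp
    (ContinuousLinearMap.smulRightL ℝ E W)

theorem fderiv_sum_comp {X F : Type*} [NormedAddCommGroup X] [NormedSpace ℝ X]
    [NormedAddCommGroup F] [NormedSpace ℝ F] (T₀ T₁ T₂ : X →L[ℝ] F) {b₀ b₁ b₂ : E → X} {y : E}
    (h₀ : DifferentiableAt ℝ b₀ y) (h₁ : DifferentiableAt ℝ b₁ y) (h₂ : DifferentiableAt ℝ b₂ y)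
    (v : E) : fderiv ℝ (fun y => T₀ (b₀ y) + T₁ (b₁ y) + T₂ (b₂ y)) y v =
      T₀ (fderiv ℝ b₀ y v) + T₁ (fderiv ℝ b₁ y v) + T₂ (fderiv ℝ b₂ y v) := by
  have e := (((T₀.hasFDerivAt.comp y h₀.hasFDerivAt).add
    (T₁.hasFDerivAt.comp y h₁.hasFDerivAt)).add (T₂.hasFDerivAt.comp y h₂.hasFDerivAt)).fderiv
  exact congrArg (fun T : E →L[ℝ] F => T v) e

theorem contDiffOn_sum_comp {X F : Type*} [NormedAddCommGroup X] [NormedSpace ℝ X]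
    [NormedAddCommGroup F] [NormedSpace ℝ F] (T₀ T₁ T₂ : X →L[ℝ] F) {b₀ b₁ b₂ : E → X}
    (h₀ : ContDiffOn ℝ ∞ b₀ s) (h₁ : ContDiffOn ℝ ∞ b₁ s) (h₂ : ContDiffOn ℝ ∞ b₂ s) :
    ContDiffOn ℝ ∞ (fun y => T₀ (b₀ y) + T₁ (b₁ y) + T₂ (b₂ y)) s :=
  ((T₀.contDiff.comp_contDiffOn h₀).add (T₁.contDiff.comp_contDiffOn h₁)).add
    (T₂.contDiff.comp_contDiffOn h₂)

theorem fderiv_sum_tensorApply {W : Type*} [NormedAddCommGroup W] [NormedSpace ℝ W]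
    (D₀ D₁ D₂ : W →L[ℝ] W) {y : E} (h₀ : DifferentiableAt ℝ a₀ y) (h₁ : DifferentiableAt ℝ a₁ y)
    (h₂ : DifferentiableAt ℝ a₂ y) (v w : E) (z : W) :
    fderiv ℝ (fun y => tensorApply D₀ (a₀ y) + tensorApply D₁ (a₁ y) + tensorApply D₂ (a₂ y)) y v z w
      = fderiv ℝ a₀ y v w • D₀ z + fderiv ℝ a₁ y v w • D₁ z + fderiv ℝ a₂ y v w • D₂ z := by
  have e := fderiv_sum_comp (F := W →L[ℝ] E →L[ℝ] W)
    (tensorApply D₀) (tensorApply D₁) (tensorApply D₂) h₀ h₁ h₂ v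
  rw [e]; rfl

theorem contDiffOn_sum_tensorApply {W : Type*} [NormedAddCommGroup W] [NormedSpace ℝ W]
    (D₀ D₁ D₂ : W →L[ℝ] W) (h₀ : ContDiffOn ℝ ∞ a₀ s) (h₁ : ContDiffOn ℝ ∞ a₁ s)
    (h₂ : ContDiffOn ℝ ∞ a₂ s) : ContDiffOn ℝ ∞
      (fun y => tensorApply D₀ (a₀ y) + tensorApply D₁ (a₁ y) + tensorApply D₂ (a₂ y)) s := by
  have e := contDiffOn_sum_comp (F := W →L[ℝ] E →L[ℝ] W)
    (tensorApply D₀) (tensorApply D₁) (tensorApply D₂) h₀ h₁ h₂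
  exact e

variable (L) in
/-- The linear system of the structure equations, for the unknown `(f, n₁, n₂)`. -/
def structureSystem (a₀ a₁ a₂ : E → E →L[ℝ] ℝ) (y : E) : (V × V × V) →L[ℝ] E →L[ℝ] (V × V × V) :=
  tensorApply ((0 : (V × V × V) →L[ℝ] V).prod
    (((ContinuousLinearMap.fst ℝ V V).comp (ContinuousLinearMap.snd ℝ V (V × V))).prod
      (-(ContinuousLinearMap.snd ℝ V V).comp (ContinuousLinearMap.snd ℝ V (V × V))))) (a₀ y) +
  tensorApply (((ContinuousLinearMap.fst ℝ V V).comp (ContinuousLinearMap.snd ℝ V (V × V))).prod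
    ((0 : (V × V × V) →L[ℝ] V).prod (-(L.κ • ContinuousLinearMap.fst ℝ V (V × V))))) (a₁ y) +
  tensorApply (((ContinuousLinearMap.snd ℝ V V).comp (ContinuousLinearMap.snd ℝ V (V × V))).prod
    ((-(L.κ • ContinuousLinearMap.fst ℝ V (V × V))).prod (0 : (V × V × V) →L[ℝ] V))) (a₂ y)

theorem structureSystem_apply (y v : E) (z : V × V × V) :
    structureSystem L a₀ a₁ a₂ y z v =
      a₀ y v • ((0, z.2.1, -z.2.2) : V × V × V) + a₁ y v • ((z.2.1, 0, -(L.κ • z.1)) : V × V × V) +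
      a₂ y v • ((z.2.2, -(L.κ • z.1), 0) : V × V × V) := rfl

theorem fderiv_structureSystem {y : E} (h₀ : DifferentiableAt ℝ a₀ y)
    (h₁ : DifferentiableAt ℝ a₁ y) (h₂ : DifferentiableAt ℝ a₂ y) (v w : E) (z : V × V × V) :
    fderiv ℝ (structureSystem L a₀ a₁ a₂) y v z w =
      fderiv ℝ a₀ y v w • ((0, z.2.1, -z.2.2) : V × V × V) +
      fderiv ℝ a₁ y v w • ((z.2.1, 0, -(L.κ • z.1)) : V × V × V) +
      fderiv ℝ a₂ y v w • ((z.2.2, -(L.κ • z.1), 0) : V × V × V) :=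
  fderiv_sum_tensorApply _ _ _ h₀ h₁ h₂ v w z

theorem contDiffOn_structureSystem (h₀ : ContDiffOn ℝ ∞ a₀ s) (h₁ : ContDiffOn ℝ ∞ a₁ s)
    (h₂ : ContDiffOn ℝ ∞ a₂ s) : ContDiffOn ℝ ∞ (structureSystem L a₀ a₁ a₂) s :=
  contDiffOn_sum_tensorApply _ _ _ h₀ h₁ h₂

/-- Written out in components, flatness of the structure system is a consequence of `hd₀`, `hd₁`,
`hd₂`. A solution that starts at a null frame remains one on the whole ball, which is connected. -/
theorem exists_isAdaptedOn [FiniteDimensional ℝ E] [FiniteDimensional ℝ V] {O : Set E}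
    (hO : IsOpen O) (h₀ : ContDiffOn ℝ ∞ a₀ O) (h₁ : ContDiffOn ℝ ∞ a₁ O) (h₂ : ContDiffOn ℝ ∞ a₂ O)
    (hd₀ : ∀ y ∈ O, ∀ v w, fderiv ℝ a₀ y v w - fderiv ℝ a₀ y w v =
      L.κ * (a₁ y v * a₂ y w - a₁ y w * a₂ y v))
    (hd₁ : ∀ y ∈ O, ∀ v w, fderiv ℝ a₁ y v w - fderiv ℝ a₁ y w v = a₁ y v * a₀ y w - a₁ y w * a₀ y v)
    (hd₂ : ∀ y ∈ O, ∀ v w, fderiv ℝ a₂ y v w - fderiv ℝ a₂ y w v =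
      -(a₂ y v * a₀ y w - a₂ y w * a₀ y v))
    {y₀ : E} (hy₀ : y₀ ∈ O) {e m₁ m₂ : V} (hn : L.IsNullFrame e m₁ m₂) :
    ∃ r > 0, ∃ f n₁ n₂ : E → V, Metric.ball y₀ r ⊆ O ∧
      IsAdaptedOn L a₀ a₁ a₂ (Metric.ball y₀ r) f n₁ n₂ ∧
      ContDiffOn ℝ ∞ f (Metric.ball y₀ r) ∧ ContDiffOn ℝ ∞ n₁ (Metric.ball y₀ r) ∧
      ContDiffOn ℝ ∞ n₂ (Metric.ball y₀ r) ∧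
      ∀ y ∈ Metric.ball y₀ r, L.IsNullFrame (f y) (n₁ y) (n₂ y) := by
  have : CompleteSpace V := FiniteDimensional.complete ℝ V
  set Ω := structureSystem L a₀ a₁ a₂ with hΩdef
  have hΩ : ContDiffOn ℝ ∞ Ω O := contDiffOn_structureSystem h₀ h₁ h₂
  have hdiff : ∀ {a : E → E →L[ℝ] ℝ}, ContDiffOn ℝ ∞ a O → ∀ y ∈ O, DifferentiableAt ℝ a y :=
    fun ha y hy => (ha.contDiffAt (hO.mem_nhds hy)).differentiableAt (by simp)
  have hflat : ∀ y ∈ O, ∀ v w z, fderiv ℝ Ω y v z w - fderiv ℝ Ω y w z v =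
      Ω y (Ω y z w) v - Ω y (Ω y z v) w := by
    intro y hy v w z
    rw [fderiv_structureSystem (hdiff h₀ y hy) (hdiff h₁ y hy) (hdiff h₂ y hy),
      fderiv_structureSystem (hdiff h₀ y hy) (hdiff h₁ y hy) (hdiff h₂ y hy)]
    rw [sub_eq_iff_eq_add.1 (hd₀ y hy v w), sub_eq_iff_eq_add.1 (hd₁ y hy v w),
      sub_eq_iff_eq_add.1 (hd₂ y hy v w)]
    obtain ⟨z0, z1, z2⟩ := z
    simp only [hΩdef, structureSystem_apply]
    refine Prod.ext ?_ (Prod.ext ?_ ?_) <;>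
    simp only [Prod.fst_add, Prod.snd_add, Prod.fst_sub, Prod.snd_sub, Prod.smul_fst,
      Prod.smul_snd] <;> module
  obtain ⟨Z, hZ0, hZ⟩ := exists_hasFDerivAt_of_flat (Ω := Ω) (y₀ := y₀)
    ((hΩ.contDiffAt (hO.mem_nhds hy₀)).of_le (by exact_mod_cast le_top))
    (by filter_upwards [hO.mem_nhds hy₀] with y hy using hflat y hy) (e, m₁, m₂)
  obtain ⟨r, hr, hball⟩ := Metric.eventually_nhds_iff_ball.1 (hZ.and (hO.mem_nhds hy₀))
  have hsub : Metric.ball y₀ r ⊆ O := fun y hy => (hball y hy).2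
  have hZs := contDiffOn_of_hasFDerivAt_apply Metric.isOpen_ball (hΩ.mono hsub)
    fun y hy => (hball y hy).1
  let p0 := ContinuousLinearMap.fst ℝ V (V × V)
  let p1 := (ContinuousLinearMap.fst ℝ V V).comp (ContinuousLinearMap.snd ℝ V (V × V))
  let p2 := (ContinuousLinearMap.snd ℝ V V).comp (ContinuousLinearMap.snd ℝ V (V × V))
  have had : IsAdaptedOn L a₀ a₁ a₂ (Metric.ball y₀ r) (fun y => (Z y).1) (fun y => (Z y).2.1)
      (fun y => (Z y).2.2) := by
    constructor <;> intro y hy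
    · refine (p0.hasFDerivAt.comp y (hball y hy).1).congr_fderiv ?_
      ext v
      change (structureSystem L a₀ a₁ a₂ y (Z y) v).1 = a₁ y v • (Z y).2.1 + a₂ y v • (Z y).2.2
      rw [structureSystem_apply]
      simp only [Prod.fst_add, Prod.smul_fst]
      module
    · refine (p1.hasFDerivAt.comp y (hball y hy).1).congr_fderiv ?_
      ext v
      change (structureSystem L a₀ a₁ a₂ y (Z y) v).2.1 =
        a₀ y v • (Z y).2.1 - L.κ • a₂ y v • (Z y).1
      rw [structureSystem_apply]
      simp only [Prod.snd_add, Prod.smul_snd, Prod.fst_add, Prod.smul_fst]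
      module
    · refine (p2.hasFDerivAt.comp y (hball y hy).1).congr_fderiv ?_
      ext v
      change (structureSystem L a₀ a₁ a₂ y (Z y) v).2.2 =
        -(a₀ y v • (Z y).2.2) - L.κ • a₁ y v • (Z y).1
      rw [structureSystem_apply]
      simp only [Prod.snd_add, Prod.smul_snd]
      module
  refine ⟨r, hr, _, _, _, hsub, had, p0.contDiff.comp_contDiffOn hZs,
    p1.contDiff.comp_contDiffOn hZs, p2.contDiff.comp_contDiffOn hZs, fun y hy => ?_⟩
  refine had.isNullFrame Metric.isOpen_ball (convex_ball y₀ r).isPreconnected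
    (Metric.mem_ball_self hr) hy ?_
  rw [hZ0]
  exact hn
end AdaptedFrames

/-! ### Passing between a manifold and its charts -/

section ChartDerivatives

variable {E : Type*} [NormedAddCommGroup E] [NormedSpace ℝ E]
variable {M : Type*} [TopologicalSpace M] [ChartedSpace E M] [IsManifold 𝓘(ℝ, E) ∞ M]

theorem mfderiv_extChartAt_mfderiv_symm (x₀ : M) {y : M} (hy : y ∈ (chartAt E x₀).source) (w : E) :
    mfderiv 𝓘(ℝ, E) 𝓘(ℝ, E) (extChartAt 𝓘(ℝ, E) x₀) y
      (mfderiv 𝓘(ℝ, E) 𝓘(ℝ, E) (extChartAt 𝓘(ℝ, E) x₀).symm (extChartAt 𝓘(ℝ, E) x₀ y) w) = w := by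
  have h := mfderiv_extChartAt_comp_mfderivWithin_extChartAt_symm' (I := 𝓘(ℝ, E)) (x := x₀) (y := y)
    (by simpa using hy)
  simp only [modelWithCornersSelf_coe, range_id, mfderivWithin_univ] at h
  exact congrArg (fun T : E →L[ℝ] E => T w) h

/-- The tangent vector at `y` with coordinates `w` in the chart around `x₀`. -/
def tangentLift (x₀ y : M) (w : E) : TangentSpace 𝓘(ℝ, E) y :=
  (mfderiv 𝓘(ℝ, E) 𝓘(ℝ, E) (extChartAt 𝓘(ℝ, E) x₀).symm (extChartAt 𝓘(ℝ, E) x₀ y) w : E)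

theorem mfderiv_extChartAt_tangentLift (x₀ : M) {y : M} (hy : y ∈ (chartAt E x₀).source) (w : E) :
    mfderiv 𝓘(ℝ, E) 𝓘(ℝ, E) (extChartAt 𝓘(ℝ, E) x₀) y (tangentLift x₀ y w) = w :=
  mfderiv_extChartAt_mfderiv_symm x₀ hy w

theorem mdifferentiableAt_extChartAt_symm (x₀ : M) {y : M} (hy : y ∈ (chartAt E x₀).source) :
    MDifferentiableAt 𝓘(ℝ, E) 𝓘(ℝ, E) (extChartAt 𝓘(ℝ, E) x₀).symm (extChartAt 𝓘(ℝ, E) x₀ y) :=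
  ((contMDiffOn_extChartAt_symm x₀).contMDiffAt ((isOpen_extChartAt_target x₀).mem_nhds
    ((extChartAt 𝓘(ℝ, E) x₀).map_source (by simpa using hy)))).mdifferentiableAt
    (n := ∞) (by simp)

variable {V : Type*} [NormedAddCommGroup V] [NormedSpace ℝ V]

theorem hasMFDerivAt_comp_extChartAt (x₀ : M) {y : M} (hy : y ∈ (chartAt E x₀).source)
    {g : E → V} {T : E →L[ℝ] V} (h : HasFDerivAt g T (extChartAt 𝓘(ℝ, E) x₀ y))
    {S : TangentSpace 𝓘(ℝ, E) y →L[ℝ] V}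
    (hS : ∀ v, ∀ u : E, mfderiv 𝓘(ℝ, E) 𝓘(ℝ, E) (extChartAt 𝓘(ℝ, E) x₀) y v = u → S v = T u) :
    HasMFDerivAt 𝓘(ℝ, E) 𝓘(ℝ, V) (g ∘ extChartAt 𝓘(ℝ, E) x₀) y S := by
  have h1 := h.hasMFDerivAt.comp y (mdifferentiableAt_extChartAt (I := 𝓘(ℝ, E)) hy).hasMFDerivAt
  have : S = T.comp (mfderiv 𝓘(ℝ, E) 𝓘(ℝ, E) (extChartAt 𝓘(ℝ, E) x₀) y) :=
    ContinuousLinearMap.ext fun v => hS v _ rfl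
  rw [this]
  exact h1

theorem hasFDerivAt_comp_extChartAt_symm (x₀ : M) {y : M} (hy : y ∈ (chartAt E x₀).source)
    {f : M → V} {S : TangentSpace 𝓘(ℝ, E) y →L[ℝ] V} (h : HasMFDerivAt 𝓘(ℝ, E) 𝓘(ℝ, V) f y S)
    {T : E →L[ℝ] V}
    (hS : ∀ v, ∀ u : E, mfderiv 𝓘(ℝ, E) 𝓘(ℝ, E) (extChartAt 𝓘(ℝ, E) x₀) y v = u → S v = T u) :
    HasFDerivAt (f ∘ (extChartAt 𝓘(ℝ, E) x₀).symm) T (extChartAt 𝓘(ℝ, E) x₀ y) := by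
  have hl : (extChartAt 𝓘(ℝ, E) x₀).symm (extChartAt 𝓘(ℝ, E) x₀ y) = y :=
    (extChartAt 𝓘(ℝ, E) x₀).left_inv (by simpa using hy)
  have h0 : HasMFDerivAt 𝓘(ℝ, E) 𝓘(ℝ, V) f
      ((extChartAt 𝓘(ℝ, E) x₀).symm (extChartAt 𝓘(ℝ, E) x₀ y)) S := by rw [hl]; exact h
  have h1 := (h0.comp (extChartAt 𝓘(ℝ, E) x₀ y)
    (mdifferentiableAt_extChartAt_symm x₀ hy).hasMFDerivAt).hasFDerivAt
  refine h1.congr_fderiv (ContinuousLinearMap.ext fun w => ?_)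
  exact hS _ _ (mfderiv_extChartAt_mfderiv_symm x₀ hy w)

end ChartDerivatives

/-! ### From forms to the transverse structure -/

section Developing

variable {E : Type*} [NormedAddCommGroup E] [NormedSpace ℝ E]
variable {M : Type*} [TopologicalSpace M] [ChartedSpace E M] [IsManifold 𝓘(ℝ, E) ∞ M]
variable {V : Type*} [NormedAddCommGroup V] [NormedSpace ℝ V] (L : LorentzModel V)

/-- The condition `(*)`, uniformly in the curvature: `dω₀ = κ ω₁ ∧ ω₂`. -/
def Foliation.HasFormsOfCurvature (F : Foliation E M 2) (κ : ℝ) : Prop :=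
  ∃ ω₀ ω₁ ω₂ : OneForm E M, F.IsDefinedByForms ω₀ ω₁ ω₂ ∧
    ∀ (x : M) (v w : TangentSpace 𝓘(ℝ, E) x), ω₀.d x v w = κ * ω₁.wedge ω₂ x v w

/-- The linear map `v ↦ α v • u + β v • w`. -/
def planeMap {W : Type*} [AddCommGroup W] [Module ℝ W] [TopologicalSpace W] (α β : W →L[ℝ] ℝ) (u w : V) :
    W →L[ℝ] V := α.smulRight u + β.smulRight w

/-- Frames `f, n₁, n₂` on a subset of a manifold solving the structure equations with
coefficients `ω₀, ω₁, ω₂`. -/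
structure IsAdaptedFrame (ω₀ ω₁ ω₂ : OneForm E M) (U : Set M) (f n₁ n₂ : M → V) : Prop where
  null : ∀ y ∈ U, L.IsNullFrame (f y) (n₁ y) (n₂ y)
  base : ∀ y ∈ U, HasMFDerivAt 𝓘(ℝ, E) 𝓘(ℝ, V) f y
    (planeMap (V := V) (W := TangentSpace 𝓘(ℝ, E) y) (ω₁.at y) (ω₂.at y) (n₁ y) (n₂ y))
  left : ∀ y ∈ U, HasMFDerivAt 𝓘(ℝ, E) 𝓘(ℝ, V) n₁ y
    (planeMap (V := V) (W := TangentSpace 𝓘(ℝ, E) y) (ω₀.at y) (ω₂.at y) (n₁ y) (-L.κ • f y))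
  right : ∀ y ∈ U, HasMFDerivAt 𝓘(ℝ, E) 𝓘(ℝ, V) n₂ y
    (planeMap (V := V) (W := TangentSpace 𝓘(ℝ, E) y) (ω₀.at y) (ω₁.at y) (-n₂ y) (-L.κ • f y))

variable {L} {ω₀ ω₁ ω₂ : OneForm E M} {U U' : Set M} {f n₁ n₂ f' n₁' n₂' : M → V}

theorem IsAdaptedFrame.inChart (h : IsAdaptedFrame L ω₀ ω₁ ω₂ U f n₁ n₂) (x₀ : M)
    {a₀ a₁ a₂ : E → E →L[ℝ] ℝ}
    (h₀ : ∀ y ∈ (chartAt E x₀).source, ∀ v : TangentSpace 𝓘(ℝ, E) y,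
      ω₀.at y v = a₀ (extChartAt 𝓘(ℝ, E) x₀ y)
        (mfderiv 𝓘(ℝ, E) 𝓘(ℝ, E) (extChartAt 𝓘(ℝ, E) x₀) y v))
    (h₁ : ∀ y ∈ (chartAt E x₀).source, ∀ v : TangentSpace 𝓘(ℝ, E) y,
      ω₁.at y v = a₁ (extChartAt 𝓘(ℝ, E) x₀ y)
        (mfderiv 𝓘(ℝ, E) 𝓘(ℝ, E) (extChartAt 𝓘(ℝ, E) x₀) y v))
    (h₂ : ∀ y ∈ (chartAt E x₀).source, ∀ v : TangentSpace 𝓘(ℝ, E) y,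
      ω₂.at y v = a₂ (extChartAt 𝓘(ℝ, E) x₀ y)
        (mfderiv 𝓘(ℝ, E) 𝓘(ℝ, E) (extChartAt 𝓘(ℝ, E) x₀) y v))
    {s : Set E} (hs : ∀ z ∈ s, z ∈ (extChartAt 𝓘(ℝ, E) x₀).target ∧
      (extChartAt 𝓘(ℝ, E) x₀).symm z ∈ U) :
    IsAdaptedOn L a₀ a₁ a₂ s (f ∘ (extChartAt 𝓘(ℝ, E) x₀).symm)
      (n₁ ∘ (extChartAt 𝓘(ℝ, E) x₀).symm) (n₂ ∘ (extChartAt 𝓘(ℝ, E) x₀).symm) := by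
  have key : ∀ z ∈ s, ∃ y ∈ (chartAt E x₀).source, y ∈ U ∧
      (extChartAt 𝓘(ℝ, E) x₀).symm z = y ∧ extChartAt 𝓘(ℝ, E) x₀ y = z := fun z hz =>
    ⟨_, by simpa using (extChartAt 𝓘(ℝ, E) x₀).map_target (hs z hz).1, (hs z hz).2, rfl,
      (extChartAt 𝓘(ℝ, E) x₀).right_inv (hs z hz).1⟩
  constructor <;> intro z hz <;> obtain ⟨y, hy, hyU, hzy, hyz⟩ := key z hz <;>
    simp only [Function.comp_apply, hzy] <;> rw [← hyz]
  · refine hasFDerivAt_comp_extChartAt_symm x₀ hy (h.base y hyU) fun v u hu => ?_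
    simp only [planeMap, add_apply, ContinuousLinearMap.smulRight_apply, hu, h₁ y hy, h₂ y hy]
  · refine hasFDerivAt_comp_extChartAt_symm x₀ hy (h.left y hyU) fun v u hu => ?_
    simp only [planeMap, add_apply, sub_apply, smul_apply, ContinuousLinearMap.smulRight_apply,
      hu, h₀ y hy, h₂ y hy]
    module
  · refine hasFDerivAt_comp_extChartAt_symm x₀ hy (h.right y hyU) fun v u hu => ?_
    simp only [planeMap, add_apply, sub_apply, neg_apply, smul_apply,
      ContinuousLinearMap.smulRight_apply, hu, h₀ y hy, h₁ y hy]
    module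

theorem IsAdaptedFrame.exists_isometry (h : IsAdaptedFrame L ω₀ ω₁ ω₂ U f n₁ n₂)
    (h' : IsAdaptedFrame L ω₀ ω₁ ω₂ U' f' n₁' n₂') (hU : IsOpen U) (hU' : IsOpen U')
    {x : M} (hx : x ∈ U) (hx' : x ∈ U') : ∃ g ∈ L.isometries, ∀ᶠ y in 𝓝 x, f' y = g (f y) := by
  obtain ⟨a₀, -, h₀⟩ := ω₀.exists_chart_repr x
  obtain ⟨a₁, -, h₁⟩ := ω₁.exists_chart_repr x
  obtain ⟨a₂, -, h₂⟩ := ω₂.exists_chart_repr x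
  set χ := extChartAt 𝓘(ℝ, E) x with hχ
  have htend : Tendsto χ.symm (𝓝 (χ x)) (𝓝 x) := by
    have := (continuousAt_extChartAt_symm (I := 𝓘(ℝ, E)) x)
    rwa [ContinuousAt, extChartAt_to_inv] at this
  obtain ⟨r, hr, hball⟩ := Metric.eventually_nhds_iff_ball.1
    ((show ∀ᶠ z in 𝓝 (χ x), z ∈ χ.target from extChartAt_target_mem_nhds x).and ((htend.eventually (hU.mem_nhds hx)).and
      (htend.eventually (hU'.mem_nhds hx'))))
  have e := h.inChart x h₀ h₁ h₂ (s := Metric.ball (χ x) r)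
    fun z hz => ⟨(hball z hz).1, (hball z hz).2.1⟩
  have e' := h'.inChart x h₀ h₁ h₂ (s := Metric.ball (χ x) r)
    fun z hz => ⟨(hball z hz).1, (hball z hz).2.2⟩
  obtain ⟨g, hg, hgf⟩ := e.exists_isometry e' Metric.isOpen_ball (convex_ball _ _).isPreconnected
    (fun z hz => h.null _ (hball z hz).2.1) (fun z hz => h'.null _ (hball z hz).2.2)
    (Metric.mem_ball_self hr)
  refine ⟨g, hg, ?_⟩
  filter_upwards [(continuousAt_extChartAt (I := 𝓘(ℝ, E)) x).eventually
    (Metric.ball_mem_nhds (χ x) hr), extChartAt_source_mem_nhds (I := 𝓘(ℝ, E)) x] with y hy hys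
  have := hgf _ hy
  simp only [Function.comp_apply] at this
  rwa [χ.left_inv hys] at this

theorem OneForm.fderiv_chart_repr (α : OneForm E M) (x₀ : M) {a : E → E →L[ℝ] ℝ}
    (ha : ContDiffOn ℝ ∞ a (extChartAt 𝓘(ℝ, E) x₀).target)
    (h : ∀ y ∈ (chartAt E x₀).source, ∀ v : TangentSpace 𝓘(ℝ, E) y,
      α.at y v = a (extChartAt 𝓘(ℝ, E) x₀ y)
        (mfderiv 𝓘(ℝ, E) 𝓘(ℝ, E) (extChartAt 𝓘(ℝ, E) x₀) y v))
    {y : M} (hy : y ∈ (chartAt E x₀).source) (v w : E) :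
    fderiv ℝ a (extChartAt 𝓘(ℝ, E) x₀ y) v w - fderiv ℝ a (extChartAt 𝓘(ℝ, E) x₀ y) w v =
      α.d y (tangentLift x₀ y v) (tangentLift x₀ y w) := by
  have hy' : y ∈ (extChartAt 𝓘(ℝ, E) x₀).source := by simpa using hy
  have hd := α.d_apply_of_eventually (φ := extChartAt 𝓘(ℝ, E) x₀) (a := a)
    (contMDiffAt_extChartAt' hy)
    ((ha.contDiffAt ((isOpen_extChartAt_target x₀).mem_nhds
      ((extChartAt 𝓘(ℝ, E) x₀).map_source hy'))).differentiableAt (by simp))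
    (by filter_upwards [(chartAt E x₀).open_source.mem_nhds hy] with y hy using h y hy)
    (tangentLift x₀ y v) (tangentLift x₀ y w)
  rw [hd]
  have e := mfderiv_extChartAt_tangentLift x₀ hy
  exact (congrArg₂ (fun p q : E => fderiv ℝ a (extChartAt 𝓘(ℝ, E) x₀ y) p q -
    fderiv ℝ a (extChartAt 𝓘(ℝ, E) x₀ y) q p) (e v) (e w)).symm

theorem exists_isAdaptedFrame [FiniteDimensional ℝ E] [FiniteDimensional ℝ V]
    (hd₀ : ∀ (x : M) (v w : TangentSpace 𝓘(ℝ, E) x), ω₀.d x v w = L.κ * ω₁.wedge ω₂ x v w)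
    (hd₁ : ∀ (x : M) (v w : TangentSpace 𝓘(ℝ, E) x), ω₁.d x v w = ω₁.wedge ω₀ x v w)
    (hd₂ : ∀ (x : M) (v w : TangentSpace 𝓘(ℝ, E) x), ω₂.d x v w = -ω₂.wedge ω₀ x v w)
    {e m₁ m₂ : V} (hn : L.IsNullFrame e m₁ m₂) (x : M) :
    ∃ (U : Set M) (f n₁ n₂ : M → V), IsOpen U ∧ x ∈ U ∧ ContMDiffOn 𝓘(ℝ, E) 𝓘(ℝ, V) ∞ f U ∧
      IsAdaptedFrame L ω₀ ω₁ ω₂ U f n₁ n₂ := by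
  obtain ⟨a₀, hs₀, h₀⟩ := ω₀.exists_chart_repr x
  obtain ⟨a₁, hs₁, h₁⟩ := ω₁.exists_chart_repr x
  obtain ⟨a₂, hs₂, h₂⟩ := ω₂.exists_chart_repr x
  set χ := extChartAt 𝓘(ℝ, E) x with hχ
  have key : ∀ z ∈ χ.target, ∃ y ∈ (chartAt E x).source, χ y = z := fun z hz =>
    ⟨χ.symm z, by simpa [hχ] using χ.map_target hz, χ.right_inv hz⟩
  have pull : ∀ {α : OneForm E M} {a : E → E →L[ℝ] ℝ}
    (_ : ∀ y ∈ (chartAt E x).source, ∀ v : TangentSpace 𝓘(ℝ, E) y,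
      α.at y v = a (χ y) (mfderiv 𝓘(ℝ, E) 𝓘(ℝ, E) χ y v)),
    ∀ y ∈ (chartAt E x).source, ∀ w : E,
      α.at y (tangentLift x y w) = a (χ y) w := by
    intro α a h y hy w
    exact (h y hy _).trans (congrArg (a (χ y)) (mfderiv_extChartAt_tangentLift x hy w))
  obtain ⟨r, hr, f, n₁, n₂, hsub, had, hf, hn₁, hn₂, hnull⟩ := exists_isAdaptedOn (L := L)
    (isOpen_extChartAt_target x) hs₀ hs₁ hs₂
    (fun z hz v w => by
      obtain ⟨y, hy, rfl⟩ := key z hz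
      rw [ω₀.fderiv_chart_repr x hs₀ h₀ hy, hd₀, OneForm.wedge]
      simp only [pull h₁ y hy, pull h₂ y hy])
    (fun z hz v w => by
      obtain ⟨y, hy, rfl⟩ := key z hz
      rw [ω₁.fderiv_chart_repr x hs₁ h₁ hy, hd₁, OneForm.wedge]
      simp only [pull h₁ y hy, pull h₀ y hy])
    (fun z hz v w => by
      obtain ⟨y, hy, rfl⟩ := key z hz
      rw [ω₂.fderiv_chart_repr x hs₂ h₂ hy, hd₂, OneForm.wedge]
      simp only [pull h₂ y hy, pull h₀ y hy])
    (χ.map_source (mem_extChartAt_source x)) hn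
  have hχs : ContMDiffOn 𝓘(ℝ, E) 𝓘(ℝ, E) ∞ χ (chartAt E x).source := contMDiffOn_extChartAt
  refine ⟨(chartAt E x).source ∩ χ ⁻¹' Metric.ball (χ x) r, f ∘ χ, n₁ ∘ χ, n₂ ∘ χ,
    hχs.continuousOn.isOpen_inter_preimage (chartAt E x).open_source Metric.isOpen_ball,
    ⟨mem_chart_source E x, Metric.mem_ball_self hr⟩,
    hf.contMDiffOn.comp (hχs.mono inter_subset_left) inter_subset_right,
    fun y hy => hnull _ hy.2, fun y hy => ?_, fun y hy => ?_, fun y hy => ?_⟩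
  · refine hasMFDerivAt_comp_extChartAt x hy.1 (had.base _ hy.2) fun v u hu => ?_
    rw [← hχ] at hu ⊢
    simp only [planeMap, add_apply, ContinuousLinearMap.smulRight_apply, h₁ y hy.1, h₂ y hy.1, hu]
    rfl
  · refine hasMFDerivAt_comp_extChartAt x hy.1 (had.left _ hy.2) fun v u hu => ?_
    rw [← hχ] at hu ⊢
    simp only [planeMap, add_apply, sub_apply, smul_apply, ContinuousLinearMap.smulRight_apply,
      h₀ y hy.1, h₂ y hy.1, hu, Function.comp_apply]
    module
  · refine hasMFDerivAt_comp_extChartAt x hy.1 (had.right _ hy.2) fun v u hu => ?_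
    rw [← hχ] at hu ⊢
    simp only [planeMap, add_apply, sub_apply, neg_apply, smul_apply,
      ContinuousLinearMap.smulRight_apply, h₀ y hy.1, h₁ y hy.1, hu, Function.comp_apply]
    module

/-- The atlas consists of all smooth maps that belong to an adapted frame of the three forms.
Pairing df = ω₁n₁ + ω₂n₂ with n₁ and n₂ shows that its kernel is that of ω₁ and ω₂. One null frame
of the model is the initial value of the system at every point. -/
theorem Foliation.HasFormsOfCurvature.hasTransverseStructure [FiniteDimensional ℝ E]
    [FiniteDimensional ℝ V] {F : Foliation E M 2} (h : F.HasFormsOfCurvature L.κ)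
    {e m₁ m₂ : V} (hn : L.IsNullFrame e m₁ m₂) :
    F.HasTransverseStructure L.space L.isometries := by
  obtain ⟨ω₀, ω₁, ω₂, ⟨hF, hd₁, hd₂⟩, hd₀⟩ := h
  refine ⟨{c | IsOpen c.1 ∧ ContMDiffOn 𝓘(ℝ, E) 𝓘(ℝ, V) ∞ c.2 c.1 ∧
    ∃ n₁ n₂ : M → V, IsAdaptedFrame L ω₀ ω₁ ω₂ c.1 c.2 n₁ n₂}, fun x => ?_, ?_, ?_⟩
  · obtain ⟨U, f, n₁, n₂, hU, hx, hf, had⟩ := exists_isAdaptedFrame hd₀ hd₁ hd₂ hn x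
    exact ⟨(U, f), ⟨hU, hf, n₁, n₂, had⟩, hx⟩
  · rintro ⟨U, f⟩ ⟨hU, hf, n₁, n₂, had⟩
    refine ⟨hU, hf, fun x hx => ⟨(had.null x hx).norm, fun v => ?_⟩⟩
    have hx' := had.null x hx
    have hfv : mfderiv 𝓘(ℝ, E) 𝓘(ℝ, V) f x v = (ω₁.at x v • n₁ x + ω₂.at x v • n₂ x : V) := by
      rw [(had.base x hx).mfderiv]; rfl
    rw [hF]
    refine ⟨fun ⟨e1, e2⟩ => hfv.trans ?_, fun e => ?_⟩
    · rw [e1, e2, zero_smul, zero_smul, add_zero]; rfl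
    replace e : ω₁.at x v • n₁ x + ω₂.at x v • n₂ x = 0 := hfv.symm.trans e
    have e1 := congrArg (fun u : V => L.form u (n₁ x)) e
    have e2 := congrArg (fun u : V => L.form u (n₂ x)) e
    simp only [map_add, map_smul, add_apply, smul_apply, smul_eq_mul, hx'.null₁, hx'.null₂,
      hx'.pair, hx'.pair', map_zero, zero_apply] at e1 e2
    constructor <;> linarith
  · rintro ⟨U, f⟩ ⟨hU, hf, n₁, n₂, had⟩ ⟨U', f'⟩ ⟨hU', hf', n₁', n₂', had'⟩ x ⟨hx, hx'⟩
    exact had.exists_isometry had' hU hU' hx hx'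

end Developing

/-! ### Differentials of vector-valued maps -/

section TangentDerivative

variable {E : Type*} [NormedAddCommGroup E] [NormedSpace ℝ E]
variable {M : Type*} [TopologicalSpace M] [ChartedSpace E M]
variable {V : Type*} [NormedAddCommGroup V] [NormedSpace ℝ V]

/-- The differential of a map to a vector space, as a linear map to that space. -/
def tderiv (f : M → V) (x : M) : TangentSpace 𝓘(ℝ, E) x →L[ℝ] V := mfderiv 𝓘(ℝ, E) 𝓘(ℝ, V) f x

theorem tderiv_eq_of_hasMFDerivAt {f : M → V} {x : M} {S : TangentSpace 𝓘(ℝ, E) x →L[ℝ] V}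
    (h : HasMFDerivAt 𝓘(ℝ, E) 𝓘(ℝ, V) f x S) : tderiv f x = S := h.mfderiv

theorem hasMFDerivAt_tderiv {f : M → V} {x : M} (h : MDifferentiableAt 𝓘(ℝ, E) 𝓘(ℝ, V) f x) :
    HasMFDerivAt 𝓘(ℝ, E) 𝓘(ℝ, V) f x (tderiv f x) := h.hasMFDerivAt

theorem tderiv_affine {W : Type*} [NormedAddCommGroup W] [NormedSpace ℝ W] {f : M → V} {g : M → W}
    {x : M} (A : V →L[ℝ] W) (b : W) (hf : MDifferentiableAt 𝓘(ℝ, E) 𝓘(ℝ, V) f x)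
    (h : ∀ᶠ y in 𝓝 x, g y = A (f y) + b) (v : TangentSpace 𝓘(ℝ, E) x) :
    tderiv g x v = A (tderiv f x v) := by
  have h1 : HasFDerivAt (fun u => A u + b) A (f x) := A.hasFDerivAt.add_const b
  have h2 : HasMFDerivAt 𝓘(ℝ, E) 𝓘(ℝ, W) g x (A.comp (tderiv f x)) :=
    (h1.hasMFDerivAt.comp x (hasMFDerivAt_tderiv hf)).congr_of_eventuallyEq h
  rw [tderiv_eq_of_hasMFDerivAt h2]; rfl

/-- Differentiates each relation of a null frame; `k` is `κ` for those that hold only after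
multiplication by it, and `1` for the others. -/
theorem tderiv_form_eq_zero (B : V →L[ℝ] V →L[ℝ] ℝ) (k c : ℝ) {f g : M → V} {x : M}
    (hf : MDifferentiableAt 𝓘(ℝ, E) 𝓘(ℝ, V) f x) (hg : MDifferentiableAt 𝓘(ℝ, E) 𝓘(ℝ, V) g x)
    (h : ∀ᶠ y in 𝓝 x, k * B (f y) (g y) = c) (v : TangentSpace 𝓘(ℝ, E) x) :
    k * (B (tderiv f x v) (g x) + B (f x) (tderiv g x v)) = 0 := by
  have h0 : HasMFDerivAt 𝓘(ℝ, E) 𝓘(ℝ, V × V) (fun y => (f y, g y)) x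
      ((tderiv f x : E →L[ℝ] V).prod (tderiv g x : E →L[ℝ] V)) :=
    ⟨(hasMFDerivAt_tderiv hf).1.prodMk (hasMFDerivAt_tderiv hg).1,
      (hasMFDerivAt_tderiv hf).2.prodMk (hasMFDerivAt_tderiv hg).2⟩
  have h1 := (((B.isBoundedBilinearMap).hasFDerivAt (f x, g x)).const_mul k).hasMFDerivAt.comp x h0
  have h2 : HasMFDerivAt 𝓘(ℝ, E) 𝓘(ℝ, ℝ) (fun _ : M => c) x _ :=
    h1.congr_of_eventuallyEq (by filter_upwards [h] with y hy using hy.symm)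
  have h3 := hasMFDerivAt_unique h2 (hasMFDerivAt_const c x)
  have h4 : k * (B (f x) (tderiv g x v) + B (tderiv f x v) (g x)) = 0 :=
    congrArg (fun T : E →L[ℝ] ℝ => T v) h3
  rwa [add_comm]

end TangentDerivative

/-- Rank and nullity. Together with the submersions defining the foliation it makes ω₁ and ω₂
independent at every point. -/
theorem surjective_of_ker_eq {W : Type*} [AddCommGroup W] [Module ℝ W] [FiniteDimensional ℝ W]
    {D : W →ₗ[ℝ] (Fin 2 → ℝ)} (hD : Function.Surjective D) {T : W →ₗ[ℝ] ℝ × ℝ}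
    (h : ∀ v, T v = 0 ↔ D v = 0) : Function.Surjective T := by
  have hk : LinearMap.ker T = LinearMap.ker D := by ext v; simpa using h v
  have h1 := LinearMap.finrank_range_add_finrank_ker T
  have h2 := LinearMap.finrank_range_add_finrank_ker D
  rw [LinearMap.range_eq_top.2 hD, finrank_top, ← hk] at h2
  rw [← LinearMap.range_eq_top]
  apply Submodule.eq_top_of_finrank_eq
  simp only [Module.finrank_prod, Module.finrank_self, Module.finrank_fin_fun] at h2 ⊢
  omega

/-! ### Moving null frames along local defining maps -/

section LocalFrames

variable {E : Type*} [NormedAddCommGroup E] [NormedSpace ℝ E]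
variable {M : Type*} [TopologicalSpace M] [ChartedSpace E M]
variable {V : Type*} [NormedAddCommGroup V] [NormedSpace ℝ V]

/-- A local defining map of a foliation to a Lorentzian model, together with a null frame along
it. -/
structure LocalFrame (L : LorentzModel V) (F : Foliation E M 2) where
  /-- The domain. -/
  dom : Set M
  /-- The defining map. -/
  map : M → V
  /-- The first null vector field. -/
  left : M → V
  /-- The second null vector field. -/
  right : M → V
  isOpen_dom : IsOpen dom
  contMDiffOn_map : ContMDiffOn 𝓘(ℝ, E) 𝓘(ℝ, V) ∞ map dom
  contMDiffOn_left : ContMDiffOn 𝓘(ℝ, E) 𝓘(ℝ, V) ∞ left dom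
  contMDiffOn_right : ContMDiffOn 𝓘(ℝ, E) 𝓘(ℝ, V) ∞ right dom
  null : ∀ y ∈ dom, L.IsNullFrame (map y) (left y) (right y)
  mem_tangent : ∀ y ∈ dom, ∀ v : TangentSpace 𝓘(ℝ, E) y, v ∈ F.tangent y ↔ tderiv map y v = 0

namespace LocalFrame

variable {L : LorentzModel V} {F : Foliation E M 2} (c c' : LocalFrame L F) {x : M}

/-- The form `⟨df, n₂⟩`. -/
def form₁ (y : M) : TangentSpace 𝓘(ℝ, E) y →L[ℝ] ℝ := (L.form.flip (c.right y)).comp (tderiv c.map y)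

/-- The form `⟨df, n₁⟩`. -/
def form₂ (y : M) : TangentSpace 𝓘(ℝ, E) y →L[ℝ] ℝ := (L.form.flip (c.left y)).comp (tderiv c.map y)

/-- The form `⟨dn₁, n₂⟩`. -/
def form₀ (y : M) : TangentSpace 𝓘(ℝ, E) y →L[ℝ] ℝ :=
  (L.form.flip (c.right y)).comp (tderiv c.left y)

theorem form₁_apply (y : M) (v : TangentSpace 𝓘(ℝ, E) y) :
    c.form₁ y v = L.form (tderiv c.map y v) (c.right y) := rfl

theorem form₂_apply (y : M) (v : TangentSpace 𝓘(ℝ, E) y) :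
    c.form₂ y v = L.form (tderiv c.map y v) (c.left y) := rfl

theorem form₀_apply (y : M) (v : TangentSpace 𝓘(ℝ, E) y) :
    c.form₀ y v = L.form (tderiv c.left y v) (c.right y) := rfl

theorem contMDiffAt_map (hx : x ∈ c.dom) : ContMDiffAt 𝓘(ℝ, E) 𝓘(ℝ, V) ∞ c.map x :=
  c.contMDiffOn_map.contMDiffAt (c.isOpen_dom.mem_nhds hx)

theorem contMDiffAt_left (hx : x ∈ c.dom) : ContMDiffAt 𝓘(ℝ, E) 𝓘(ℝ, V) ∞ c.left x :=
  c.contMDiffOn_left.contMDiffAt (c.isOpen_dom.mem_nhds hx)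

theorem contMDiffAt_right (hx : x ∈ c.dom) : ContMDiffAt 𝓘(ℝ, E) 𝓘(ℝ, V) ∞ c.right x :=
  c.contMDiffOn_right.contMDiffAt (c.isOpen_dom.mem_nhds hx)

theorem mdifferentiableAt_map (hx : x ∈ c.dom) : MDifferentiableAt 𝓘(ℝ, E) 𝓘(ℝ, V) c.map x :=
  (c.contMDiffAt_map hx).mdifferentiableAt (by simp)

theorem mdifferentiableAt_left (hx : x ∈ c.dom) : MDifferentiableAt 𝓘(ℝ, E) 𝓘(ℝ, V) c.left x :=
  (c.contMDiffAt_left hx).mdifferentiableAt (by simp)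

theorem mdifferentiableAt_right (hx : x ∈ c.dom) : MDifferentiableAt 𝓘(ℝ, E) 𝓘(ℝ, V) c.right x :=
  (c.contMDiffAt_right hx).mdifferentiableAt (by simp)

theorem eventually_null (hx : x ∈ c.dom) :
    ∀ᶠ y in 𝓝 x, L.IsNullFrame (c.map y) (c.left y) (c.right y) := by
  filter_upwards [c.isOpen_dom.mem_nhds hx] with y hy using c.null y hy

theorem form_tderiv_map_base (hx : x ∈ c.dom) (v : TangentSpace 𝓘(ℝ, E) x) :
    L.κ * L.form (tderiv c.map x v) (c.map x) = 0 := by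
  have h := tderiv_form_eq_zero L.form L.κ L.κ (c.mdifferentiableAt_map hx)
    (c.mdifferentiableAt_map hx) ((c.eventually_null hx).mono fun y h => h.norm) v
  rw [L.symm (c.map x)] at h
  linarith

theorem tderiv_map (hx : x ∈ c.dom) (v : TangentSpace 𝓘(ℝ, E) x) :
    tderiv c.map x v = c.form₁ x v • c.left x + c.form₂ x v • c.right x := by
  rw [(c.null x hx).eq_sum (tderiv c.map x v), smul_smul, c.form_tderiv_map_base hx]
  simp [form₁_apply, form₂_apply]

/-- The component along n₁ is ω₀ by definition; those along n₂ and f come from differentiating ⟨n₁,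
n₁⟩ = 0 and κ⟨n₁, f⟩ = 0. -/
theorem tderiv_left (hx : x ∈ c.dom) (v : TangentSpace 𝓘(ℝ, E) x) :
    tderiv c.left x v = c.form₀ x v • c.left x - (L.κ * c.form₂ x v) • c.map x := by
  have h := tderiv_form_eq_zero L.form L.κ 0 (c.mdifferentiableAt_left hx)
    (c.mdifferentiableAt_map hx) ((c.eventually_null hx).mono fun y h => h.orth₁') v
  have h' := tderiv_form_eq_zero L.form 1 0 (c.mdifferentiableAt_left hx)
    (c.mdifferentiableAt_left hx) ((c.eventually_null hx).mono fun y h => by rw [h.null₁, mul_zero]) v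
  rw [L.symm (c.left x)] at h h'
  have e : L.form (tderiv c.left x v) (c.left x) = 0 := by linarith
  have e' : L.κ * L.form (tderiv c.left x v) (c.map x) = -(L.κ * c.form₂ x v) := by
    rw [form₂_apply]; linarith
  rw [(c.null x hx).eq_sum (tderiv c.left x v), smul_smul, e, e', form₀_apply]
  module

theorem tderiv_right (hx : x ∈ c.dom) (v : TangentSpace 𝓘(ℝ, E) x) :
    tderiv c.right x v = -c.form₀ x v • c.right x - (L.κ * c.form₁ x v) • c.map x := by
  have h := tderiv_form_eq_zero L.form L.κ 0 (c.mdifferentiableAt_right hx)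
    (c.mdifferentiableAt_map hx) ((c.eventually_null hx).mono fun y h => h.orth₂') v
  have h' := tderiv_form_eq_zero L.form 1 0 (c.mdifferentiableAt_right hx)
    (c.mdifferentiableAt_right hx)
    ((c.eventually_null hx).mono fun y h => by rw [h.null₂, mul_zero]) v
  have h'' := tderiv_form_eq_zero L.form 1 1 (c.mdifferentiableAt_left hx)
    (c.mdifferentiableAt_right hx)
    ((c.eventually_null hx).mono fun y h => by rw [h.pair, mul_one]) v
  rw [L.symm (c.right x)] at h h'
  rw [L.symm (c.left x)] at h''
  have e : L.form (tderiv c.right x v) (c.right x) = 0 := by linarith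
  have e' : L.κ * L.form (tderiv c.right x v) (c.map x) = -(L.κ * c.form₁ x v) := by
    rw [form₁_apply]; linarith
  have e'' : L.form (tderiv c.right x v) (c.left x) = -c.form₀ x v := by
    rw [form₀_apply]; linarith
  rw [(c.null x hx).eq_sum (tderiv c.right x v), smul_smul, e, e', e'']
  module

theorem tderiv_map_eq_zero_iff (hx : x ∈ c.dom) (v : TangentSpace 𝓘(ℝ, E) x) :
    tderiv c.map x v = 0 ↔ c.form₁ x v = 0 ∧ c.form₂ x v = 0 := by
  constructor
  · intro h
    rw [form₁_apply, form₂_apply, h]; simp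
  · rintro ⟨h1, h2⟩
    rw [c.tderiv_map hx, h1, h2]; simp

theorem exists_forms_eq [FiniteDimensional ℝ E] (hx : x ∈ c.dom) (a b : ℝ) :
    ∃ v : TangentSpace 𝓘(ℝ, E) x, c.form₁ x v = a ∧ c.form₂ x v = b := by
  obtain ⟨U, s, -, hxU, -, hs⟩ := F.exists_submersion x
  obtain ⟨hsurj, hker⟩ := hs x hxU
  have : FiniteDimensional ℝ (TangentSpace 𝓘(ℝ, E) x) := inferInstanceAs (FiniteDimensional ℝ E)
  have key := surjective_of_ker_eq (W := TangentSpace 𝓘(ℝ, E) x) (D := (tderiv s x).toLinearMap)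
    hsurj (T := ((c.form₁ x).toLinearMap).prod ((c.form₂ x).toLinearMap))
    (fun v => by
      refine Iff.trans ?_ (hker v)
      rw [c.mem_tangent x hx, c.tderiv_map_eq_zero_iff hx]
      exact Prod.mk_eq_zero)
  obtain ⟨v, hv⟩ := key (a, b)
  exact ⟨v, congrArg Prod.fst hv, congrArg Prod.snd hv⟩

theorem form₁_ne_zero [FiniteDimensional ℝ E] (hx : x ∈ c.dom) : c.form₁ x ≠ 0 := by
  obtain ⟨v, hv, -⟩ := c.exists_forms_eq hx 1 0
  intro h
  rw [h] at hv
  exact zero_ne_one hv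

/-- Rescaling the null frame by a positive function. -/
def scale (t : M → ℝ) (ht : ContMDiffOn 𝓘(ℝ, E) 𝓘(ℝ) ∞ t c.dom) (h0 : ∀ y ∈ c.dom, t y ≠ 0) :
    LocalFrame L F where
  dom := c.dom
  map := c.map
  left y := (t y)⁻¹ • c.left y
  right y := t y • c.right y
  isOpen_dom := c.isOpen_dom
  contMDiffOn_map := c.contMDiffOn_map
  contMDiffOn_left := (ht.inv₀ h0).smul c.contMDiffOn_left
  contMDiffOn_right := ht.smul c.contMDiffOn_right
  null y hy := (c.null y hy).scale (h0 y hy)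
  mem_tangent := c.mem_tangent

variable {c c'}

/-- The form ω₁ determines the frame. The vector An₂ - n₂' is orthogonal to the image of df', which
is the plane of n₁' and n₂', and, up to `κ`, to f', so it vanishes. Then An₁ is null and has product
`1` with n₂', which leaves only n₁'. -/
theorem right_eq_of_form₁_eq [FiniteDimensional ℝ E] {A : V →L[ℝ] V} {b : V}
    (hA : ∀ u v, L.form (A u) (A v) = L.form u v) (hb : L.κ • b = 0)
    (hx : x ∈ c.dom) (hx' : x ∈ c'.dom) (h : ∀ᶠ y in 𝓝 x, c'.map y = A (c.map y) + b)
    (h₁ : c'.form₁ x = c.form₁ x) : c'.right x = A (c.right x) ∧ c'.left x = A (c.left x) := by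
  have hd : ∀ v : TangentSpace 𝓘(ℝ, E) x, tderiv c'.map x v = A (tderiv c.map x v) :=
    fun v => tderiv_affine A b (c.mdifferentiableAt_map hx) h v
  have hn := c.null x hx
  have hn' := c'.null x hx'
  have hb' : ∀ u, L.κ * L.form u b = 0 := fun u => by
    have := congrArg (L.form u) hb
    simpa using this
  have hbase : ∀ {u}, L.κ * L.form u (c.map x) = 0 → L.κ * L.form (A u) (c'.map x) = 0 := by
    intro u hu
    rw [h.self_of_nhds, map_add, hA, mul_add, hu, hb', add_zero]
  have hr : A (c.right x) = c'.right x := by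
    rw [← sub_eq_zero]
    have hpair : ∀ v : TangentSpace 𝓘(ℝ, E) x, L.form (tderiv c'.map x v) (A (c.right x) - c'.right x) = 0 := by
      intro v
      have e : c'.form₁ x v = c.form₁ x v := by rw [h₁]
      rw [form₁_apply, form₁_apply] at e
      rw [map_sub, e, hd, hA, sub_self]
    refine hn'.eq_zero ?_ ?_ ?_
    · rw [map_sub, sub_apply, mul_sub, hbase hn.orth₂', hn'.orth₂', sub_self]
    · obtain ⟨v, hv1, hv2⟩ := c'.exists_forms_eq hx' 1 0
      rw [L.symm, ← hpair v, c'.tderiv_map hx', hv1, hv2]; simp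
    · obtain ⟨v, hv1, hv2⟩ := c'.exists_forms_eq hx' 0 1
      rw [L.symm, ← hpair v, c'.tderiv_map hx', hv1, hv2]; simp
  refine ⟨hr.symm, ?_⟩
  have e1 : A (c.left x) = c'.left x + L.form (A (c.left x)) (c'.left x) • c'.right x := by
    conv_lhs => rw [hn'.eq_sum (A (c.left x)), smul_smul, hbase hn.orth₁', ← hr, hA, hn.pair]
    rw [hr]; simp
  have e2 : L.form (A (c.left x)) (c'.left x) = 0 := by
    have e3 := hA (c.left x) (c.left x)
    rw [hn.null₁] at e3
    set s := L.form (A (c.left x)) (c'.left x)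
    rw [e1] at e3
    simp only [map_add, map_smul, add_apply, smul_apply, smul_eq_mul, hn'.null₁, hn'.null₂,
      hn'.pair, hn'.pair'] at e3
    linarith
  rw [e1, e2]; simp

/-- The linear part of `g` matches the frames. Since ω₀ involves dn₁, the forms ω₁ have to agree in
a neighbourhood and not merely at `x`. -/
theorem forms_eq_of_form₁_eq [FiniteDimensional ℝ E] {g : V → V} (hg : g ∈ L.isometries)
    (hx : x ∈ c.dom) (hx' : x ∈ c'.dom) (h : ∀ᶠ y in 𝓝 x, c'.map y = g (c.map y))
    (h₁ : ∀ᶠ y in 𝓝 x, c'.form₁ y = c.form₁ y) :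
    c'.form₂ x = c.form₂ x ∧ c'.form₀ x = c.form₀ x := by
  obtain ⟨A, b, hA, hb, hgA⟩ := hg
  simp only [hgA] at h
  have key : ∀ᶠ y in 𝓝 x, c'.right y = A (c.right y) ∧ c'.left y = A (c.left y) := by
    filter_upwards [eventually_eventually_nhds.2 h, h₁, c.isOpen_dom.mem_nhds hx,
      c'.isOpen_dom.mem_nhds hx'] with y h1 h2 h3 h4
    exact right_eq_of_form₁_eq hA hb h3 h4 h1 h2
  constructor
  · ext v
    rw [form₂_apply, form₂_apply, tderiv_affine A b (c.mdifferentiableAt_map hx) h,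
      key.self_of_nhds.2, hA]
  · ext v
    rw [form₀_apply, form₀_apply, tderiv_affine A 0 (c.mdifferentiableAt_left hx)
      (key.mono fun y hy => by rw [hy.2, add_zero]), key.self_of_nhds.1, hA]

end LocalFrame
end LocalFrames

/-! ### Gluing the local forms -/

section GlobalForms

variable {E : Type*} [NormedAddCommGroup E] [NormedSpace ℝ E]
variable {M : Type*} [TopologicalSpace M] [ChartedSpace E M] [IsManifold 𝓘(ℝ, E) ∞ M]
variable {V : Type*} [NormedAddCommGroup V] [NormedSpace ℝ V]
variable {L : LorentzModel V} {F : Foliation E M 2}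

namespace LocalFrame

variable (c : LocalFrame L F) {x : M}

/-- Once the structure equations are inserted in the formula for d⟨df, n₂⟩, the null and
orthogonality relations leave only ω₁ ∧ ω₀. -/
theorem d_eq_of_form₁ {α : OneForm E M} (hx : x ∈ c.dom) (h : ∀ᶠ y in 𝓝 x, α.at y = c.form₁ y)
    (v w : TangentSpace 𝓘(ℝ, E) x) :
    α.d x v w = c.form₁ x v * c.form₀ x w - c.form₁ x w * c.form₀ x v := by
  rw [α.d_apply_of_pairing L.form (c.contMDiffAt_map hx) (c.contMDiffAt_right hx)
    (h.mono fun y hy v => by rw [hy]; rfl)]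
  change L.form (tderiv c.map x w) (tderiv c.right x v) -
    L.form (tderiv c.map x v) (tderiv c.right x w) = _
  have hn := c.null x hx
  have e1 := hn.orth₁'
  have e2 := hn.orth₂'
  simp only [c.tderiv_map hx, c.tderiv_right hx, map_add, map_sub, map_smul, add_apply,
    smul_apply, smul_eq_mul, hn.null₂, hn.pair]
  linear_combination (-c.form₁ x w * c.form₁ x v + c.form₁ x v * c.form₁ x w) * e1 +
    (-c.form₂ x w * c.form₁ x v + c.form₂ x v * c.form₁ x w) * e2

theorem d_eq_of_form₂ {α : OneForm E M} (hx : x ∈ c.dom) (h : ∀ᶠ y in 𝓝 x, α.at y = c.form₂ y)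
    (v w : TangentSpace 𝓘(ℝ, E) x) :
    α.d x v w = -(c.form₂ x v * c.form₀ x w - c.form₂ x w * c.form₀ x v) := by
  rw [α.d_apply_of_pairing L.form (c.contMDiffAt_map hx) (c.contMDiffAt_left hx)
    (h.mono fun y hy v => by rw [hy]; rfl)]
  change L.form (tderiv c.map x w) (tderiv c.left x v) -
    L.form (tderiv c.map x v) (tderiv c.left x w) = _
  have hn := c.null x hx
  have e1 := hn.orth₁'
  have e2 := hn.orth₂'
  simp only [c.tderiv_map hx, c.tderiv_left hx, map_add, map_sub, map_smul, add_apply,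
    smul_apply, smul_eq_mul, hn.null₁, hn.pair']
  linear_combination (-c.form₁ x w * c.form₂ x v + c.form₁ x v * c.form₂ x w) * e1 +
    (-c.form₂ x w * c.form₂ x v + c.form₂ x v * c.form₂ x w) * e2

/-- The curvature arises from the f-components of dn₁ and dn₂: their product carries κ²⟨f, f⟩, which
equals `κ`. -/
theorem d_eq_of_form₀ {α : OneForm E M} (hx : x ∈ c.dom) (h : ∀ᶠ y in 𝓝 x, α.at y = c.form₀ y)
    (v w : TangentSpace 𝓘(ℝ, E) x) :
    α.d x v w = L.κ * (c.form₁ x v * c.form₂ x w - c.form₁ x w * c.form₂ x v) := by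
  rw [α.d_apply_of_pairing L.form (c.contMDiffAt_left hx) (c.contMDiffAt_right hx)
    (h.mono fun y hy v => by rw [hy]; rfl)]
  change L.form (tderiv c.left x w) (tderiv c.right x v) -
    L.form (tderiv c.left x v) (tderiv c.right x w) = _
  have hn := c.null x hx
  have e1 := hn.orth₁'
  have e2 := hn.orth₂
  have e3 := hn.norm
  have e4 := L.κ_mul_self
  simp only [c.tderiv_left hx, c.tderiv_right hx, map_sub, map_smul, sub_apply,
    smul_apply, smul_eq_mul, hn.pair]
  linear_combination (-c.form₀ x w * c.form₁ x v + c.form₀ x v * c.form₁ x w) * e1 +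
    (c.form₂ x w * c.form₀ x v - c.form₂ x v * c.form₀ x w) * e2 +
    L.κ * (c.form₁ x v * c.form₂ x w - c.form₁ x w * c.form₂ x v) * e3 +
    (c.form₁ x v * c.form₂ x w - c.form₁ x w * c.form₂ x v) * e4

theorem smoothFormAt_form₁ {α : ∀ x : M, TangentSpace 𝓘(ℝ, E) x →L[ℝ] Bundle.Trivial M ℝ x}
    (hx : x ∈ c.dom) (h : ∀ᶠ y in 𝓝 x, α y = c.form₁ y) : SmoothFormAt α x :=
  smoothFormAt_pairing L.form α (c.contMDiffAt_map hx) (c.contMDiffAt_right hx)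
    (h.mono fun y hy v => by rw [hy]; rfl)

theorem smoothFormAt_form₂ {α : ∀ x : M, TangentSpace 𝓘(ℝ, E) x →L[ℝ] Bundle.Trivial M ℝ x}
    (hx : x ∈ c.dom) (h : ∀ᶠ y in 𝓝 x, α y = c.form₂ y) : SmoothFormAt α x :=
  smoothFormAt_pairing L.form α (c.contMDiffAt_map hx) (c.contMDiffAt_left hx)
    (h.mono fun y hy v => by rw [hy]; rfl)

theorem smoothFormAt_form₀ {α : ∀ x : M, TangentSpace 𝓘(ℝ, E) x →L[ℝ] Bundle.Trivial M ℝ x}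
    (hx : x ∈ c.dom) (h : ∀ᶠ y in 𝓝 x, α y = c.form₀ y) : SmoothFormAt α x :=
  smoothFormAt_pairing L.form α (c.contMDiffAt_left hx) (c.contMDiffAt_right hx)
    (h.mono fun y hy v => by rw [hy]; rfl)

end LocalFrame

/-- Local frames with the same form `⟨df, n₂⟩` define global forms. -/
theorem hasFormsOfCurvature_of_normalized [FiniteDimensional ℝ E] (c : M → LocalFrame L F)
    (hc : ∀ x, x ∈ (c x).dom)
    (hiso : ∀ x z y, y ∈ (c x).dom → y ∈ (c z).dom →
      ∃ g ∈ L.isometries, ∀ᶠ y' in 𝓝 y, (c z).map y' = g ((c x).map y'))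
    (h₁ : ∀ x z y, y ∈ (c x).dom → y ∈ (c z).dom → (c z).form₁ y = (c x).form₁ y) :
    F.HasFormsOfCurvature L.κ := by
  have key : ∀ x, ∀ y ∈ (c x).dom, (c y).form₁ y = (c x).form₁ y ∧
      (c y).form₂ y = (c x).form₂ y ∧ (c y).form₀ y = (c x).form₀ y := by
    intro x y hy
    obtain ⟨g, hg, h⟩ := hiso x y y hy (hc y)
    have := LocalFrame.forms_eq_of_form₁_eq hg hy (hc y) h (by
      filter_upwards [(c x).isOpen_dom.mem_nhds hy, (c y).isOpen_dom.mem_nhds (hc y)] with z hz hz'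
      exact h₁ x y z hz hz')
    exact ⟨h₁ x y y hy (hc y), this⟩
  have ev : ∀ x, ∀ᶠ y in 𝓝 x, (c y).form₁ y = (c x).form₁ y ∧
      (c y).form₂ y = (c x).form₂ y ∧ (c y).form₀ y = (c x).form₀ y := fun x => by
    filter_upwards [(c x).isOpen_dom.mem_nhds (hc x)] with y hy using key x y hy
  -- The value at `y` is taken from the frame chosen at `y`, but by `ev` it comes from the single
  -- frame `c x` for all `y` near `x`, so smoothness and differentials are computed there.
  let ω₁ : OneForm E M := ⟨fun y => (c y).form₁ y, fun x =>
    (c x).smoothFormAt_form₁ (hc x) ((ev x).mono fun y hy => hy.1)⟩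
  let ω₂ : OneForm E M := ⟨fun y => (c y).form₂ y, fun x =>
    (c x).smoothFormAt_form₂ (hc x) ((ev x).mono fun y hy => hy.2.1)⟩
  let ω₀ : OneForm E M := ⟨fun y => (c y).form₀ y, fun x =>
    (c x).smoothFormAt_form₀ (hc x) ((ev x).mono fun y hy => hy.2.2)⟩
  refine ⟨ω₀, ω₁, ω₂, ⟨fun x v => ?_, fun x v w => ?_, fun x v w => ?_⟩, fun x v w => ?_⟩
  · rw [(c x).mem_tangent x (hc x), (c x).tderiv_map_eq_zero_iff (hc x)]; rfl
  · exact (c x).d_eq_of_form₁ (α := ω₁) (hc x) ((ev x).mono fun y hy => hy.1) v w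
  · exact (c x).d_eq_of_form₂ (α := ω₂) (hc x) ((ev x).mono fun y hy => hy.2.1) v w
  · exact (c x).d_eq_of_form₀ (α := ω₀) (hc x) ((ev x).mono fun y hy => hy.2.2) v w

/-- Local frames the null directions of which agree, with orientations, define global forms. -/
theorem hasFormsOfCurvature_of_positive [FiniteDimensional ℝ E] [T2Space M] [SigmaCompactSpace M]
    (c : M → LocalFrame L F) (hc : ∀ x, x ∈ (c x).dom)
    (hiso : ∀ x z y, y ∈ (c x).dom → y ∈ (c z).dom →
      ∃ g ∈ L.isometries, ∀ᶠ y' in 𝓝 y, (c z).map y' = g ((c x).map y'))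
    (h₁ : ∀ x z y, y ∈ (c x).dom → y ∈ (c z).dom →
      ∃ t : ℝ, 0 < t ∧ (c z).form₁ y = t • (c x).form₁ y) :
    F.HasFormsOfCurvature L.κ := by
  -- The positive multiples of a linear form are a convex set, so a partition of unity yields a
  -- global form that is everywhere a positive multiple of the local ω₁.
  obtain ⟨α, hα⟩ := exists_contMDiffSection_forall_mem_convex_of_local (n := ⊤) 𝓘(ℝ, E)
    (F_fiber := E →L[ℝ] ℝ) (fun x : M => TangentSpace 𝓘(ℝ, E) x →L[ℝ] Bundle.Trivial M ℝ x)
    (fun y => {β | ∃ t : ℝ, 0 < t ∧ β = t • (c y).form₁ y})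
    (fun y => by
      rintro _ ⟨t, ht, rfl⟩ _ ⟨s, hs, rfl⟩ a b ha hb hab
      refine ⟨a * t + b * s, ?_, ?_⟩
      · rcases ha.eq_or_lt with rfl | ha
        · have : b = 1 := by linarith
          subst this; simpa using hs
        · have := mul_pos ha ht
          have := mul_nonneg hb hs.le
          linarith
      · rw [add_smul, mul_smul, mul_smul])
    (fun x => ⟨(c x).dom, (c x).isOpen_dom.mem_nhds (hc x), fun y => (c x).form₁ y, fun y hy =>
      ((c x).smoothFormAt_form₁ hy (Eventually.of_forall fun _ => rfl)).contMDiffWithinAt,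
      fun y hy => h₁ y x y (hc y) hy⟩)
  have key : ∀ x, ∀ y ∈ (c x).dom, ∃ t : ℝ, 0 < t ∧ α y = t • (c x).form₁ y := by
    intro x y hy
    obtain ⟨t, ht, h⟩ := hα y
    obtain ⟨s, hs, h'⟩ := h₁ x y y hy (hc y)
    exact ⟨t * s, mul_pos ht hs, by rw [h, h', mul_smul]⟩
  choose t ht hαt using fun x y (hy : y ∈ (c x).dom) => key x y hy
  classical
  let t' : M → M → ℝ := fun x y => if hy : y ∈ (c x).dom then t x y hy else 1
  have ht' : ∀ x, ∀ y ∈ (c x).dom, 0 < t' x y ∧ α y = t' x y • (c x).form₁ y := by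
    intro x y hy
    simp only [t', dif_pos hy]
    exact ⟨ht x y hy, hαt x y hy⟩
  -- After this rescaling all the frames have `α` as their first form.
  refine hasFormsOfCurvature_of_normalized (fun x => (c x).scale (t' x) (fun y hy => ?_)
    fun y hy => (ht' x y hy).1.ne') hc hiso fun x z y hy hy' => ?_
  · refine (contMDiffAt_of_eventually_smul (α := fun y => α y) (β := fun y => (c x).form₁ y)
      (α.contMDiff y) ((c x).smoothFormAt_form₁ hy (Eventually.of_forall fun _ => rfl))
      ((c x).form₁_ne_zero hy) ?_).contMDiffWithinAt
    filter_upwards [(c x).isOpen_dom.mem_nhds hy] with z hz v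
    rw [(ht' x z hz).2]; rfl
  · have e : ∀ x, ∀ (h1 h2), y ∈ (c x).dom → ((c x).scale (t' x) h1 h2).form₁ y = α y := by
      intro x h1 h2 hy
      rw [(ht' x y hy).2]
      ext v
      exact map_smul (L.form (tderiv (c x).map y v)) (t' x y) ((c x).right y)
    exact (e z _ _ hy').trans (e x _ _ hy).symm

end GlobalForms

/-! ### Quotient coverings and connected components -/

section Coverings

theorem IsCoveringMap.t2Space {X Y : Type*} [TopologicalSpace X] [TopologicalSpace Y] [T2Space X]
    {p : Y → X} (hp : IsCoveringMap p) : T2Space Y := by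
  refine ⟨fun y z hyz => ?_⟩
  by_cases h : p y = p z
  · exact hp.isSeparatedMap y z h hyz
  · exact separated_by_continuous hp.continuous h

/-- The restriction of a quotient covering map by a finite group to the component of a point, the
base being connected. -/
theorem IsQuotientCoveringMap.restrict_connectedComponent {X Y G : Type*} [TopologicalSpace X]
    [TopologicalSpace Y] [Group G] [MulAction G Y] [LocallyConnectedSpace Y]
    [ConnectedSpace X] {p : Y → X} (hp : IsQuotientCoveringMap p G) (y₀ : Y) :
    IsCoveringMap (fun y : connectedComponent y₀ => p y) ∧
      ∀ x, Nat.card ((fun y : connectedComponent y₀ => p y) ⁻¹' {x}) ∣ Nat.card G := by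
  have := hp.toContinuousConstSMul
  set C := connectedComponent y₀ with hC
  have hopen : IsOpen C := isOpen_connectedComponent
  have hclosed : IsClosed C := isClosed_connectedComponent
  -- An element that moves one point of the component into it preserves the component, by
  -- connectedness.
  have hsmul : ∀ (g : G) (y : Y), y ∈ C → g • y ∈ C → ∀ z ∈ C, g • z ∈ C := by
    intro g y hy hgy z hz
    have h1 : IsPreconnected ((g • ·) '' C) :=
      isPreconnected_connectedComponent.image _ (continuous_const_smul g).continuousOn
    rw [hC, connectedComponent_eq hgy]
    exact h1.subset_connectedComponent ⟨y, hy, rfl⟩ ⟨z, hz, rfl⟩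
  -- The stabilizer of the component acts simply transitively on the fibres of the restricted
  -- covering; their size then divides the order of `G` by Lagrange.
  let H : Subgroup G :=
    { carrier := {g | ∀ z ∈ C, g • z ∈ C}
      mul_mem' := fun {a b} ha hb z hz => by rw [mul_smul]; exact ha _ (hb _ hz)
      one_mem' := fun z hz => by rwa [one_smul]
      inv_mem' := fun {a} ha => hsmul _ (a • y₀) (ha _ mem_connectedComponent)
        (by rw [inv_smul_smul]; exact mem_connectedComponent) }
  let S : SubMulAction H Y := ⟨C, fun g z hz => g.2 z hz⟩
  have hsurj : ∀ x, ∃ y ∈ C, p y = x := by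
    have hpo : IsOpenMap p := hp.isCoveringMap.isOpenMap
    have hU : IsOpen (⋃ g : G, (g • ·) ⁻¹' C) :=
      isOpen_iUnion fun g => hopen.preimage (continuous_const_smul g)
    have hcl : IsClopen (p '' C) := by
      refine ⟨⟨?_⟩, hpo _ hopen⟩
      -- The complement is the image of the points whose orbit avoids `C`. They form a union of
      -- components, hence an open set, so the image of `C` is clopen.
      have e : (p '' C)ᶜ = p '' {y | y ∉ ⋃ g : G, (g • ·) ⁻¹' C} := by
        ext x
        obtain ⟨y, rfl⟩ := hp.surjective x
        simp only [mem_compl_iff, mem_image, mem_ofPred_eq, mem_iUnion, mem_preimage]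
        constructor
        · intro h
          refine ⟨y, fun ⟨g, hg⟩ => h ⟨_, hg, hp.map_smul g⟩, rfl⟩
        · rintro ⟨z, hz, hzy⟩ ⟨w, hw, hwy⟩
          obtain ⟨g, hg⟩ := hp.apply_eq_iff_mem_orbit.1 (hwy.trans hzy.symm)
          exact hz ⟨g, by change g • z = w at hg; rwa [hg]⟩
      rw [e]
      refine hpo _ ?_
      have e2 : {y | y ∉ ⋃ g : G, (g • ·) ⁻¹' C} = ⋃ z ∈ {z | z ∉ ⋃ g : G, (g • ·) ⁻¹' C},
          connectedComponent z := by
        ext w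
        simp only [mem_ofPred_eq, mem_iUnion]
        constructor
        · intro hw
          exact ⟨w, hw, mem_connectedComponent⟩
        · rintro ⟨z, hz, hwz⟩ ⟨g, hg⟩
          refine hz ⟨g, ?_⟩
          have h1 : IsPreconnected ((g • ·) '' connectedComponent z) :=
            isPreconnected_connectedComponent.image _ (continuous_const_smul g).continuousOn
          have h2 := h1.subset_connectedComponent ⟨w, hwz, rfl⟩ ⟨z, mem_connectedComponent, rfl⟩
          rwa [← connectedComponent_eq hg] at h2
      rw [e2]
      exact isOpen_biUnion fun z _ => isOpen_connectedComponent
    intro x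
    have := hcl.eq_univ ⟨p y₀, y₀, mem_connectedComponent, rfl⟩
    have hx : x ∈ p '' C := this ▸ mem_univ x
    exact hx
  have hq : IsQuotientCoveringMap (fun y : S => p y) H := by
    refine { toIsQuotientMap := ?_, continuous_const_smul := ?_, apply_eq_iff_mem_orbit := ?_,
             disjoint := ?_ }
    · refine IsOpenMap.isQuotientMap (hp.isCoveringMap.isOpenMap.comp hopen.isOpenMap_subtype_val)
        (hp.isCoveringMap.continuous.comp continuous_subtype_val) fun x => ?_
      obtain ⟨y, hy, h⟩ := hsurj x
      exact ⟨⟨y, hy⟩, h⟩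
    · intro g
      exact ((continuous_const_smul (g : G)).comp continuous_subtype_val).subtype_mk _
    · rintro ⟨y, hy⟩ ⟨z, hz⟩
      rw [show (p (⟨y, hy⟩ : S) = p (⟨z, hz⟩ : S) ↔ y ∈ MulAction.orbit G z) from
        hp.apply_eq_iff_mem_orbit]
      constructor
      · rintro ⟨g, rfl⟩
        exact ⟨⟨g, hsmul g z hz hy⟩, rfl⟩
      · rintro ⟨g, hg⟩
        exact ⟨g, congrArg Subtype.val hg⟩
    · rintro ⟨y, hy⟩
      obtain ⟨U, hU, h⟩ := hp.disjoint y
      refine ⟨Subtype.val ⁻¹' U, continuous_subtype_val.continuousAt.preimage_mem_nhds hU, ?_⟩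
      rintro g ⟨_, ⟨z, hz, rfl⟩, hz'⟩
      exact Subtype.ext (h g ⟨_, ⟨z.1, hz, rfl⟩, hz'⟩)
  refine ⟨hq.isCoveringMap, fun x => ?_⟩
  obtain ⟨y, hy⟩ := hq.surjective x
  have e1 := Nat.card_congr (hq.fiberEquivGroup (x := x) ⟨y, hy⟩)
  exact (dvd_of_eq e1).trans (Subgroup.card_subgroup_dvd_card H)

end Coverings

/-! ### The smooth structure on a covering -/

section PullbackManifold

variable {E : Type*} [NormedAddCommGroup E] [NormedSpace ℝ E]
variable {M : Type*} [TopologicalSpace M] [ChartedSpace E M]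
variable {N : Type*} [TopologicalSpace N]

variable (E) in
/-- The charted space structure on the source of a local homeomorphism, the charts of which are
local inverses followed by charts. -/
abbrev pullbackChartedSpace {p : N → M} (hp : IsLocalHomeomorph p) : ChartedSpace E N where
  atlas := {e | ∃ (Φ : OpenPartialHomeomorph N M) (c : OpenPartialHomeomorph M E),
    p = Φ ∧ c ∈ atlas E M ∧ e = Φ.trans c}
  chartAt y := (hp y).choose.trans (chartAt E (p y))
  mem_chart_source y := by
    obtain ⟨h1, h2⟩ := (hp y).choose_spec
    rw [OpenPartialHomeomorph.trans_source]
    refine ⟨h1, ?_⟩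
    rw [mem_preimage, ← h2]
    exact mem_chart_source E (p y)
  chart_mem_atlas y := ⟨_, _, (hp y).choose_spec.2, chart_mem_atlas E (p y), rfl⟩

/-- Any two of the local homeomorphisms used are restrictions of the same map `p`, so a change of
coordinates of `N` is a restriction of one of `M`. -/
theorem isManifold_pullbackChartedSpace [IsManifold 𝓘(ℝ, E) ∞ M] {p : N → M}
    (hp : IsLocalHomeomorph p) :
    @IsManifold ℝ _ E _ _ E _ 𝓘(ℝ, E) ∞ N _ (pullbackChartedSpace E hp) := by
  let := pullbackChartedSpace E hp
  refine isManifold_of_contDiffOn 𝓘(ℝ, E) ∞ N ?_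
  rintro _ _ ⟨Φ, c, hΦ, hc, rfl⟩ ⟨Φ', c', hΦ', hc', rfl⟩
  have h := (contDiffGroupoid ∞ 𝓘(ℝ, E)).compatible hc hc'
  rw [contDiffGroupoid, mem_groupoid_of_pregroupoid] at h
  have h1 : ContDiffOn ℝ ∞ (c.symm.trans c') (c.symm.trans c').source := by
    simpa [contDiffPregroupoid] using h.1
  have hcoe : ⇑Φ' = ⇑Φ := hΦ'.symm.trans hΦ
  simp only [modelWithCornersSelf_coe, modelWithCornersSelf_coe_symm, Function.id_comp,
    Function.comp_id, preimage_id, range_id, inter_univ]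
  refine (h1.mono fun z hz => ?_).congr fun z hz => ?_
  all_goals
    simp only [OpenPartialHomeomorph.trans_source, OpenPartialHomeomorph.symm_source,
      OpenPartialHomeomorph.trans_target, OpenPartialHomeomorph.coe_trans_symm, mem_inter_iff,
      mem_preimage, Function.comp_apply, hcoe] at hz ⊢
  · rw [Φ.right_inv hz.1.2] at hz
    exact ⟨hz.1.1, hz.2.2⟩
  · simp only [OpenPartialHomeomorph.coe_trans, OpenPartialHomeomorph.coe_trans_symm,
      Function.comp_apply, hcoe, Φ.right_inv hz.1.2]

theorem isLocalDiffeomorph_pullbackChartedSpace [IsManifold 𝓘(ℝ, E) ∞ M] {p : N → M}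
    (hp : IsLocalHomeomorph p) :
    @IsLocalDiffeomorph ℝ _ E _ _ E _ _ E _ E _ 𝓘(ℝ, E) 𝓘(ℝ, E) N _ (pullbackChartedSpace E hp) M _ _
      ∞ p := by
  let := pullbackChartedSpace E hp
  have hM := isManifold_pullbackChartedSpace (E := E) hp
  intro y
  obtain ⟨Φ, hy, hΦ⟩ := hp y
  have hmem : ∀ x : M, (Φ.trans (chartAt E x)) ∈ IsManifold.maximalAtlas 𝓘(ℝ, E) ∞ N := fun x =>
    IsManifold.subset_maximalAtlas ⟨Φ, _, hΦ, chart_mem_atlas E x, rfl⟩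
  refine ⟨⟨Φ.toPartialEquiv, Φ.open_source, Φ.open_target, fun z hz => ?_, fun z hz => ?_⟩, hy,
    fun z _ => congrFun hΦ z⟩
  · have hz' : z ∈ (Φ.trans (chartAt E (Φ z))).source := by
      rw [OpenPartialHomeomorph.trans_source]
      exact ⟨hz, mem_chart_source E (Φ z)⟩
    have h1 := contMDiffAt_of_mem_maximalAtlas (hmem (Φ z)) hz'
    have h2 : ContMDiffAt 𝓘(ℝ, E) 𝓘(ℝ, E) ∞ (chartAt E (Φ z)).symm
        ((Φ.trans (chartAt E (Φ z))) z) :=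
      contMDiffAt_symm_of_mem_maximalAtlas (IsManifold.chart_mem_maximalAtlas (Φ z))
        ((chartAt E (Φ z)).map_source (mem_chart_source E (Φ z)))
    refine ((h2.comp z h1).congr_of_eventuallyEq ?_).contMDiffWithinAt
    filter_upwards [(Φ.trans (chartAt E (Φ z))).open_source.mem_nhds hz'] with w hw
    rw [OpenPartialHomeomorph.trans_source] at hw
    exact ((chartAt E (Φ z)).left_inv hw.2).symm
  · have h1 : ContMDiffAt 𝓘(ℝ, E) 𝓘(ℝ, E) ∞ (chartAt E z) z :=
      contMDiffAt_of_mem_maximalAtlas (IsManifold.chart_mem_maximalAtlas z) (mem_chart_source E z)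
    have h2 : ContMDiffAt 𝓘(ℝ, E) 𝓘(ℝ, E) ∞ (Φ.trans (chartAt E z)).symm (chartAt E z z) := by
      refine contMDiffAt_symm_of_mem_maximalAtlas (hmem z) ?_
      rw [OpenPartialHomeomorph.trans_target]
      refine ⟨(chartAt E z).map_source (mem_chart_source E z), ?_⟩
      rw [mem_preimage, (chartAt E z).left_inv (mem_chart_source E z)]
      exact hz
    refine ((h2.comp z h1).congr_of_eventuallyEq ?_).contMDiffWithinAt
    filter_upwards [(chartAt E z).open_source.mem_nhds (mem_chart_source E z)] with w hw
    exact congrArg Φ.symm ((chartAt E z).left_inv hw).symm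

theorem IsLocalHomeomorph.locallyConnectedSpace {E M N : Type*} [NormedAddCommGroup E]
    [NormedSpace ℝ E] [TopologicalSpace M] [ChartedSpace E M] [TopologicalSpace N] {p : N → M}
    (hp : IsLocalHomeomorph p) : LocallyConnectedSpace N :=
  let := pullbackChartedSpace E hp
  ChartedSpace.locallyConnectedSpace E N

end PullbackManifold

/-! ### Coverings that trivialize a cocycle -/

section Cocycles

variable {M : Type u} [TopologicalSpace M] {G : Type} [Group G]

/-- A locally constant cocycle on an open cover of a space, with values in a discrete group. -/
structure LocConstCocycle (M : Type u) [TopologicalSpace M] (G : Type) [Group G] where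
  /-- The open cover, with a preferred index at every point. -/
  dom : M → Set M
  isOpen_dom : ∀ i, IsOpen (dom i)
  mem_dom : ∀ x, x ∈ dom x
  /-- The transition elements. -/
  trans : M → M → M → G
  eventually_trans : ∀ i j x, x ∈ dom i → x ∈ dom j → ∀ᶠ y in 𝓝 x, trans i j y = trans i j x
  trans_mul : ∀ i j k x, x ∈ dom i → x ∈ dom j → x ∈ dom k →
    trans j k x * trans i j x = trans i k x

namespace LocConstCocycle

theorem trans_self (Z : LocConstCocycle M G) (i x : M) (hx : x ∈ Z.dom i) : Z.trans i i x = 1 := by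
  have := Z.trans_mul i i i x hx hx hx
  rwa [mul_eq_left] at this

variable [TopologicalSpace G] [DiscreteTopology G] (Z : LocConstCocycle M G)

/-- The principal bundle of a cocycle. -/
def bundleCore : FiberBundleCore M M G where
  baseSet := Z.dom
  isOpen_baseSet := Z.isOpen_dom
  indexAt x := x
  mem_baseSet_at := Z.mem_dom
  coordChange i j x v := Z.trans i j x * v
  coordChange_self i x hx v := by rw [Z.trans_self i x hx, one_mul]
  continuousOn_coordChange i j := by
    rintro ⟨x, v⟩ ⟨⟨hi, hj⟩, -⟩
    refine ContinuousAt.continuousWithinAt ?_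
    have h : ContinuousAt (fun p : M × G => Z.trans i j p.1) (x, v) := by
      refine ContinuousAt.comp (f := Prod.fst) (g := Z.trans i j) ?_ continuousAt_fst
      exact continuousAt_const.congr ((Z.eventually_trans i j x hi hj).mono fun y hy => hy.symm)
    exact (continuous_of_discreteTopology (f := fun q : G × G => q.1 * q.2)).continuousAt.comp
      (f := fun p : M × G => (Z.trans i j p.1, p.2)) (h.prodMk continuousAt_snd)
  coordChange_comp i j k x hx v := by
    rw [← mul_assoc, Z.trans_mul i j k x hx.1.1 hx.1.2 hx.2]

/-- The covering space of a cocycle. -/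
abbrev Cover : Type u := Z.bundleCore.TotalSpace

/-- The point of the covering space with given projection and coordinate. -/
def point (x : M) (g : G) : Z.Cover := ⟨x, g⟩

/-- The preferred coordinate of a point of the covering space. -/
def preCoord (y : Z.Cover) : G := y.2

/-- The coordinate of a point of the covering space over the open set of index `i`. -/
def coord (i : M) (y : Z.Cover) : G := Z.trans y.1 i y.1 * Z.preCoord y

theorem coord_trans (i j : M) (y : Z.Cover) (hi : y.1 ∈ Z.dom i) (hj : y.1 ∈ Z.dom j) :
    Z.coord j y = Z.trans i j y.1 * Z.coord i y := by
  rw [coord, coord, ← mul_assoc, Z.trans_mul y.1 i j y.1 (Z.mem_dom _) hi hj]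

theorem eventually_coord (i : M) (y : Z.Cover) (hi : y.1 ∈ Z.dom i) :
    ∀ᶠ z in 𝓝 y, Z.coord i z = Z.coord i y := by
  have hc : ContinuousAt (Z.coord i) y :=
    continuousAt_snd.comp ((Z.bundleCore.localTriv i).continuousAt
      ((Z.bundleCore.mem_localTriv_source i y).2 hi))
  exact hc.eventually (show ∀ᶠ g in 𝓝 (Z.coord i y), g = Z.coord i y by simp [nhds_discrete])

instance : MulAction G Z.Cover where
  -- Acting on the right, through the inverse, commutes with the transitions, which multiply on the
  -- left.
  smul g y := Z.point y.1 (Z.preCoord y * g⁻¹)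
  one_smul y := by
    change Z.point y.1 (Z.preCoord y * 1⁻¹) = Z.point y.1 (Z.preCoord y)
    rw [inv_one, mul_one]
  mul_smul g h y := by
    change Z.point y.1 (Z.preCoord y * (g * h)⁻¹) = Z.point y.1 (Z.preCoord y * h⁻¹ * g⁻¹)
    rw [mul_inv_rev, mul_assoc]

theorem coord_smul (g : G) (i : M) (y : Z.Cover) : Z.coord i (g • y) = Z.coord i y * g⁻¹ :=
  (mul_assoc (Z.trans y.1 i y.1) (Z.preCoord y) g⁻¹).symm

theorem isCoveringMap_proj : IsCoveringMap Z.bundleCore.proj :=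
  IsFiberBundle.isCoveringMap fun x => ⟨Z.bundleCore.localTriv x, Z.mem_dom x⟩

theorem isQuotientCoveringMap_proj : IsQuotientCoveringMap Z.bundleCore.proj G where
  toIsQuotientMap := Z.isCoveringMap_proj.isQuotientMap fun x => ⟨Z.point x 1, rfl⟩
  continuous_const_smul g := by
    rw [continuous_iff_continuousAt]
    intro y
    refine (FiberBundle.continuousAt_totalSpace G _).2
      ⟨Z.isCoveringMap_proj.continuous.continuousAt, ?_⟩
    have h : ContinuousAt (fun z => Z.coord y.1 (g • z)) y := by
      refine (continuousAt_const (y := Z.coord y.1 y * g⁻¹)).congr ?_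
      filter_upwards [Z.eventually_coord y.1 y (Z.mem_dom _)] with z hz
      rw [coord_smul, hz]
    exact h
  apply_eq_iff_mem_orbit {y z} := by
    constructor
    · intro h
      have hy : y = Z.point y.1 (Z.preCoord y) := rfl
      have hz : z = Z.point y.1 (Z.preCoord z) := by
        change y.1 = z.1 at h
        rw [h]; rfl
      rw [hy, hz]
      refine ⟨(Z.preCoord y)⁻¹ * Z.preCoord z, ?_⟩
      change Z.point y.1 (Z.preCoord z * ((Z.preCoord y)⁻¹ * Z.preCoord z)⁻¹) = _
      rw [mul_inv_rev, inv_inv, mul_inv_cancel_left]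
    · rintro ⟨g, rfl⟩
      rfl
  disjoint y := by
    refine ⟨_, Z.eventually_coord y.1 y (Z.mem_dom _), ?_⟩
    rintro g ⟨_, ⟨z, hz, rfl⟩, hz'⟩
    have h : Z.coord y.1 (g • z) = Z.coord y.1 z := hz'.trans hz.symm
    rwa [coord_smul, mul_eq_left, inv_eq_one] at h

theorem secondCountableTopology_cover [Finite G] [SecondCountableTopology M] :
    SecondCountableTopology Z.Cover := by
  obtain ⟨s, hs, hsU⟩ := TopologicalSpace.countable_cover_nhds
    fun x => (Z.isOpen_dom x).mem_nhds (Z.mem_dom x)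
  have := hs.to_subtype
  have hsc : ∀ i : s, SecondCountableTopology (Z.bundleCore.localTriv i.1).source := fun i =>
    (Z.bundleCore.localTriv i.1).toOpenPartialHomeomorph.toHomeomorphSourceTarget.isEmbedding.secondCountableTopology
  refine TopologicalSpace.secondCountableTopology_of_countable_cover
    (U := fun i : s => (Z.bundleCore.localTriv i.1).source)
    (fun i => (Z.bundleCore.localTriv i.1).open_source) (eq_univ_of_forall fun y => ?_)
  have := hsU ▸ mem_univ y.1
  simp only [mem_iUnion] at this ⊢
  obtain ⟨i, hi, h⟩ := this
  exact ⟨⟨i, hi⟩, (Z.bundleCore.mem_localTriv_source i y).2 h⟩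

/-- A cocycle with values in a finite group becomes trivial on a finite covering space, which can
be chosen connected if the base is. -/
theorem exists_covering [Finite G] [T2Space M] [SecondCountableTopology M]
    [LocallyConnectedSpace Z.Cover] :
    ∃ (N : Type u) (_ : TopologicalSpace N) (p : N → M) (t : M → N → G), T2Space N ∧
      SecondCountableTopology N ∧ (ConnectedSpace M → ConnectedSpace N) ∧ IsCoveringMap p ∧
      (∀ x, Nat.card (p ⁻¹' {x}) ∣ Nat.card G) ∧
      (∀ i y, p y ∈ Z.dom i → ∀ᶠ z in 𝓝 y, t i z = t i y) ∧
      ∀ i j y, p y ∈ Z.dom i → p y ∈ Z.dom j → t j y = Z.trans i j (p y) * t i y := by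
  have hq := Z.isQuotientCoveringMap_proj
  have := IsCoveringMap.t2Space Z.isCoveringMap_proj
  have := Z.secondCountableTopology_cover
  -- Over a connected base a component is taken; otherwise the whole principal covering serves. In
  -- both cases the fibre coordinates are the trivialization.
  by_cases hM : ConnectedSpace M
  · obtain ⟨x₀⟩ := hM.toNonempty
    let y₀ : Z.Cover := Z.point x₀ 1
    obtain ⟨h1, h3⟩ := IsQuotientCoveringMap.restrict_connectedComponent hq y₀
    refine ⟨connectedComponent y₀, inferInstance, fun y => Z.bundleCore.proj y,
      fun i y => Z.coord i y, inferInstance, inferInstance, fun _ =>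
      isConnected_iff_connectedSpace.1 isConnected_connectedComponent, h1, h3, fun i y hy => ?_,
      fun i j y hi hj => Z.coord_trans i j y hi hj⟩
    exact continuous_subtype_val.continuousAt.eventually (Z.eventually_coord i y hy)
  · refine ⟨Z.Cover, inferInstance, Z.bundleCore.proj, Z.coord, inferInstance, inferInstance,
      fun h => absurd h hM, Z.isCoveringMap_proj, fun x => ?_, Z.eventually_coord, Z.coord_trans⟩
    exact dvd_of_eq (Nat.card_congr (hq.fiberEquivGroup (x := x) ⟨Z.point x 1, rfl⟩))

end LocConstCocycle
end Cocycles

/-- The group of the symmetries of a pair of oriented lines which reverse both lines or none: the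
first component tells whether the lines are reversed, the second whether they are exchanged. -/
abbrev FrameSymmetry : Type := ℤˣ × ℤˣ

/-! ### Symmetries of pairs of null directions -/

section Twist

variable {E : Type*} [NormedAddCommGroup E] [NormedSpace ℝ E]
variable {M : Type*} [TopologicalSpace M] [ChartedSpace E M]
variable {V : Type*} [NormedAddCommGroup V] [NormedSpace ℝ V]

namespace FrameSymmetry

/-- The sign of a symmetry. -/
def sign (g : FrameSymmetry) : ℝ := ((g.1 : ℤ) : ℝ)

theorem sign_eq (g : FrameSymmetry) : g.sign = 1 ∨ g.sign = -1 := by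
  rcases Int.units_eq_one_or g.1 with h | h <;> simp [sign, h]

theorem sign_ne_zero (g : FrameSymmetry) : g.sign ≠ 0 := by
  rcases g.sign_eq with h | h <;> simp [h]

theorem sign_inv (g : FrameSymmetry) : g.sign⁻¹ = g.sign := by
  rcases g.sign_eq with h | h <;> rw [h] <;> norm_num

theorem sign_mul (g h : FrameSymmetry) : (g * h).sign = g.sign * h.sign := by
  simp [sign]

/-- The action on a pair of vectors, or on the functions with values in pairs, of which this is
the first component. -/
def fst {W : Type*} [AddCommGroup W] [Module ℝ W] (g : FrameSymmetry) (u w : W) : W :=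
  g.sign • if g.2 = 1 then u else w

/-- The second component of the action on a pair. -/
def snd {W : Type*} [AddCommGroup W] [Module ℝ W] (g : FrameSymmetry) (u w : W) : W :=
  g.sign • if g.2 = 1 then w else u

variable {W : Type*} [AddCommGroup W] [Module ℝ W] (g h : FrameSymmetry) (u w : W)

theorem fst_one : (1 : FrameSymmetry).fst u w = u := by simp [fst, sign]

theorem snd_one : (1 : FrameSymmetry).snd u w = w := by simp [snd, sign]

theorem fst_mul : (g * h).fst u w = g.fst (h.fst u w) (h.snd u w) := by
  rcases Int.units_eq_one_or g.2 with hg | hg <;> rcases Int.units_eq_one_or h.2 with hh | hh <;>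
    simp [fst, snd, sign_mul, hg, hh, mul_smul]

theorem snd_mul : (g * h).snd u w = g.snd (h.fst u w) (h.snd u w) := by
  rcases Int.units_eq_one_or g.2 with hg | hg <;> rcases Int.units_eq_one_or h.2 with hh | hh <;>
    simp [fst, snd, sign_mul, hg, hh, mul_smul]

theorem map_fst {W' : Type*} [AddCommGroup W'] [Module ℝ W'] (A : W →ₗ[ℝ] W') :
    A (g.fst u w) = g.fst (A u) (A w) := by
  unfold fst; split_ifs <;> simp

theorem map_snd {W' : Type*} [AddCommGroup W'] [Module ℝ W'] (A : W →ₗ[ℝ] W') :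
    A (g.snd u w) = g.snd (A u) (A w) := by
  unfold snd; split_ifs <;> simp

end FrameSymmetry

/-- A sign common to both vectors keeps their product, and being its own inverse it is an instance
of the scaling of null frames. -/
theorem LorentzModel.IsNullFrame.twist {L : LorentzModel V} {f n₁ n₂ : V}
    (hn : L.IsNullFrame f n₁ n₂) (g : FrameSymmetry) :
    L.IsNullFrame f (g.fst n₁ n₂) (g.snd n₁ n₂) := by
  unfold FrameSymmetry.fst FrameSymmetry.snd
  split_ifs
  · simpa [g.sign_inv] using hn.scale g.sign_ne_zero
  · simpa [g.sign_inv] using hn.swap.scale g.sign_ne_zero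

namespace LocalFrame

variable {L : LorentzModel V} {F : Foliation E M 2} (c : LocalFrame L F)

/-- The action of the symmetries on local frames. -/
def twist (g : FrameSymmetry) : LocalFrame L F where
  dom := c.dom
  map := c.map
  left y := g.fst (c.left y) (c.right y)
  right y := g.snd (c.left y) (c.right y)
  isOpen_dom := c.isOpen_dom
  contMDiffOn_map := c.contMDiffOn_map
  contMDiffOn_left := by
    unfold FrameSymmetry.fst
    split_ifs
    · exact (contMDiffOn_const (I' := 𝓘(ℝ, ℝ)) (c := g.sign)).smul c.contMDiffOn_left
    · exact (contMDiffOn_const (I' := 𝓘(ℝ, ℝ)) (c := g.sign)).smul c.contMDiffOn_right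
  contMDiffOn_right := by
    unfold FrameSymmetry.snd
    split_ifs
    · exact (contMDiffOn_const (I' := 𝓘(ℝ, ℝ)) (c := g.sign)).smul c.contMDiffOn_right
    · exact (contMDiffOn_const (I' := 𝓘(ℝ, ℝ)) (c := g.sign)).smul c.contMDiffOn_left
  null y hy := (c.null y hy).twist g
  mem_tangent := c.mem_tangent

theorem form₁_twist (g : FrameSymmetry) (y : M) (v : TangentSpace 𝓘(ℝ, E) y) :
    (c.twist g).form₁ y v = g.fst (c.form₁ y v) (c.form₂ y v) := by
  change L.form (tderiv c.map y v) (g.snd (c.left y) (c.right y)) = _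
  rw [← ContinuousLinearMap.coe_coe, FrameSymmetry.map_snd]
  rfl

theorem form₂_twist (g : FrameSymmetry) (y : M) (v : TangentSpace 𝓘(ℝ, E) y) :
    (c.twist g).form₂ y v = g.snd (c.form₁ y v) (c.form₂ y v) := by
  change L.form (tderiv c.map y v) (g.fst (c.left y) (c.right y)) = _
  rw [← ContinuousLinearMap.coe_coe, FrameSymmetry.map_fst]
  rfl

/-- Two local frames define the same oriented null directions at a point. -/
def SameDirections (c c' : LocalFrame L F) (y : M) : Prop :=
  ∃ t : ℝ, 0 < t ∧ (∀ v, c'.form₁ y v = t * c.form₁ y v) ∧ ∀ v, c'.form₂ y v = t⁻¹ * c.form₂ y v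

variable {c} {c' c'' : LocalFrame L F} {x : M}

theorem SameDirections.symm (h : c.SameDirections c' x) : c'.SameDirections c x := by
  obtain ⟨t, ht, h1, h2⟩ := h
  refine ⟨t⁻¹, inv_pos.2 ht, fun v => ?_, fun v => ?_⟩
  · rw [h1, inv_mul_cancel_left₀ ht.ne']
  · rw [h2, inv_inv, mul_inv_cancel_left₀ ht.ne']

theorem SameDirections.trans (h : c.SameDirections c' x) (h' : c'.SameDirections c'' x) :
    c.SameDirections c'' x := by
  obtain ⟨t, ht, h1, h2⟩ := h
  obtain ⟨s, hs, h3, h4⟩ := h'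
  refine ⟨s * t, mul_pos hs ht, fun v => ?_, fun v => ?_⟩
  · rw [h3, h1, mul_assoc]
  · rw [h4, h2, mul_inv, mul_assoc]

theorem SameDirections.twist (h : c.SameDirections c' x) (g : FrameSymmetry) :
    (c.twist g).SameDirections (c'.twist g) x := by
  obtain ⟨t, ht, h1, h2⟩ := h
  rcases Int.units_eq_one_or g.2 with hg | hg
  · refine ⟨t, ht, fun v => ?_, fun v => ?_⟩ <;>
      simp only [form₁_twist, form₂_twist, h1, h2, FrameSymmetry.fst, FrameSymmetry.snd, hg, if_true,
        smul_eq_mul] <;> ring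
  -- An exchange interchanges the roles of the factors `t` and `t⁻¹`.
  · refine ⟨t⁻¹, inv_pos.2 ht, fun v => ?_, fun v => ?_⟩ <;>
      simp only [form₁_twist, form₂_twist, h1, h2, FrameSymmetry.fst, FrameSymmetry.snd, hg,
        smul_eq_mul, inv_inv] <;> simp <;> ring

theorem sameDirections_twist_mul (g h : FrameSymmetry) :
    ((c.twist h).twist g).SameDirections (c.twist (g * h)) x :=
  ⟨1, one_pos, fun v => by simp only [form₁_twist, form₂_twist, FrameSymmetry.fst_mul, one_mul],
    fun v => by simp only [form₁_twist, form₂_twist, FrameSymmetry.snd_mul, inv_one, one_mul]⟩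

/-- On a vector with ω₁ = 1 and ω₂ = 0 the first form of the twisted frame is the sign of `g`, or
`0` if `g` is an exchange. Only the identity makes it positive. -/
theorem eq_one_of_form₁_pos {g : FrameSymmetry} (h : (c.twist g).SameDirections c' x)
    {v : TangentSpace 𝓘(ℝ, E) x} (hv₁ : c.form₁ x v = 1) (hv₂ : c.form₂ x v = 0)
    (hv : 0 < c'.form₁ x v) : g = 1 := by
  obtain ⟨t, ht, h1, -⟩ := h
  rw [h1, form₁_twist, hv₁, hv₂] at hv
  replace hv := pos_of_mul_pos_right hv ht.le
  unfold FrameSymmetry.fst at hv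
  split_ifs at hv with h2
  · rcases Int.units_eq_one_or g.1 with h3 | h3
    · exact Prod.ext h3 h2
    · rw [FrameSymmetry.sign, h3] at hv
      norm_num at hv
  · simp at hv

theorem SameDirections.eq_one [FiniteDimensional ℝ E] {g : FrameSymmetry} (hx : x ∈ c.dom)
    (h : (c.twist g).SameDirections c x) : g = 1 := by
  obtain ⟨v, hv₁, hv₂⟩ := c.exists_forms_eq hx 1 0
  exact eq_one_of_form₁_pos h hv₁ hv₂ (by rw [hv₁]; exact one_pos)

theorem SameDirections.unique [FiniteDimensional ℝ E] {g h : FrameSymmetry} (hx : x ∈ c.dom)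
    (hg : (c.twist g).SameDirections c' x) (hh : (c.twist h).SameDirections c' x) : g = h := by
  have h1 := (hg.trans hh.symm).symm.twist h⁻¹
  have h2 : (c.twist (h⁻¹ * g)).SameDirections (c.twist (h⁻¹ * h)) x :=
    (sameDirections_twist_mul _ _).symm.trans (h1.symm.trans (sameDirections_twist_mul _ _))
  have h3 : (c.twist (h⁻¹ * h)).SameDirections c x :=
    ⟨1, one_pos, fun v => by rw [inv_mul_cancel, form₁_twist, FrameSymmetry.fst_one, one_mul],
      fun v => by rw [inv_mul_cancel, form₂_twist, FrameSymmetry.snd_one, inv_one, one_mul]⟩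
  exact (inv_mul_eq_one.1 ((h2.trans h3).eq_one hx)).symm

/-- The induced metric ⟨df, df⟩ is 2ω₁ω₂, and `A` preserves it. A linear change of (ω₁, ω₂) that
preserves the product is diagonal or antidiagonal with mutually inverse entries: the shape gives the
exchange, the sign of the entries gives the reversal and their size the scaling. -/
theorem exists_twist_sameDirections [FiniteDimensional ℝ E] {A : V →L[ℝ] V} {b : V}
    (hA : ∀ u v, L.form (A u) (A v) = L.form u v)
    (hx : x ∈ c.dom) (hx' : x ∈ c'.dom) (h : ∀ᶠ y in 𝓝 x, c'.map y = A (c.map y) + b) :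
    ∃ g : FrameSymmetry, (c.twist g).SameDirections c' x := by
  have hd : ∀ v : TangentSpace 𝓘(ℝ, E) x, tderiv c'.map x v = A (tderiv c.map x v) :=
    fun v => tderiv_affine A b (c.mdifferentiableAt_map hx) h v
  have hq : ∀ v, c'.form₁ x v * c'.form₂ x v = c.form₁ x v * c.form₂ x v := by
    have key : ∀ (c : LocalFrame L F), x ∈ c.dom → ∀ v : TangentSpace 𝓘(ℝ, E) x,
        L.form (tderiv c.map x v) (tderiv c.map x v) = 2 * (c.form₁ x v * c.form₂ x v) := by
      intro c hx v
      have hn := c.null x hx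
      rw [c.tderiv_map hx]
      simp only [map_add, map_smul, add_apply, smul_apply, smul_eq_mul, hn.null₁, hn.null₂,
        hn.pair, hn.pair']
      ring
    intro v
    have h1 := key c' hx' v
    rw [hd, hA, key c hx] at h1
    linarith
  obtain ⟨v₁, h11, h12⟩ := c.exists_forms_eq hx 1 0
  obtain ⟨v₂, h21, h22⟩ := c.exists_forms_eq hx 0 1
  have hexp : ∀ v, c'.form₁ x v = c.form₁ x v * c'.form₁ x v₁ + c.form₂ x v * c'.form₁ x v₂ ∧
      c'.form₂ x v = c.form₁ x v * c'.form₂ x v₁ + c.form₂ x v * c'.form₂ x v₂ := by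
    intro v
    have h0 : tderiv c'.map x (v - (c.form₁ x v • v₁ + c.form₂ x v • v₂)) = 0 := by
      rw [hd, (c.tderiv_map_eq_zero_iff hx _).2, map_zero]
      constructor <;>
        simp only [map_sub, map_add, map_smul, h11, h12, h21, h22, smul_eq_mul] <;> ring
    obtain ⟨e1, e2⟩ := (c'.tderiv_map_eq_zero_iff hx' _).1 h0
    simp only [map_sub, map_add, map_smul, smul_eq_mul] at e1 e2
    constructor <;> linarith
  -- For the matrix with rows (a, b) and (p, q) these say ap = 0, bq = 0 and (a + b)(p + q) = 1,
  -- whence aq + bp = 1.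
  have q1 := hq v₁
  have q2 := hq v₂
  have q3 := hq (v₁ + v₂)
  simp only [map_add, h11, h12, h21, h22] at q1 q2 q3
  set a := c'.form₁ x v₁
  set b := c'.form₁ x v₂
  set p := c'.form₂ x v₁
  set q := c'.form₂ x v₂
  have hε : ∀ s : ℝ, s ≠ 0 → ∃ ε : ℤˣ, 0 < s * ((ε : ℤ) : ℝ) ∧ ((ε : ℤ) : ℝ) * ((ε : ℤ) : ℝ) = 1 := by
    intro s hs
    rcases hs.lt_or_gt with hs | hs
    · exact ⟨-1, by simpa using hs, by simp⟩
    · exact ⟨1, by simpa using hs, by simp⟩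
  by_cases ha : a = 0
  · have hbp : b * p = 1 := by rw [ha] at q3; linear_combination q3 - q2
    have hb : b ≠ 0 := left_ne_zero_of_mul_eq_one hbp
    have hq0 : q = 0 := by
      rcases mul_eq_zero.1 (q2.trans (by ring)) with h | h
      · exact absurd h hb
      · exact h
    have hp : p = b⁻¹ := eq_inv_of_mul_eq_one_right hbp
    obtain ⟨ε, he, he'⟩ := hε b hb
    refine ⟨(ε, -1), b * ((ε : ℤ) : ℝ), he, fun v => ?_, fun v => ?_⟩
    · rw [form₁_twist, (hexp v).1, ha]
      simp [FrameSymmetry.fst, FrameSymmetry.sign]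
      linear_combination -b * c.form₂ x v * he'
    · rw [form₂_twist, (hexp v).2, hq0, hp]
      simp [FrameSymmetry.snd, FrameSymmetry.sign]
      field_simp
  · have hp : p = 0 := by
      rcases mul_eq_zero.1 (q1.trans (by ring)) with h | h
      · exact absurd h ha
      · exact h
    have haq : a * q = 1 := by rw [hp] at q3; linear_combination q3 - q2
    have hb : b = 0 := by
      rcases mul_eq_zero.1 (q2.trans (by ring)) with h | h
      · exact h
      · exact absurd h (right_ne_zero_of_mul_eq_one haq)
    have hq' : q = a⁻¹ := eq_inv_of_mul_eq_one_right haq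
    obtain ⟨ε, he, he'⟩ := hε a ha
    refine ⟨(ε, 1), a * ((ε : ℤ) : ℝ), he, fun v => ?_, fun v => ?_⟩
    · rw [form₁_twist, (hexp v).1, hb]
      simp [FrameSymmetry.fst, FrameSymmetry.sign]
      linear_combination -a * c.form₁ x v * he'
    · rw [form₂_twist, (hexp v).2, hp, hq']
      simp [FrameSymmetry.snd, FrameSymmetry.sign]
      field_simp

/-- Local constancy of the symmetry. The first form of `c'` on a vector with coordinates (1, 0) for
`c` is ⟨An₁, n₂'⟩, a continuous function that is positive at `x`, hence nearby, and positivity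
leaves only the identity. -/
theorem SameDirections.eventually_eq_one [FiniteDimensional ℝ E] {A : V →L[ℝ] V} {b : V}
    (hx : x ∈ c.dom) (hx' : x ∈ c'.dom) (h : ∀ᶠ y in 𝓝 x, c'.map y = A (c.map y) + b)
    (hs : c.SameDirections c' x) :
    ∀ᶠ y in 𝓝 x, ∀ g : FrameSymmetry, (c.twist g).SameDirections c' y → g = 1 := by
  have key : ∀ᶠ y in 𝓝 x, ∃ v : TangentSpace 𝓘(ℝ, E) y, c.form₁ y v = 1 ∧ c.form₂ y v = 0 ∧
      c'.form₁ y v = L.form (A (c.left y)) (c'.right y) := by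
    filter_upwards [eventually_eventually_nhds.2 h, c.isOpen_dom.mem_nhds hx] with y hy hyc
    obtain ⟨v, h1, h2⟩ := c.exists_forms_eq hyc 1 0
    refine ⟨v, h1, h2, ?_⟩
    rw [form₁_apply, tderiv_affine A b (c.mdifferentiableAt_map hyc) hy, c.tderiv_map hyc, h1, h2]
    simp
  have hcont : ContinuousAt (fun y => L.form (A (c.left y)) (c'.right y)) x :=
    ((L.form.continuous.comp A.continuous).continuousAt.comp
      (c.contMDiffAt_left hx).continuousAt).clm_apply (c'.contMDiffAt_right hx').continuousAt
  have hpos : 0 < L.form (A (c.left x)) (c'.right x) := by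
    obtain ⟨v, h1, -, h3⟩ := key.self_of_nhds
    obtain ⟨t, ht, ht1, -⟩ := hs
    rw [← h3, ht1, h1, mul_one]
    exact ht
  filter_upwards [key, hcont.eventually (lt_mem_nhds hpos)] with y hy hy' g hg
  obtain ⟨v, h1, h2, h3⟩ := hy
  exact eq_one_of_form₁_pos hg h1 h2 (by rw [h3]; exact hy')

end LocalFrame
end Twist

/-! ### From the transverse structure to forms on a covering -/

section Cover

variable {E : Type*} [NormedAddCommGroup E] [NormedSpace ℝ E]
variable {V : Type*} [NormedAddCommGroup V] [NormedSpace ℝ V]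

namespace LocalFrame

section Pullback

variable {M : Type*} [TopologicalSpace M] [ChartedSpace E M]
variable {N : Type*} [TopologicalSpace N] [ChartedSpace E N]
variable {L : LorentzModel V} {F : Foliation E M 2} (c : LocalFrame L F)

/-- The pull-back of a local frame by a local diffeomorphism, restricted to an open set. -/
def pullback (p : N → M) (hp : IsLocalDiffeomorph 𝓘(ℝ, E) 𝓘(ℝ, E) ∞ p) (U : Set N) (hU : IsOpen U)
    (hUc : ∀ y ∈ U, p y ∈ c.dom) : LocalFrame L (F.pullback p hp) where
  dom := U
  map := c.map ∘ p
  left := c.left ∘ p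
  right := c.right ∘ p
  isOpen_dom := hU
  contMDiffOn_map := c.contMDiffOn_map.comp hp.contMDiff.contMDiffOn hUc
  contMDiffOn_left := c.contMDiffOn_left.comp hp.contMDiff.contMDiffOn hUc
  contMDiffOn_right := c.contMDiffOn_right.comp hp.contMDiff.contMDiffOn hUc
  null y hy := c.null _ (hUc y hy)
  mem_tangent y hy v := by
    refine (c.mem_tangent (p y) (hUc y hy) _).trans ?_
    have h := mfderiv_comp y (c.mdifferentiableAt_map (hUc y hy))
      (hp.mdifferentiable (by simp) y)
    rw [tderiv, tderiv, h]
    rfl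

theorem form₁_pullback (p : N → M) (hp : IsLocalDiffeomorph 𝓘(ℝ, E) 𝓘(ℝ, E) ∞ p) (U : Set N)
    (hU : IsOpen U) (hUc : ∀ y ∈ U, p y ∈ c.dom) {y : N} (hy : y ∈ U) (v : TangentSpace 𝓘(ℝ, E) y) :
    (c.pullback p hp U hU hUc).form₁ y v = c.form₁ (p y) (mfderiv 𝓘(ℝ, E) 𝓘(ℝ, E) p y v) := by
  have h := mfderiv_comp y (c.mdifferentiableAt_map (hUc y hy)) (hp.mdifferentiable (by simp) y)
  rw [form₁_apply, form₁_apply, tderiv, tderiv]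
  change L.form (mfderiv 𝓘(ℝ, E) 𝓘(ℝ, V) (c.map ∘ p) y v) _ = _
  rw [h]
  rfl

end Pullback

variable {M : Type u} [TopologicalSpace M] [ChartedSpace E M]
variable {L : LorentzModel V} {F : Foliation E M 2} [FiniteDimensional ℝ E]

open Classical in
/-- The symmetry relating the null directions of two local frames at a point. -/
def transition (c c' : LocalFrame L F) (y : M) : FrameSymmetry :=
  -- The default is irrelevant where an isometry relates the two frames.
  if h : ∃ g : FrameSymmetry, (c.twist g).SameDirections c' y then h.choose else 1

theorem transition_eq {c c' : LocalFrame L F} {y : M} (hy : y ∈ c.dom) {g : FrameSymmetry}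
    (hg : (c.twist g).SameDirections c' y) : transition c c' y = g := by
  have h : ∃ g : FrameSymmetry, (c.twist g).SameDirections c' y := ⟨g, hg⟩
  rw [transition, dif_pos h]
  exact SameDirections.unique hy h.choose_spec hg

theorem sameDirections_transition {c c' : LocalFrame L F} {y : M} (hy : y ∈ c.dom)
    (hy' : y ∈ c'.dom) (hiso : ∃ g ∈ L.isometries, ∀ᶠ z in 𝓝 y, c'.map z = g (c.map z)) :
    (c.twist (transition c c' y)).SameDirections c' y := by
  obtain ⟨_, ⟨A, b, hA, -, hg⟩, h⟩ := hiso
  simp only [hg] at h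
  obtain ⟨g, hg⟩ := exists_twist_sameDirections hA hy hy' h
  rwa [transition_eq hy hg]

/-- The cocycle of the symmetries relating the null directions of local frames. -/
def cocycle (c : M → LocalFrame L F) (hc : ∀ x, x ∈ (c x).dom)
    (hiso : ∀ x z y, y ∈ (c x).dom → y ∈ (c z).dom →
      ∃ g ∈ L.isometries, ∀ᶠ y' in 𝓝 y, (c z).map y' = g ((c x).map y')) :
    LocConstCocycle M FrameSymmetry where
  dom x := (c x).dom
  isOpen_dom x := (c x).isOpen_dom
  mem_dom := hc
  trans i j y := transition (c i) (c j) y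
  eventually_trans i j x hi hj := by
    have h := sameDirections_transition hi hj (hiso i j x hi hj)
    set g := transition (c i) (c j) x
    obtain ⟨_, ⟨A, b, hA, -, hg⟩, hAb⟩ := hiso i j x hi hj
    simp only [hg] at hAb
    filter_upwards [SameDirections.eventually_eq_one (c := (c i).twist g) hi hj hAb h,
      (c i).isOpen_dom.mem_nhds hi, (c j).isOpen_dom.mem_nhds hj] with y hy hyi hyj
    have h1 := sameDirections_transition hyi hyj (hiso i j y hyi hyj)
    -- Relative to the frame already twisted by the value at `x`, the symmetry at `y` must be the
    -- identity.
    have h2 := hy (transition (c i) (c j) y * g⁻¹) ((sameDirections_twist_mul _ _).trans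
      (by rwa [inv_mul_cancel_right]))
    exact mul_inv_eq_one.1 h2
  trans_mul i j k x hi hj hk := by
    refine (transition_eq hi ?_).symm
    have h1 := sameDirections_transition hi hj (hiso i j x hi hj)
    have h2 := sameDirections_transition hj hk (hiso j k x hj hk)
    exact (sameDirections_twist_mul _ _).symm.trans ((h1.twist _).trans h2)

end LocalFrame

/-- A foliation with a transverse structure modelled on a Lorentzian model having a smooth field of
null frames satisfies `(*)` on a covering with one, two or four sheets. -/
theorem Foliation.HasTransverseStructure.holdsUpToFourCover [FiniteDimensional ℝ E]
    {M : Type u} [TopologicalSpace M] [T2Space M] [SecondCountableTopology M] [ChartedSpace E M]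
    [IsManifold 𝓘(ℝ, E) ∞ M] {L : LorentzModel V} {F : Foliation E M 2}
    (h : F.HasTransverseStructure L.space L.isometries) {n₁ n₂ : V → V} (hn₁ : ContDiff ℝ ∞ n₁)
    (hn₂ : ContDiff ℝ ∞ n₂) (hn : ∀ x ∈ L.space, L.IsNullFrame x (n₁ x) (n₂ x)) :
    F.HoldsUpToFourCover fun _ _ _ _ F' => F'.HasFormsOfCurvature L.κ := by
  obtain ⟨A, hcov, hA, hAA⟩ := h
  choose a haA hxa using hcov
  -- The null frame field of the model is pulled back by every map of the atlas. Isometries need not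
  -- preserve this field, and the cocycle measures the failure.
  let c : M → LocalFrame L F := fun x =>
    { dom := (a x).1
      map := (a x).2
      left := n₁ ∘ (a x).2
      right := n₂ ∘ (a x).2
      isOpen_dom := (hA _ (haA x)).1
      contMDiffOn_map := (hA _ (haA x)).2.1
      contMDiffOn_left := hn₁.contMDiff.comp_contMDiffOn (hA _ (haA x)).2.1
      contMDiffOn_right := hn₂.contMDiff.comp_contMDiffOn (hA _ (haA x)).2.1
      null := fun y hy => hn _ ((hA _ (haA x)).2.2 y hy).1
      mem_tangent := fun y hy => ((hA _ (haA x)).2.2 y hy).2 }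
  have hiso : ∀ x z y, y ∈ (c x).dom → y ∈ (c z).dom →
      ∃ g ∈ L.isometries, ∀ᶠ y' in 𝓝 y, (c z).map y' = g ((c x).map y') :=
    fun x z y hx hz => hAA _ (haA x) _ (haA z) y ⟨hx, hz⟩
  let Z := LocalFrame.cocycle c hxa hiso
  have := IsLocalHomeomorph.locallyConnectedSpace (E := E) Z.isCoveringMap_proj.isLocalHomeomorph
  obtain ⟨N, _, p, t, hT2, hsc, hconn, hp, hcard, ht, htrans⟩ := Z.exists_covering
  let := pullbackChartedSpace E hp.isLocalHomeomorph
  have hN := isManifold_pullbackChartedSpace (E := E) hp.isLocalHomeomorph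
  have hpd := isLocalDiffeomorph_pullbackChartedSpace (E := E) hp.isLocalHomeomorph
  refine ⟨N, inferInstance, inferInstance, hN, p, hpd, hT2, hsc, hconn, hp, fun x => ?_, ?_⟩
  · refine (hcard x).trans (dvd_of_eq ?_)
    rw [Nat.card_eq_fintype_card]; rfl
  -- With second countability this gives the σ-compactness required by the partition of unity.
  have : LocallyCompactSpace N := Manifold.locallyCompact_of_finiteDimensional 𝓘(ℝ, E)
  have hopen : ∀ y, IsOpen {z | p z ∈ (c (p y)).dom ∧ t (p y) z = t (p y) y} := by
    intro y
    rw [isOpen_iff_mem_nhds]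
    rintro z ⟨hz1, hz2⟩
    filter_upwards [ht (p y) z hz1,
      hp.continuous.continuousAt.preimage_mem_nhds ((c (p y)).isOpen_dom.mem_nhds hz1)] with w hw hw'
    exact ⟨hw', hw.trans hz2⟩
  -- Each frame is untwisted by its fibre coordinate, and its domain is cut down to where this
  -- coordinate is constant.
  refine hasFormsOfCurvature_of_positive
    (fun y => ((c (p y)).twist (t (p y) y)⁻¹).pullback p hpd _ (hopen y) fun z hz => hz.1)
    (fun y => ⟨hxa (p y), rfl⟩) (fun x z y hx hz => ?_) fun x z y hx hz => ?_
  · obtain ⟨g, hg, h⟩ := hiso _ _ _ hx.1 hz.1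
    exact ⟨g, hg, hp.continuous.continuousAt.eventually h⟩
  · have h1 := LocalFrame.sameDirections_transition hx.1 hz.1 (hiso _ _ _ hx.1 hz.1)
    -- The transition takes one coordinate to the other, so the inverse coordinates absorb it and
    -- the oriented directions agree.
    have h2 : ((c (p x)).twist (t (p x) y)⁻¹).SameDirections ((c (p z)).twist (t (p z) y)⁻¹) (p y) := by
      have h3 := h1.twist (t (p z) y)⁻¹
      have h4 := (LocalFrame.sameDirections_twist_mul _ _).symm.trans h3
      rw [htrans (p x) (p z) y hx.1 hz.1, mul_inv_rev] at h4 ⊢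
      change LocalFrame.SameDirections
        ((c (p x)).twist ((t (p x) y)⁻¹ * (Z.trans (p x) (p z) (p y))⁻¹ *
          Z.trans (p x) (p z) (p y))) _ _ at h4
      rwa [inv_mul_cancel_right] at h4
    rw [show t (p x) y = t (p x) x from hx.2, show t (p z) y = t (p z) z from hz.2] at h2
    obtain ⟨s, hs, h3, -⟩ := h2
    refine ⟨s, hs, ?_⟩
    ext v
    exact (LocalFrame.form₁_pullback _ p hpd _ _ _ hz v).trans ((h3 _).trans
      (congrArg (s * ·) (LocalFrame.form₁_pullback _ p hpd _ _ _ hx v).symm))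

end Cover

/-! ### The Minkowski plane and the de Sitter surface -/

section StandardModels

/-- The bilinear form of the Lorentzian quadratic form. -/
def lorentzBilin (m : ℕ) : (Fin (m + 1) → ℝ) →L[ℝ] (Fin (m + 1) → ℝ) →L[ℝ] ℝ :=
  ∑ i, (Fin.cons (-1) (fun _ => 1) : Fin (m + 1) → ℝ) i •
    (ContinuousLinearMap.proj (R := ℝ) (φ := fun _ : Fin (m + 1) => ℝ) i).smulRight
      (ContinuousLinearMap.proj (R := ℝ) (φ := fun _ : Fin (m + 1) => ℝ) i)

theorem lorentzBilin_apply (m : ℕ) (u v : Fin (m + 1) → ℝ) : lorentzBilin m u v =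
    ∑ i, (Fin.cons (-1) (fun _ => 1) : Fin (m + 1) → ℝ) i * (u i * v i) := by
  simp [lorentzBilin]

theorem lorentzBilin_symm (m : ℕ) (u v : Fin (m + 1) → ℝ) :
    lorentzBilin m u v = lorentzBilin m v u := by
  simp only [lorentzBilin_apply, mul_comm (u _)]

theorem lorentzForm_apply (m : ℕ) (u : Fin (m + 1) → ℝ) : lorentzForm m u = lorentzBilin m u u := by
  rw [lorentzForm, QuadraticMap.weightedSumSquares_apply, lorentzBilin_apply]
  simp only [smul_eq_mul]

/-- The standard Lorentzian model, of curvature `0` or `1`. -/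
def standardModel (m : ℕ) (κ : ℝ) (hκ : κ * κ = κ) : LorentzModel (Fin (m + 1) → ℝ) where
  form := lorentzBilin m
  κ := κ
  symm := lorentzBilin_symm m
  nondeg u h := by
    funext j
    have hj := h (Pi.single j 1)
    rw [lorentzBilin_apply, Finset.sum_eq_single j (fun i _ hi => by simp [hi]) (by simp)] at hj
    refine Fin.cases (fun hj => ?_) (fun i hj => ?_) j hj <;> simpa using hj
  κ_mul_self := hκ

theorem lorentzBilin_eq_of_lorentzForm {m : ℕ} {A : (Fin (m + 1) → ℝ) →L[ℝ] (Fin (m + 1) → ℝ)}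
    (h : ∀ u, lorentzForm m (A u) = lorentzForm m u) (u v : Fin (m + 1) → ℝ) :
    lorentzBilin m (A u) (A v) = lorentzBilin m u v := by
  have h1 := h (u + v)
  have h2 := h u
  have h3 := h v
  simp only [lorentzForm_apply, map_add, add_apply] at h1 h2 h3
  rw [lorentzBilin_symm m (A v) (A u), lorentzBilin_symm m v u] at h1
  linarith

/-- A linear map preserving a nondegenerate form is injective, hence invertible in finite dimension;
the converse is polarization. -/
theorem mem_isometries_standardModel {m : ℕ} {κ : ℝ} (hκ : κ * κ = κ)
    (g : (Fin (m + 1) → ℝ) → (Fin (m + 1) → ℝ)) : g ∈ (standardModel m κ hκ).isometries ↔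
      ∃ (A : (lorentzForm m).IsometryEquiv (lorentzForm m)) (b : Fin (m + 1) → ℝ), κ • b = 0 ∧
        ∀ x, g x = A x + b := by
  constructor
  · rintro ⟨A, b, hA, hb, hg⟩
    have hinj : Function.Injective A.toLinearMap := by
      rw [← LinearMap.ker_eq_bot, LinearMap.ker_eq_bot']
      intro u hu
      refine (standardModel m κ hκ).nondeg u fun v => ?_
      rw [← hA, show A u = 0 from hu, map_zero, zero_apply]
    exact ⟨⟨LinearEquiv.ofInjectiveEndo A.toLinearMap hinj, fun u => by
      rw [lorentzForm_apply, lorentzForm_apply]; exact hA u u⟩, b, hb, hg⟩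
  · rintro ⟨A, b, hb, hg⟩
    refine ⟨LinearMap.toContinuousLinearMap (A.toLinearEquiv : (Fin (m + 1) → ℝ) →ₗ[ℝ] _), b,
      lorentzBilin_eq_of_lorentzForm fun u => A.map_app u, hb, hg⟩

/-- The Minkowski plane. -/
abbrev minkowskiModel : LorentzModel (Fin 2 → ℝ) := standardModel 1 0 (by norm_num)

/-- The de Sitter surface. -/
abbrev deSitterModel : LorentzModel (Fin 3 → ℝ) := standardModel 2 1 (by norm_num)

theorem minkowskiModel_space : minkowskiModel.space = univ :=
  eq_univ_of_forall fun x => zero_mul (lorentzBilin 1 x x)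

theorem minkowskiModel_isometries : minkowskiModel.isometries = minkowskiIsometries := by
  ext g
  rw [mem_isometries_standardModel]
  simp [minkowskiIsometries]

theorem deSitterModel_space : deSitterModel.space = deSitterSurface := by
  ext x
  change 1 * lorentzBilin 2 x x = 1 ↔ lorentzForm 2 x = 1
  rw [one_mul, lorentzForm_apply]

theorem deSitterModel_isometries : deSitterModel.isometries = deSitterIsometries := by
  ext g
  rw [mem_isometries_standardModel]
  simp [deSitterIsometries]

theorem lorentzBilin_one (u v : Fin 2 → ℝ) : lorentzBilin 1 u v = -(u 0 * v 0) + u 1 * v 1 := by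
  simp [lorentzBilin_apply, Fin.sum_univ_succ]

theorem lorentzBilin_two (u v : Fin 3 → ℝ) :
    lorentzBilin 2 u v = -(u 0 * v 0) + u 1 * v 1 + u 2 * v 2 := by
  simp [lorentzBilin_apply, Fin.sum_univ_succ]
  ring

theorem isNullFrame_minkowskiModel (x : Fin 2 → ℝ) :
    minkowskiModel.IsNullFrame x ![1, 1] ![-1 / 2, 1 / 2] where
  null₁ := by change lorentzBilin 1 _ _ = 0; simp [lorentzBilin_one]
  null₂ := by change lorentzBilin 1 _ _ = 0; simp [lorentzBilin_one]; norm_num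
  pair := by change lorentzBilin 1 _ _ = 1; simp [lorentzBilin_one]; norm_num
  orth₁ := zero_mul _
  orth₂ := zero_mul _
  norm := zero_mul _
  expand u v := by
    change lorentzBilin 1 _ _ = 0 * _ + lorentzBilin 1 _ _ * lorentzBilin 1 _ _ +
      lorentzBilin 1 _ _ * lorentzBilin 1 _ _
    simp [lorentzBilin_one]
    ring

/-- The first null direction of the de Sitter surface. -/
def deSitterLeft (x : Fin 3 → ℝ) : Fin 3 → ℝ :=
  ![1 + x 0 ^ 2, x 0 * x 1 + x 2, x 0 * x 2 - x 1]

/-- The second null direction of the de Sitter surface. -/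
def deSitterRight (x : Fin 3 → ℝ) : Fin 3 → ℝ :=
  (-(2 * (1 + x 0 ^ 2))⁻¹) • ![1 + x 0 ^ 2, x 0 * x 1 - x 2, x 0 * x 2 + x 1]

theorem contDiff_deSitterLeft : ContDiff ℝ ∞ deSitterLeft := by
  refine contDiff_pi.2 fun i => ?_
  fin_cases i <;> simp [deSitterLeft] <;> fun_prop

theorem contDiff_deSitterRight : ContDiff ℝ ∞ deSitterRight := by
  have h : ContDiff ℝ ∞ fun x : Fin 3 → ℝ => 2 * (1 + x 0 ^ 2) := by fun_prop
  refine ContDiff.smul (h.inv fun x => by positivity).neg ?_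
  refine contDiff_pi.2 fun i => ?_
  fin_cases i <;> simp <;> fun_prop

/-- The vectors are x₀x + (1, x₂, -x₁) and a multiple of x₀x + (1, -x₂, x₁), the directions of the
two rulings of the hyperboloid. Before normalization their product is -2(1 + x₀²), which explains
the factor. Each relation reduces to x₁² + x₂² = 1 + x₀². -/
theorem isNullFrame_deSitterModel (x : Fin 3 → ℝ) (hx : x ∈ deSitterModel.space) :
    deSitterModel.IsNullFrame x (deSitterLeft x) (deSitterRight x) := by
  have h : x 1 * x 1 + x 2 * x 2 = 1 + x 0 ^ 2 := by
    have h1 : 1 * lorentzBilin 2 x x = 1 := hx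
    rw [lorentzBilin_two] at h1
    linarith
  have hs : 1 + x 0 ^ 2 ≠ 0 := by positivity
  have el : ∀ u, lorentzBilin 2 u (deSitterLeft x) =
      -(u 0 * (1 + x 0 ^ 2)) + u 1 * (x 0 * x 1 + x 2) + u 2 * (x 0 * x 2 - x 1) := by
    intro u; simp [lorentzBilin_two, deSitterLeft]
  have er : ∀ u, lorentzBilin 2 u (deSitterRight x) = -(2 * (1 + x 0 ^ 2))⁻¹ *
      (-(u 0 * (1 + x 0 ^ 2)) + u 1 * (x 0 * x 1 - x 2) + u 2 * (x 0 * x 2 + x 1)) := by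
    intro u; rw [deSitterRight, map_smul]; simp [lorentzBilin_two]
  constructor
  · change lorentzBilin 2 _ _ = 0
    rw [el]
    simp [deSitterLeft]
    linear_combination (1 + x 0 ^ 2) * h
  · change lorentzBilin 2 _ _ = 0
    rw [er]
    simp [deSitterRight]
    right
    field_simp
    linear_combination (-(1 + x 0 ^ 2)) * h
  · change lorentzBilin 2 _ _ = 1
    rw [er]
    simp [deSitterLeft]
    field_simp
    linear_combination (1 - x 0 ^ 2) * h
  · change 1 * lorentzBilin 2 _ _ = 0
    rw [el]
    linear_combination x 0 * h
  · change 1 * lorentzBilin 2 _ _ = 0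
    rw [er]
    linear_combination -(2 * (1 + x 0 ^ 2))⁻¹ * x 0 * h
  · exact hx
  · intro u v
    change lorentzBilin 2 _ _ = 1 * (lorentzBilin 2 _ _ * lorentzBilin 2 _ _) +
      lorentzBilin 2 _ _ * lorentzBilin 2 _ _ + lorentzBilin 2 _ _ * lorentzBilin 2 _ _
    rw [el, el, er, er]
    simp only [lorentzBilin_two]
    field_simp
    linear_combination (-2 * (u 1 * v 1 + u 2 * v 2)) * h

variable {E : Type*} [NormedAddCommGroup E] [NormedSpace ℝ E]
  {M : Type u} [TopologicalSpace M] [ChartedSpace E M] [IsManifold 𝓘(ℝ, E) ∞ M]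
  (F : Foliation E M 2)

theorem Foliation.hasFormsOfCurvature_zero_iff : F.HasFormsOfCurvature 0 ↔ F.HasMinkowskiForms := by
  simp only [HasFormsOfCurvature, HasMinkowskiForms, zero_mul]

theorem Foliation.hasFormsOfCurvature_one_iff : F.HasFormsOfCurvature 1 ↔ F.HasDeSitterForms := by
  simp only [HasFormsOfCurvature, HasDeSitterForms, one_mul]

theorem mem_space_deSitterModel : ![0, 0, 1] ∈ deSitterModel.space := by
  change 1 * lorentzBilin 2 _ _ = 1
  simp [lorentzBilin_two]

end StandardModels

end TransverseGeometry

end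

/-! ### The two geometries as the cases of curvature zero and one -/

theorem corollary7p3 (n : ℕ) {M : Type*} [TopologicalSpace M] [T2Space M]
    [SecondCountableTopology M] [ChartedSpace (EuclideanSpace ℝ (Fin n)) M] [IsManifold (𝓡 n) ∞ M]
    (F : TransverseGeometry.Foliation (EuclideanSpace ℝ (Fin n)) M 2) :
    ((F.HasMinkowskiForms → F.IsTransverselyMinkowski) ∧
      (F.IsTransverselyMinkowski → F.HoldsUpToFourCover fun _ _ _ _ F' => F'.HasMinkowskiForms)) ∧
    ((F.HasDeSitterForms → F.IsTransverselyDeSitter) ∧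
      (F.IsTransverselyDeSitter → F.HoldsUpToFourCover fun _ _ _ _ F' => F'.HasDeSitterForms)) := by
  open TransverseGeometry in
  refine ⟨⟨fun h => ?_, fun h => ?_⟩, fun h => ?_, fun h => ?_⟩
  · have := ((F.hasFormsOfCurvature_zero_iff).2 h).hasTransverseStructure (L := minkowskiModel)
      (isNullFrame_minkowskiModel 0)
    rwa [minkowskiModel_space, minkowskiModel_isometries] at this
  · rw [Foliation.IsTransverselyMinkowski, ← minkowskiModel_space, ← minkowskiModel_isometries] at h
    simp only [← Foliation.hasFormsOfCurvature_zero_iff]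
    exact h.holdsUpToFourCover contDiff_const contDiff_const
      fun x _ => isNullFrame_minkowskiModel x
  · have := ((F.hasFormsOfCurvature_one_iff).2 h).hasTransverseStructure (L := deSitterModel)
      (isNullFrame_deSitterModel _ mem_space_deSitterModel)
    rwa [deSitterModel_space, deSitterModel_isometries] at this
  · rw [Foliation.IsTransverselyDeSitter, ← deSitterModel_space, ← deSitterModel_isometries] at h
    simp only [← Foliation.hasFormsOfCurvature_one_iff]
    exact h.holdsUpToFourCover contDiff_deSitterLeft contDiff_deSitterRight
      isNullFrame_deSitterModel
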